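/- Let $\mathbb T=[-\pi,\pi)$ denote the circle; functions on $\mathbb T$ are identified with $2\pi$-periodic functions on $\mathbb R$, and $C^\infty(\mathbb T)$ denotes the smooth ones. For $a>0$ put $$H_af(x)=\mathrm{P.V.}\int_{\mathbb R} f(x-y)\,K_a(y)\,dy,\qquad K_a(y)=\frac1{\pi y}\,\frac{a^2}{y^2+a^2},$$ where the principal value is $\lim_{\varepsilon\to0^+}\int_{|y|>\varepsilon}$. For $a,g>0$ and $\rho_0\in C^\infty(\mathbb T)$ consider $$\partial_t\rho+(g\,H_a\rho)\,\partial_x\rho=0,\qquad \rho(\cdot,0)=\rho_0. \tag{1}$$ By a smooth solution on $[0,T)$, $0<T\le\infty$, we mean a function $\rho\in C^\infty(\mathbb T\times[0,T))$ (smooth up to $t=0$) satisfying (1) on $\mathbb T\times[0,T)$. **Theorem 1.1.** Suppose $\rho_0\in C^\infty(\mathbb T)$ is not identically zero, nonnegative and even, with $\rho_0(0)=0$ and $\rho_0'\ge0$ on $[0,\pi)$ (being smooth and periodic, $\rho_0$ is automatically bounded). Let $a,g>0$. Then there are a finite time $0<T_*<\infty$ and a smooth solution $\rho$ of (1) on $[0,T_*)$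 such that: 1. every smooth solution of (1) on an interval $[0,T')$, $0<T'<\infty$, satisfies $T'\le T_*$ and coincides with $\rho$ on $[0,T')$, so $\rho$ is the unique smooth solution and $[0,T_*)$ is its maximal interval of existence; 2. $\rho$ is nonnegative and bounded on $\mathbb T\times[0,T_*)$; 3. $$\lim_{t\to T_*^-}\int_0^t\|\partial_x\rho(\cdot,s)\|_{L^\infty(\mathbb T)}\,ds=\infty.$$ In particular, (1) has no smooth solution on $[0,\infty)$. -/

import Mathlib

open Set Filter Topology MeasureTheory
open scoped ContDiff

/-- The kernel `K_a(y) = (1 / (π y)) * a² / (y² + a²)`. -/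
noncomputable def kernelK (a y : ℝ) : ℝ :=
  1 / (Real.pi * y) * (a ^ 2 / (y ^ 2 + a ^ 2))

/-- `IsHa a f x v` says that the principal value
`P.V. ∫_ℝ f (x - y) K_a(y) dy = lim_{ε → 0+} ∫_{|y| > ε} f (x - y) K_a(y) dy`
exists and equals `v`, that is, `(H_a f)(x) = v`. Such a `v` is unique. For bounded continuous `f`
each truncated integral converges absolutely, since `K_a(y) = O(|y|⁻³)` at infinity. -/
def IsHa (a : ℝ) (f : ℝ → ℝ) (x v : ℝ) : Prop :=
  Tendsto (fun ε : ℝ => ∫ y in {y : ℝ | ε < |y|}, f (x - y) * kernelK a y) (𝓝[>] 0) (𝓝 v)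

/-- The function `f` belongs to `C^∞(𝕋)`: a smooth `2π`-periodic function on the real line. -/
structure IsSmoothPeriodic (f : ℝ → ℝ) : Prop where
  smooth : ContDiff ℝ ∞ f
  periodic : Function.Periodic f (2 * Real.pi)

/-- The supremum norm, which is the `L^∞` norm for the continuous periodic functions
to which it is applied. -/
noncomputable def supNorm (f : ℝ → ℝ) : ℝ := ⨆ x : ℝ, |f x|

/-- `ρ` (with `ρ t x` the value at time `t` and position `x`) is a solution in
`C^∞(𝕋 × [0, T))`, with `T > 0`, of
`∂ₜ ρ + (g H_a ρ) ∂ₓ ρ = 0`, `ρ(·, 0) = ρ₀`.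
The time derivative at `t = 0` is one-sided. Values of `ρ t` for `t` outside `[0, T)`
play no role. -/
structure IsSmoothSolution (a g : ℝ) (ρ₀ : ℝ → ℝ) (T : ℝ) (ρ : ℝ → ℝ → ℝ) : Prop where
  pos : 0 < T
  smooth : ContDiffOn ℝ ∞ (fun p : ℝ × ℝ => ρ p.1 p.2) (Ico 0 T ×ˢ univ)
  periodic : ∀ t ∈ Ico 0 T, Function.Periodic (ρ t) (2 * Real.pi)
  initial : ∀ x, ρ 0 x = ρ₀ x
  equation : ∀ t ∈ Ico 0 T, ∀ x, ∃ v, IsHa a (ρ t) x v ∧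
    HasDerivWithinAt (fun s => ρ s x) (-(g * v * deriv (ρ t) x)) (Ico 0 T) t

/-! For an even profile that is nondecreasing on `[0, π]`, the velocity `g H_a ρ` is odd, vanishes
at `0` and `π`, and is nonpositive between them, so the profile is compressed towards the origin
while its values at `0` and `π` stay frozen. A minimum principle for `∂ₓρ` (`IsSol.D_nonneg`)
preserves monotonicity, which gives the bounds `0 ≤ ρ ≤ ρ₀(π)`.

Blow-up is seen by the functional `J f = ∫₀^π (f(x) - f(0)) cot(x/2) dx`, finite for every smooth
`f`. Folding the line onto one period and using that `K_a` decreases on the half-line, `-H_a f` on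
`[0, π]` dominates a positive multiple of the same expression with kernel `cot(y/2)`, a periodic
Hilbert transform (`IsEven.mul_integral_cotHalf_le`). For the cotangent kernel, elementary
trigonometry and two integrations by parts bound `-∫ H f · f' cot(x/2)` below by a multiple of `∫ (f
cot(x/2))²`, hence of `(J f)²` by Cauchy–Schwarz. Thus `J' ≥ κ J²` along a solution
(`IsEven.riccati_mul_le`). Since `J ρ₀ > 0`, no even solution curve lives longer than `1 / (κ J
ρ₀)`.

The rest is well-posedness. Fourier series show that `H_a` is bounded on `L²`: its multiplier is at
most `2` in modulus because `K_a(y)` is odd, decreasing for `y > 0`, and at most `1/(πy)` there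
(`norm_H_le`). Integration by parts in the transport term then closes an `H²` energy estimate
without losing derivatives. Galerkin approximation in even trigonometric polynomials, bounds on all
higher norms over the same time interval, and a Cauchy estimate in `L²` produce a local solution
whose lifespan depends only on the `H²` energy (`exists_local_solution`). The `L²` estimate for a
difference gives uniqueness among all smooth solutions, even or not
(`IsSmoothSolution.eq_of_isSol`).

A logarithmic bound for `‖H_a ∂ₓρ‖_∞` keeps the energy finite as long as `∫ ‖∂ₓρ‖_∞` is bounded
(`IsSol.energy_le_of_integral_le`), so the solution can then be continued. Gluing the local
solutions yields a maximal one. Its lifetime is finite by the Riccati inequality, and at that time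
the integral must diverge. -/

/-! ### Smooth periodic functions with the `L²` inner product -/

/-- The algebra of smooth `2π`-periodic functions. -/
def smoothPeriodicSubalgebra : Subalgebra ℝ (ℝ → ℝ) where
  carrier := {f | IsSmoothPeriodic f}
  mul_mem' := fun hf hg => ⟨hf.smooth.mul hg.smooth, hf.periodic.mul hg.periodic⟩
  add_mem' := fun hf hg => ⟨hf.smooth.add hg.smooth, hf.periodic.add hg.periodic⟩
  algebraMap_mem' := fun _ => ⟨contDiff_const, fun _ => rfl⟩

/-- Smooth `2π`-periodic functions, to be normed by the `L²` norm over a period. -/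
def SP : Type := smoothPeriodicSubalgebra

namespace SP

noncomputable instance : CommRing SP := inferInstanceAs (CommRing smoothPeriodicSubalgebra)
noncomputable instance : Algebra ℝ SP := inferInstanceAs (Algebra ℝ smoothPeriodicSubalgebra)

instance : FunLike SP ℝ ℝ where
  coe f := f.1
  coe_injective := fun _ _ h => Subtype.ext h

theorem isSmoothPeriodic (f : SP) : IsSmoothPeriodic f := f.2

/-- A smooth periodic function as an element of `SP`. -/
def mk (f : ℝ → ℝ) (hf : IsSmoothPeriodic f) : SP := ⟨f, hf⟩

@[simp] theorem mk_apply (f : ℝ → ℝ) (hf : IsSmoothPeriodic f) (x : ℝ) : mk f hf x = f x := rfl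
@[simp] theorem coe_mk (f : ℝ → ℝ) (hf : IsSmoothPeriodic f) : ⇑(mk f hf) = f := rfl
@[simp] theorem add_apply (f g : SP) (x : ℝ) : (f + g) x = f x + g x := rfl
@[simp] theorem sub_apply (f g : SP) (x : ℝ) : (f - g) x = f x - g x := rfl
@[simp] theorem neg_apply (f : SP) (x : ℝ) : (-f) x = -f x := rfl
@[simp] theorem mul_apply (f g : SP) (x : ℝ) : (f * g) x = f x * g x := rfl
@[simp] theorem smul_apply (c : ℝ) (f : SP) (x : ℝ) : (c • f) x = c * f x := rfl
@[simp] theorem zero_apply (x : ℝ) : (0 : SP) x = 0 := rfl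
@[simp] theorem one_apply (x : ℝ) : (1 : SP) x = 1 := rfl

@[ext] theorem ext {f g : SP} (h : ∀ x, f x = g x) : f = g := DFunLike.ext _ _ h

/-- Evaluation at a point. -/
def eval (x : ℝ) : SP →ₗ[ℝ] ℝ where
  toFun f := f x
  map_add' _ _ := rfl
  map_smul' _ _ := rfl

@[simp] theorem eval_apply (x : ℝ) (f : SP) : eval x f = f x := rfl

theorem contDiff (f : SP) : ContDiff ℝ ∞ f := f.isSmoothPeriodic.smooth
theorem periodic (f : SP) : Function.Periodic f (2 * Real.pi) := f.isSmoothPeriodic.periodic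
@[fun_prop] theorem continuous (f : SP) : Continuous f := f.contDiff.continuous
theorem differentiable (f : SP) : Differentiable ℝ f := f.contDiff.differentiable (by simp)
theorem intervalIntegrable (f : SP) (a b : ℝ) : IntervalIntegrable f volume a b :=
  f.continuous.intervalIntegrable a b

theorem _root_.IsSmoothPeriodic.deriv {f : ℝ → ℝ} (hf : IsSmoothPeriodic f) :
    IsSmoothPeriodic (deriv f) where
  smooth := (contDiff_infty_iff_deriv.1 hf.smooth).2
  periodic := fun x => by
    have : f = fun y => f (y + 2 * Real.pi) := funext fun y => (hf.periodic y).symm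
    conv_rhs => rw [this]
    rw [deriv_comp_add_const]

/-- The derivative. -/
noncomputable def D : SP →ₗ[ℝ] SP where
  toFun f := mk (deriv f) f.isSmoothPeriodic.deriv
  map_add' f g := by
    ext x
    exact deriv_add (f.differentiable x) (g.differentiable x)
  map_smul' c f := by
    ext x
    exact deriv_const_mul c (f.differentiable x)

theorem D_apply (f : SP) (x : ℝ) : D f x = deriv f x := rfl
theorem coe_D (f : SP) : ⇑(D f) = deriv f := rfl

theorem hasDerivAt (f : SP) (x : ℝ) : HasDerivAt f (D f x) x := (f.differentiable x).hasDerivAt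

theorem D_eq_of_hasDerivAt {f g : SP} (h : ∀ x, HasDerivAt f (g x) x) : D f = g :=
  ext fun x => (h x).deriv

theorem D_mul (f g : SP) : D (f * g) = D f * g + f * D g :=
  D_eq_of_hasDerivAt fun x => (f.hasDerivAt x).mul (g.hasDerivAt x)

/-- The integral over a period. -/
noncomputable def integral : SP →ₗ[ℝ] ℝ where
  toFun f := ∫ x in (-Real.pi)..Real.pi, f x
  map_add' f g := intervalIntegral.integral_add (f.intervalIntegrable _ _) (g.intervalIntegrable _ _)
  map_smul' c _ := intervalIntegral.integral_const_mul c _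

theorem integral_def (f : SP) : integral f = ∫ x in (-Real.pi)..Real.pi, f x := rfl

theorem neg_pi_lt_pi : -Real.pi < Real.pi := by linarith [Real.pi_pos]

theorem integral_nonneg {f : SP} (h : ∀ x, 0 ≤ f x) : 0 ≤ integral f :=
  intervalIntegral.integral_nonneg neg_pi_lt_pi.le fun x _ => h x

theorem integral_mono {f g : SP} (h : ∀ x, f x ≤ g x) : integral f ≤ integral g := by
  have := integral_nonneg (f := g - f) fun x => sub_nonneg.2 (h x)
  rw [map_sub] at this
  linarith

theorem integral_D (f : SP) : integral (D f) = 0 := by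
  rw [integral_def, intervalIntegral.integral_eq_sub_of_hasDerivAt (f := f) (fun x _ => f.hasDerivAt x)
    ((D f).intervalIntegrable _ _)]
  have := f.periodic (-Real.pi)
  rw [← this]
  ring_nf

theorem exists_mem_Icc (f : SP) (x : ℝ) : ∃ y ∈ Icc (-Real.pi) Real.pi, f x = f y := by
  obtain ⟨y, hy, h⟩ := f.periodic.exists_mem_Ico (by positivity) x (-Real.pi)
  exact ⟨y, ⟨hy.1, by linarith [hy.2]⟩, h⟩

theorem eq_zero_of_integral_sq {f : SP} (h : integral (f * f) = 0) : f = 0 := by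
  have key : ∀ y ∈ Icc (-Real.pi) Real.pi, f y = 0 := by
    intro y hy
    by_contra hne
    have hpos : 0 < ∫ x in (-Real.pi)..Real.pi, (f * f) x :=
      intervalIntegral.integral_pos neg_pi_lt_pi (f * f).continuous.continuousOn
        (fun x _ => mul_self_nonneg (f x)) ⟨y, hy, mul_self_pos.2 hne⟩
    rw [← integral_def, h] at hpos
    exact lt_irrefl _ hpos
  ext x
  obtain ⟨y, hy, hxy⟩ := f.exists_mem_Icc x
  rw [hxy, key y hy, zero_apply]

/-- The resulting normed space is not complete. Energy identities take place in this one norm;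
limits are taken with all the norms of `D ^ k f` controlled together. -/
noncomputable instance : InnerProductSpace.Core ℝ SP where
  inner f g := integral (f * g)
  conj_inner_symm f g := by simp [mul_comm]
  re_inner_nonneg f := integral_nonneg fun x => mul_self_nonneg (f x)
  add_left f g h := by simp [add_mul]
  smul_left f g c := by simp
  definite f := eq_zero_of_integral_sq

noncomputable instance : NormedAddCommGroup SP := InnerProductSpace.Core.toNormedAddCommGroup (𝕜 := ℝ)
noncomputable instance : InnerProductSpace ℝ SP := InnerProductSpace.ofCore inferInstance

theorem inner_def (f g : SP) : inner ℝ f g = integral (f * g) := rfl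

theorem norm_sq (f : SP) : ‖f‖ ^ 2 = integral (f * f) := by
  rw [← real_inner_self_eq_norm_sq, inner_def]

theorem inner_mul_left (p f g : SP) : inner ℝ (p * f) g = inner ℝ f (p * g) := by
  simp only [inner_def]; congr 1; ring

theorem inner_D_left (f g : SP) : inner ℝ (D f) g = -inner ℝ f (D g) := by
  have := integral_D (f * g)
  rw [D_mul, map_add] at this
  simp only [inner_def]
  linarith

/-- Integration by parts moves the derivative onto the coefficient. This is why the transport term
costs no derivative of `w` in an energy estimate. -/
theorem inner_mul_D (p w : SP) : inner ℝ w (p * D w) = -(1 / 2) * inner ℝ w (D p * w) := by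
  have h1 : inner ℝ w (p * D w) = inner ℝ (p * w) (D w) := (inner_mul_left p w (D w)).symm
  have h2 : inner ℝ (D (p * w)) w = -inner ℝ (p * w) (D w) := inner_D_left _ _
  rw [D_mul, inner_add_left, real_inner_comm, inner_mul_left p (D w) w] at h2
  have h3 : inner ℝ (D w) (p * w) = inner ℝ w (p * D w) := by
    simp only [inner_def]; congr 1; ring
  linarith

/-! ### Supremum bounds -/

theorem exists_abs_le (f : SP) : ∃ C, ∀ x, |f x| ≤ C := by
  obtain ⟨C, hC⟩ := isCompact_Icc.exists_bound_of_continuousOn (f := f)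
    (s := Icc (-Real.pi) Real.pi) f.continuous.continuousOn
  refine ⟨C, fun x => ?_⟩
  obtain ⟨y, hy, hxy⟩ := f.exists_mem_Icc x
  rw [hxy]
  exact hC y hy

theorem abs_le_supNorm (f : SP) (x : ℝ) : |f x| ≤ supNorm f := by
  obtain ⟨C, hC⟩ := f.exists_abs_le
  exact le_ciSup (f := fun x => |f x|) ⟨C, by rintro _ ⟨y, rfl⟩; exact hC y⟩ x

theorem supNorm_le {f : SP} {C : ℝ} (h : ∀ x, |f x| ≤ C) : supNorm f ≤ C := ciSup_le h

theorem supNorm_nonneg (f : SP) : 0 ≤ supNorm f := (abs_nonneg _).trans (f.abs_le_supNorm 0)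

theorem supNorm_add_le (f g : SP) : supNorm (f + g : SP) ≤ supNorm f + supNorm g :=
  supNorm_le fun x => (abs_add_le _ _).trans (add_le_add (f.abs_le_supNorm x) (g.abs_le_supNorm x))

theorem supNorm_sub_comm (f g : SP) : supNorm (f - g : SP) = supNorm (g - f : SP) := by
  simp only [supNorm, sub_apply, abs_sub_comm]

theorem abs_supNorm_sub_le (f g : SP) : |supNorm f - supNorm g| ≤ supNorm (f - g : SP) := by
  have h1 := supNorm_add_le (f - g) g
  have h2 := supNorm_add_le (g - f) f
  rw [sub_add_cancel] at h1 h2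
  rw [supNorm_sub_comm] at h2
  rw [abs_le]
  constructor <;> linarith

theorem norm_le_of_abs_le {f g : SP} (h : ∀ x, |f x| ≤ |g x|) : ‖f‖ ≤ ‖g‖ := by
  refine le_of_sq_le_sq ?_ (norm_nonneg _) 
  rw [norm_sq, norm_sq]
  refine integral_mono fun x => ?_
  simpa using abs_le_iff_mul_self_le.1 (h x)

theorem norm_mul_le (f g : SP) : ‖f * g‖ ≤ supNorm f * ‖g‖ := by
  have h := norm_le_of_abs_le (f := f * g) (g := supNorm f • g) fun x => by
    simp only [mul_apply, smul_apply, abs_mul, abs_of_nonneg f.supNorm_nonneg]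
    exact mul_le_mul_of_nonneg_right (f.abs_le_supNorm x) (abs_nonneg _)
  rwa [norm_smul, Real.norm_of_nonneg f.supNorm_nonneg] at h

theorem norm_one_sq : ‖(1 : SP)‖ ^ 2 = 2 * Real.pi := by
  rw [norm_sq, integral_def]
  simp
  ring

theorem norm_le_supNorm (f : SP) : ‖f‖ ≤ supNorm f * ‖(1 : SP)‖ := by
  simpa using norm_mul_le f 1

theorem abs_inner_mul_le (f g p : SP) : |inner ℝ f (p * g)| ≤ supNorm p * (‖f‖ * ‖g‖) :=
  (abs_real_inner_le_norm _ _).trans <| by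
    nlinarith [norm_mul_le p g, norm_nonneg f, norm_nonneg g]

end SP
-- Sobolev, Poincaré and interpolation inequalities on the circle
namespace SP

/-- Cauchy–Schwarz against `1`, read off from the nonnegative integral of the squared deviation from
the mean `m`. -/
theorem sq_integral_le {f : ℝ → ℝ} (hf : Continuous f) {a b : ℝ} (hab : a ≤ b) :
    (∫ x in a..b, f x) ^ 2 ≤ (b - a) * ∫ x in a..b, f x ^ 2 := by
  rcases hab.eq_or_lt with rfl | hlt
  · simp
  set I := ∫ x in a..b, f x with hI
  set J := ∫ x in a..b, f x ^ 2 with hJ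
  set m := I / (b - a) with hm
  have hpos : 0 < b - a := sub_pos.2 hlt
  have hnn : 0 ≤ ∫ x in a..b, (f x - m) ^ 2 :=
    intervalIntegral.integral_nonneg hab fun x _ => sq_nonneg _
  have heq : ∫ x in a..b, (f x - m) ^ 2 = J - 2 * m * I + (b - a) * m ^ 2 := by
    have : (fun x => (f x - m) ^ 2) = fun x => f x ^ 2 - 2 * m * f x + m ^ 2 := by
      ext x; ring
    rw [this, intervalIntegral.integral_add, intervalIntegral.integral_sub,
      intervalIntegral.integral_const_mul, intervalIntegral.integral_const, smul_eq_mul]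
    all_goals exact Continuous.intervalIntegrable (by fun_prop) _ _
  have hmI : m * (b - a) = I := div_mul_cancel₀ _ hpos.ne'
  have : 0 ≤ (b - a) * (J - 2 * m * I + (b - a) * m ^ 2) := mul_nonneg hpos.le (heq ▸ hnn)
  nlinarith

theorem integral_sq_le (f : SP) {a b : ℝ} (hab : a ≤ b) (hb : b ≤ a + 2 * Real.pi) :
    ∫ x in a..b, f x ^ 2 ≤ ‖f‖ ^ 2 := by
  have h1 : ∫ x in a..b, f x ^ 2 ≤ ∫ x in a..(a + 2 * Real.pi), f x ^ 2 :=
    intervalIntegral.integral_mono_interval le_rfl hab hb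
      (ae_of_all _ fun x => sq_nonneg _) (Continuous.intervalIntegrable (by fun_prop) _ _)
  have h2 := (f * f).periodic.intervalIntegral_add_eq a (-Real.pi)
  rw [norm_sq, integral_def]
  refine h1.trans (le_of_eq ?_)
  convert h2 using 2
  · ext x; simp [sq]
  · ring

theorem sq_sub_le (f : SP) {a b : ℝ} (hab : a ≤ b) (hb : b ≤ a + 2 * Real.pi) :
    (f b - f a) ^ 2 ≤ (b - a) * ‖D f‖ ^ 2 := by
  rw [← intervalIntegral.integral_eq_sub_of_hasDerivAt (f := f) (fun x _ => f.hasDerivAt x)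
    ((D f).intervalIntegrable _ _)]
  exact (sq_integral_le (D f).continuous hab).trans
    (mul_le_mul_of_nonneg_left ((D f).integral_sq_le hab hb) (sub_nonneg.2 hab))

theorem abs_sub_le (f : SP) {a b : ℝ} (hab : a ≤ b) (hb : b ≤ a + 2 * Real.pi) :
    |f b - f a| ≤ √(b - a) * ‖D f‖ := by
  refine abs_le_of_sq_le_sq ?_ (by positivity)
  rw [mul_pow, Real.sq_sqrt (sub_nonneg.2 hab)]
  exact f.sq_sub_le hab hb

/-- By periodicity the two points may be taken within `2π` of each other, and `√(2π) ≤ 3`. -/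
theorem abs_sub_le_three (f : SP) (a b : ℝ) : |f b - f a| ≤ 3 * ‖D f‖ := by
  obtain ⟨c, hc, h⟩ := f.periodic.exists_mem_Ico (by positivity) b a
  rw [h]
  refine (f.abs_sub_le hc.1 hc.2.le).trans (mul_le_mul_of_nonneg_right ?_ (norm_nonneg _))
  rw [Real.sqrt_le_left (by norm_num)]
  have := Real.pi_lt_d2
  linarith [hc.2]

/-- The circle has length greater than `1`, so some value is at most the `L²` norm; the oscillation
is controlled by the derivative. -/
theorem supNorm_le_norm_add (f : SP) : supNorm f ≤ ‖f‖ + 3 * ‖D f‖ := by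
  obtain ⟨y, hy⟩ : ∃ y, |f y| ≤ ‖f‖ := by
    by_contra! hcon
    have h1 : ∀ x, (‖f‖ ^ 2 • (1 : SP)) x ≤ (f * f) x := fun x => by
      have := (hcon x).le
      have := abs_le_abs_of_nonneg (norm_nonneg f) this
      have := abs_le_iff_mul_self_le.1 this
      simp only [abs_mul_abs_self] at this
      simpa [sq] using this
    have h2 := integral_mono h1
    have h3 : (0 : ℝ) < |f 0| := (norm_nonneg f).trans_lt (hcon 0)
    have h4 : f ≠ 0 := fun h => by simp [h] at h3
    have h5 : integral 1 = 2 * Real.pi := by rw [← norm_one_sq, norm_sq, mul_one]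
    rw [← norm_sq, map_smul, h5, smul_eq_mul] at h2
    have h6 : 0 < ‖f‖ ^ 2 := by positivity
    nlinarith [Real.pi_gt_three]
  refine supNorm_le fun x => ?_
  have h1 := f.abs_sub_le_three y x
  have h2 := abs_sub_abs_le_abs_sub (f x) (f y)
  linarith

theorem exists_D_eq_zero (f : SP) : ∃ x, D f x = 0 := by
  obtain ⟨c, -, hc⟩ := exists_deriv_eq_zero (f := f) (a := 0) (b := 2 * Real.pi) (by positivity)
    f.continuous.continuousOn (by simpa using (f.periodic 0).symm)
  exact ⟨c, hc⟩

theorem supNorm_D_le (f : SP) : supNorm (D f) ≤ 3 * ‖D (D f)‖ := by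
  obtain ⟨y, hy⟩ := f.exists_D_eq_zero
  refine supNorm_le fun x => ?_
  simpa [hy] using (D f).abs_sub_le_three y x

theorem norm_one_le : ‖(1 : SP)‖ ≤ 3 := by
  refine le_of_sq_le_sq ?_ (by norm_num)
  rw [norm_one_sq]
  linarith [Real.pi_lt_d2]

/-- A Poincaré inequality: by Rolle the derivative has a zero, which bounds its supremum by `3 ‖D (D
f)‖`, and `‖1‖ ≤ 3` converts back to `L²`. -/
theorem norm_D_le (f : SP) : ‖D f‖ ≤ 9 * ‖D (D f)‖ := by
  have h1 := norm_le_supNorm (D f)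
  have h2 := f.supNorm_D_le
  nlinarith [norm_one_le, norm_nonneg (1 : SP), supNorm_nonneg (D f)]

theorem norm_D_sq_le (f : SP) : ‖D f‖ ^ 2 ≤ ‖f‖ * ‖D (D f)‖ := by
  rw [← real_inner_self_eq_norm_sq, inner_D_left]
  exact (neg_le_abs _).trans (abs_real_inner_le_norm _ _)

/-! ### Differentiable curves -/

/-- The curve `F` has time derivative `G` at `t` within `I`, in every Sobolev norm. -/
def HasTD (F : ℝ → SP) (G : SP) (I : Set ℝ) (t : ℝ) : Prop :=
  ∀ k : ℕ, HasDerivWithinAt (fun s => (D ^ k) (F s)) ((D ^ k) G) I t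

theorem D_pow_succ (k : ℕ) (f : SP) : (D ^ (k + 1)) f = (D ^ k) (D f) := by
  rw [pow_succ]; rfl

theorem D_pow_succ' (k : ℕ) (f : SP) : (D ^ (k + 1)) f = D ((D ^ k) f) := by
  rw [pow_succ']; rfl

namespace HasTD
variable {F F₁ F₂ : ℝ → SP} {G G₁ G₂ : SP} {I : Set ℝ} {t : ℝ}

theorem hasDerivWithinAt (h : HasTD F G I t) : HasDerivWithinAt F G I t := h 0

theorem map_D (h : HasTD F G I t) : HasTD (fun s => D (F s)) (D G) I t := fun k => by
  simpa only [D_pow_succ] using h (k + 1)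

theorem add (h₁ : HasTD F₁ G₁ I t) (h₂ : HasTD F₂ G₂ I t) :
    HasTD (fun s => F₁ s + F₂ s) (G₁ + G₂) I t := fun k => by
  simpa only [map_add] using (h₁ k).fun_add (h₂ k)

theorem sub (h₁ : HasTD F₁ G₁ I t) (h₂ : HasTD F₂ G₂ I t) :
    HasTD (fun s => F₁ s - F₂ s) (G₁ - G₂) I t := fun k => by
  simpa only [map_sub] using (h₁ k).fun_sub (h₂ k)

theorem const_smul (c : ℝ) (h : HasTD F G I t) : HasTD (fun s => c • F s) (c • G) I t := fun k => by
  simpa only [map_smul] using (h k).fun_const_smul c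

theorem mono {J : Set ℝ} (h : HasTD F G I t) (hJ : J ⊆ I) : HasTD F G J t :=
  fun k => (h k).mono hJ

theorem congr_of_eventuallyEq (h : HasTD F G I t) (he : F₁ =ᶠ[𝓝[I] t] F) (ht : F₁ t = F t) :
    HasTD F₁ G I t := fun k => by
  refine (h k).congr_of_eventuallyEq (he.mono fun s hs => ?_) ?_
  · simp only [hs]
  · simp only [ht]

/-- The difference-quotient remainder is small in every Sobolev norm, so a linear map need only be
bounded for the `H²` norm. Point evaluation and `J` are unbounded in `L²` but qualify. -/
theorem map_of_bound {E : Type*} [NormedAddCommGroup E] [NormedSpace ℝ E] (h : HasTD F G I t)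
    (l : SP →ₗ[ℝ] E) (C : ℝ) (hl : ∀ f, ‖l f‖ ≤ C * (‖f‖ + ‖D f‖ + ‖D (D f)‖)) :
    HasDerivWithinAt (fun s => l (F s)) (l G) I t := by
  rw [hasDerivWithinAt_iff_isLittleO]
  have h0 := hasDerivWithinAt_iff_isLittleO.1 (h 0)
  have h1 := hasDerivWithinAt_iff_isLittleO.1 (h 1)
  have h2 := hasDerivWithinAt_iff_isLittleO.1 (h 2)
  have := ((h0.norm_left.add h1.norm_left).add h2.norm_left).const_mul_left C
  refine Asymptotics.IsBigO.trans_isLittleO (Asymptotics.IsBigO.of_norm_le fun s => ?_) this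
  have := hl (F s - F t - (s - t) • G)
  rw [map_sub, map_sub, map_smul] at this
  simp only [← map_sub, ← map_smul]
  simp only [← map_sub, ← map_smul] at this
  exact this

theorem apply (h : HasTD F G I t) (x : ℝ) : HasDerivWithinAt (fun s => F s x) (G x) I t :=
  h.map_of_bound (eval x) 3 fun f => (f.abs_le_supNorm x).trans <| f.supNorm_le_norm_add.trans <| by
    linarith [norm_nonneg f, norm_nonneg (D (D f))]

theorem map_clm (h : HasTD F G I t) (T : SP →L[ℝ] SP) (hT : ∀ f, T (D f) = D (T f)) :
    HasTD (fun s => T (F s)) (T G) I t := fun k => by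
  have hk : ∀ f, (D ^ k) (T f) = T ((D ^ k) f) := fun f => by
    induction k with
    | zero => rfl
    | succ k ih => rw [D_pow_succ', ih, D_pow_succ', hT]
  simp only [hk]
  exact T.hasFDerivAt.comp_hasDerivWithinAt t (h k)

theorem continuousWithinAt_supNorm (h : HasTD F G I t) :
    ContinuousWithinAt (fun s => supNorm (F s)) I t := by
  have h0 := (h 0).continuousWithinAt
  have h1 := (h 1).continuousWithinAt
  rw [ContinuousWithinAt, tendsto_iff_norm_sub_tendsto_zero] at *
  refine squeeze_zero (fun s => norm_nonneg _) (fun s => ?_)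
    (by simpa using h0.add (h1.const_mul 3))
  refine (abs_supNorm_sub_le _ _).trans ((supNorm_le_norm_add _).trans (le_of_eq ?_))
  rw [map_sub]

/-- Multiplication is not bounded for the `L²` norm, so the general product rule is unavailable. One
factor is measured in the supremum norm, whose continuity in time comes from the first two Sobolev
norms. -/
theorem hasDerivWithinAt_mul (h₁ : HasTD F₁ G₁ I t) (h₂ : HasTD F₂ G₂ I t) :
    HasDerivWithinAt (fun s => F₁ s * F₂ s) (G₁ * F₂ t + F₁ t * G₂) I t := by
  rw [hasDerivWithinAt_iff_isLittleO]
  have r1 := hasDerivWithinAt_iff_isLittleO.1 h₁.hasDerivWithinAt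
  have r2 := hasDerivWithinAt_iff_isLittleO.1 h₂.hasDerivWithinAt
  have hc : (fun s => supNorm (F₂ s)) =O[𝓝[I] t] fun _ => (1 : ℝ) :=
    h₂.continuousWithinAt_supNorm.tendsto.isBigO_one ℝ
  have e1 := hc.mul_isLittleO r1.norm_left
  have e2 := (r2.norm_left).const_mul_left (supNorm (F₁ t))
  have e3 : (fun s => supNorm G₁ * (‖F₂ s - F₂ t‖ * (s - t))) =o[𝓝[I] t] fun s => s - t := by
    refine Asymptotics.IsLittleO.const_mul_left ?_ _
    have : (fun s => ‖F₂ s - F₂ t‖) =o[𝓝[I] t] fun _ => (1 : ℝ) := by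
      rw [Asymptotics.isLittleO_one_iff]
      exact tendsto_iff_norm_sub_tendsto_zero.1 h₂.hasDerivWithinAt.continuousWithinAt
    simpa using this.mul_isBigO (Asymptotics.isBigO_refl (fun s => s - t) _)
  simp only [one_mul] at e1
  refine Asymptotics.IsBigO.trans_isLittleO (Asymptotics.IsBigO.of_bound 1 (.of_forall fun s => ?_))
    ((e1.add e2).add e3.norm_left)
  rw [one_mul]
  refine le_trans ?_ (le_abs_self _)
  have : F₁ s * F₂ s - F₁ t * F₂ t - (s - t) • (G₁ * F₂ t + F₁ t * G₂) =
      F₂ s * (F₁ s - F₁ t - (s - t) • G₁) + F₁ t * (F₂ s - F₂ t - (s - t) • G₂)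
        + (s - t) • (G₁ * (F₂ s - F₂ t)) := by
    ext x; simp; ring
  rw [this]
  refine (norm_add_le _ _).trans (add_le_add ((norm_add_le _ _).trans
    (add_le_add (norm_mul_le _ _) (norm_mul_le _ _))) ?_)
  have hn : ‖supNorm G₁ * (‖F₂ s - F₂ t‖ * (s - t))‖ =
      supNorm G₁ * ‖F₂ s - F₂ t‖ * ‖s - t‖ := by
    simp [abs_of_nonneg (supNorm_nonneg G₁), mul_assoc]
  rw [norm_smul, hn, mul_comm]
  exact mul_le_mul_of_nonneg_right (norm_mul_le _ _) (norm_nonneg _)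

theorem mul (h₁ : HasTD F₁ G₁ I t) (h₂ : HasTD F₂ G₂ I t) :
    HasTD (fun s => F₁ s * F₂ s) (G₁ * F₂ t + F₁ t * G₂) I t := by
  intro k
  induction k generalizing F₁ F₂ G₁ G₂ with
  | zero => exact h₁.hasDerivWithinAt_mul h₂
  | succ k ih =>
    have := (ih h₁.map_D h₂).fun_add (ih h₁ h₂.map_D)
    simp only [D_pow_succ, D_mul, map_add] at this ⊢
    exact this.congr_deriv (by abel)

end HasTD

/-- `n` times differentiable curves in `C^∞(𝕋)`. -/
def TSmooth (I : Set ℝ) : ℕ → (ℝ → SP) → Prop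
  | 0, F => ∀ k : ℕ, ContinuousOn (fun t => (D ^ k) (F t)) I
  | n + 1, F => ∃ G : ℝ → SP, (∀ t ∈ I, HasTD F (G t) I t) ∧ TSmooth I n G

namespace TSmooth
variable {I : Set ℝ} {n : ℕ} {F F₁ F₂ : ℝ → SP}

theorem of_succ (h : TSmooth I (n + 1) F) : TSmooth I n F := by
  induction n generalizing F with
  | zero =>
    obtain ⟨G, hG, -⟩ := h
    exact fun k t ht => (hG t ht k).continuousWithinAt
  | succ n ih =>
    obtain ⟨G, hG, h'⟩ := h
    exact ⟨G, hG, ih h'⟩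

theorem map_D (h : TSmooth I n F) : TSmooth I n fun t => D (F t) := by
  induction n generalizing F with
  | zero => exact fun k => by simpa only [D_pow_succ] using h (k + 1)
  | succ n ih =>
    obtain ⟨G, hG, h'⟩ := h
    exact ⟨_, fun t ht => (hG t ht).map_D, ih h'⟩

theorem const_smul (c : ℝ) (h : TSmooth I n F) : TSmooth I n fun t => c • F t := by
  induction n generalizing F with
  | zero => exact fun k => by simpa only [map_smul] using (h k).fun_const_smul c
  | succ n ih =>
    obtain ⟨G, hG, h'⟩ := h
    exact ⟨_, fun t ht => (hG t ht).const_smul c, ih h'⟩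

theorem add (h₁ : TSmooth I n F₁) (h₂ : TSmooth I n F₂) : TSmooth I n fun t => F₁ t + F₂ t := by
  induction n generalizing F₁ F₂ with
  | zero => exact fun k => by simpa only [map_add] using (h₁ k).fun_add (h₂ k)
  | succ n ih =>
    obtain ⟨G₁, hG₁, h₁'⟩ := h₁
    obtain ⟨G₂, hG₂, h₂'⟩ := h₂
    exact ⟨_, fun t ht => (hG₁ t ht).add (hG₂ t ht), ih h₁' h₂'⟩

theorem continuousOn_supNorm (h : TSmooth I 0 F) : ContinuousOn (fun t => supNorm (F t)) I := by
  intro t ht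
  have h0 := h 0 t ht
  have h1 := h 1 t ht
  rw [ContinuousWithinAt, tendsto_iff_norm_sub_tendsto_zero] at *
  refine squeeze_zero (fun s => norm_nonneg _) (fun s => ?_)
    (by simpa using h0.add (h1.const_mul 3))
  refine (abs_supNorm_sub_le _ _).trans ((supNorm_le_norm_add _).trans (le_of_eq ?_))
  rw [map_sub]

theorem continuousOn_mul (h₁ : TSmooth I 0 F₁) (h₂ : TSmooth I 0 F₂) :
    ContinuousOn (fun t => F₁ t * F₂ t) I := by
  intro t ht
  have c1 : ContinuousWithinAt F₁ I t := h₁ 0 t ht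
  have c2 : ContinuousWithinAt F₂ I t := h₂ 0 t ht
  have c3 := h₂.continuousOn_supNorm t ht
  rw [ContinuousWithinAt, tendsto_iff_norm_sub_tendsto_zero] at *
  rw [← tendsto_iff_norm_sub_tendsto_zero] at c3
  refine squeeze_zero (fun s => norm_nonneg _) (fun s => ?_)
    (by simpa using (c3.mul c1).add (c2.const_mul (supNorm (F₁ t))))
  have : F₁ s * F₂ s - F₁ t * F₂ t = F₂ s * (F₁ s - F₁ t) + F₁ t * (F₂ s - F₂ t) := by ring
  rw [this]
  exact (norm_add_le _ _).trans (add_le_add (norm_mul_le _ _) (norm_mul_le _ _))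

theorem mul (h₁ : TSmooth I n F₁) (h₂ : TSmooth I n F₂) : TSmooth I n fun t => F₁ t * F₂ t := by
  induction n generalizing F₁ F₂ with
  | zero =>
    intro k
    induction k generalizing F₁ F₂ with
    | zero => exact continuousOn_mul h₁ h₂
    | succ k ih =>
      simp only [D_pow_succ, D_mul, map_add]
      exact (ih h₁.map_D h₂).add (ih h₁ h₂.map_D)
  | succ n ih =>
    have h₁₀ := h₁.of_succ
    have h₂₀ := h₂.of_succ
    obtain ⟨G₁, hG₁, h₁'⟩ := h₁
    obtain ⟨G₂, hG₂, h₂'⟩ := h₂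
    exact ⟨_, fun t ht => (hG₁ t ht).mul (hG₂ t ht), (ih h₁' h₂₀).add (ih h₁₀ h₂')⟩

theorem map_clm (h : TSmooth I n F) (T : SP →L[ℝ] SP) (hT : ∀ f, T (D f) = D (T f)) :
    TSmooth I n fun t => T (F t) := by
  induction n generalizing F with
  | zero =>
    intro k
    have hk : ∀ f, (D ^ k) (T f) = T ((D ^ k) f) := fun f => by
      induction k with
      | zero => rfl
      | succ k ih => rw [D_pow_succ', ih, D_pow_succ', hT]
    simp only [hk]
    exact T.continuous.comp_continuousOn (h k)
  | succ n ih =>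
    obtain ⟨G, hG, h'⟩ := h
    exact ⟨_, fun t ht => (hG t ht).map_clm T hT, ih h'⟩

theorem continuousOn_uncurry (h : TSmooth I 0 F) :
    ContinuousOn (fun p : ℝ × ℝ => F p.1 p.2) (I ×ˢ univ) := by
  rintro ⟨t, x⟩ ⟨ht, -⟩
  have c0 : ContinuousWithinAt (fun p : ℝ × ℝ => ‖F p.1 - F t‖ + 3 * ‖D (F p.1) - D (F t)‖
      + |F t p.2 - F t x|) (I ×ˢ univ) (t, x) := by
    have hfst : ContinuousWithinAt (fun p : ℝ × ℝ => p.1) (I ×ˢ univ) (t, x) :=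
      continuous_fst.continuousWithinAt
    have hm : MapsTo (fun p : ℝ × ℝ => p.1) (I ×ˢ univ) I := fun p hp => hp.1
    have h0 := ContinuousWithinAt.comp (t := I) (h 0 t ht) hfst hm
    have h1 := ContinuousWithinAt.comp (t := I) (h 1 t ht) hfst hm
    have hs : ContinuousWithinAt (fun p : ℝ × ℝ => F t p.2) (I ×ˢ univ) (t, x) :=
      ((F t).continuous.comp continuous_snd).continuousWithinAt
    exact ((h0.sub continuousWithinAt_const).norm.add
      ((h1.sub continuousWithinAt_const).norm.const_mul 3)).add (hs.sub continuousWithinAt_const).abs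
  rw [ContinuousWithinAt, tendsto_iff_norm_sub_tendsto_zero] 
  have c1 := c0.tendsto
  simp only [sub_self, norm_zero, mul_zero, add_zero, abs_zero] at c1
  refine squeeze_zero (fun s => norm_nonneg _) (fun p => ?_) c1
  have e1 := ((F p.1 - F t).abs_le_supNorm p.2).trans (supNorm_le_norm_add _)
  rw [map_sub, sub_apply] at e1
  exact (_root_.abs_sub_le _ (F t p.2) _).trans (by linarith)

/-- The remainder splits into a time remainder, uniform in `x` by Sobolev embedding, a space
remainder at the fixed time `t`, and a cross term that is small by continuity of `G t`. -/
theorem hasFDerivWithinAt_uncurry {G : ℝ → SP} (hG : ∀ t ∈ I, HasTD F (G t) I t) {t : ℝ} (ht : t ∈ I) (x : ℝ) :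
    HasFDerivWithinAt (fun p : ℝ × ℝ => F p.1 p.2)
      (G t x • ContinuousLinearMap.fst ℝ ℝ ℝ + D (F t) x • ContinuousLinearMap.snd ℝ ℝ ℝ)
      (I ×ˢ univ) (t, x) := by
  rw [hasFDerivWithinAt_iff_isLittleO]
  have hfst : Tendsto (fun p : ℝ × ℝ => p.1) (𝓝[I ×ˢ univ] (t, x)) (𝓝[I] t) := by
    rw [nhdsWithin_prod_eq]; exact tendsto_fst
  have hsnd : Tendsto (fun p : ℝ × ℝ => p.2) (𝓝[I ×ˢ univ] (t, x)) (𝓝 x) :=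
    (continuous_snd.tendsto _).mono_left nhdsWithin_le_nhds
  have o1 : (fun p : ℝ × ℝ => p.1 - t) =O[𝓝[I ×ˢ univ] (t, x)] fun p => p - (t, x) :=
    Asymptotics.IsBigO.of_bound 1 (.of_forall fun p => by simpa using norm_fst_le (p - (t, x)))
  have o2 : (fun p : ℝ × ℝ => p.2 - x) =O[𝓝[I ×ˢ univ] (t, x)] fun p => p - (t, x) :=
    Asymptotics.IsBigO.of_bound 1 (.of_forall fun p => by simpa using norm_snd_le (p - (t, x)))
  have h0 := ((hasDerivWithinAt_iff_isLittleO.1 (hG t ht 0)).comp_tendsto hfst).trans_isBigO o1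
  have h1 := ((hasDerivWithinAt_iff_isLittleO.1 (hG t ht 1)).comp_tendsto hfst).trans_isBigO o1
  have h2 : (fun p : ℝ × ℝ => F t p.2 - F t x - (p.2 - x) * D (F t) x)
      =o[𝓝[I ×ˢ univ] (t, x)] fun p => p - (t, x) :=
    ((hasDerivAt_iff_isLittleO.1 ((F t).hasDerivAt x)).comp_tendsto hsnd).trans_isBigO o2
  have h3 : (fun p : ℝ × ℝ => (G t p.2 - G t x) * (p.1 - t))
      =o[𝓝[I ×ˢ univ] (t, x)] fun p => p - (t, x) := by
    have : (fun p : ℝ × ℝ => G t p.2 - G t x) =o[𝓝[I ×ˢ univ] (t, x)] fun _ => (1 : ℝ) := by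
      rw [Asymptotics.isLittleO_one_iff]
      have := ((G t).continuous.tendsto x).comp hsnd
      simpa using this.sub_const (G t x)
    simpa using Asymptotics.IsBigO.trans_isLittleO (Asymptotics.isBigO_refl _ _) (this.mul_isBigO o1.norm_right)
  refine Asymptotics.IsBigO.trans_isLittleO (Asymptotics.IsBigO.of_bound 1 (.of_forall fun p => ?_))
    (((h0.norm_left.add (h1.norm_left.const_mul_left 3)).add h2.norm_left).add h3.norm_left)
  rw [one_mul]
  refine le_trans ?_ (le_abs_self _)
  have e1 := ((F p.1 - F t - (p.1 - t) • G t).abs_le_supNorm p.2).trans (supNorm_le_norm_add _)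
  have e2 : F p.1 p.2 - F t x - (G t x • ContinuousLinearMap.fst ℝ ℝ ℝ
      + D (F t) x • ContinuousLinearMap.snd ℝ ℝ ℝ) (p - (t, x)) =
      (F p.1 - F t - (p.1 - t) • G t) p.2 + (F t p.2 - F t x - (p.2 - x) * D (F t) x)
        + (G t p.2 - G t x) * (p.1 - t) := by
    simp; ring
  rw [e2]
  refine (norm_add_le _ _).trans (add_le_add ((norm_add_le _ _).trans (add_le_add ?_ le_rfl)) le_rfl)
  rw [map_sub, map_sub, map_smul] at e1
  exact e1

theorem contDiffOn (hI : UniqueDiffOn ℝ I) (h : TSmooth I n F) :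
    ContDiffOn ℝ n (fun p : ℝ × ℝ => F p.1 p.2) (I ×ˢ univ) := by
  induction n generalizing F with
  | zero => exact contDiffOn_zero.2 h.continuousOn_uncurry
  | succ n ih =>
    have h₀ := h.of_succ.map_D
    obtain ⟨G, hG, h'⟩ := h
    rw [Nat.cast_succ, contDiffOn_succ_iff_hasFDerivWithinAt_of_uniqueDiffOn
      (hI.prod uniqueDiffOn_univ)]
    refine ⟨by simp, fun p => G p.1 p.2 • ContinuousLinearMap.fst ℝ ℝ ℝ
      + D (F p.1) p.2 • ContinuousLinearMap.snd ℝ ℝ ℝ, ?_, fun p hp =>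
      hasFDerivWithinAt_uncurry hG hp.1 p.2⟩
    exact ((ih h').smul contDiffOn_const).add ((ih h₀).smul contDiffOn_const)

end TSmooth
end SP

/-! ### The kernel -/

theorem kernelK_neg (a y : ℝ) : kernelK a (-y) = -kernelK a y := by
  simp [kernelK]

theorem kernelK_nonneg (a : ℝ) {y : ℝ} (hy : 0 < y) : 0 ≤ kernelK a y := by
  unfold kernelK; positivity

@[fun_prop] theorem measurable_kernelK (a : ℝ) : Measurable (kernelK a) := by
  unfold kernelK; fun_prop

/-- The function `y K_a(y)`. -/
noncomputable def kernelW (a y : ℝ) : ℝ := Real.pi⁻¹ * (a ^ 2 / (y ^ 2 + a ^ 2))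

theorem mul_kernelK (a : ℝ) {y : ℝ} (hy : y ≠ 0) : y * kernelK a y = kernelW a y := by
  unfold kernelK kernelW
  have := Real.pi_ne_zero
  field_simp

theorem kernelW_nonneg (a y : ℝ) : 0 ≤ kernelW a y := by
  unfold kernelW; positivity

theorem kernelW_le (a y : ℝ) : kernelW a y ≤ Real.pi⁻¹ := by
  unfold kernelW
  refine mul_le_of_le_one_right (by positivity) (div_le_one_of_le₀ ?_ (by positivity))
  nlinarith [sq_nonneg y]

theorem integrable_kernelW (a : ℝ) : Integrable (kernelW a) := by
  unfold kernelW
  refine Integrable.const_mul ?_ _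
  rcases eq_or_ne a 0 with rfl | ha
  · simp
  have := (integrable_inv_one_add_sq).comp_div ha
  refine this.congr (ae_of_all _ fun y => ?_)
  simp only
  field_simp
  ring

theorem kernelK_eq (a : ℝ) {y : ℝ} (hy : y ≠ 0) : kernelK a y = kernelW a y / y := by
  rw [← mul_kernelK a hy, mul_div_cancel_left₀ _ hy]

theorem integrableOn_kernelK (a : ℝ) {ε : ℝ} (hε : 0 < ε) : IntegrableOn (kernelK a) (Ioi ε) := by
  refine ((integrable_kernelW a).integrableOn.const_mul ε⁻¹).mono'
    (measurable_kernelK a).aestronglyMeasurable ?_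
  filter_upwards [ae_restrict_mem measurableSet_Ioi] with y hy
  have hy0 : 0 < y := hε.trans hy
  rw [Real.norm_of_nonneg (kernelK_nonneg a hy0), kernelK_eq a hy0.ne', div_eq_inv_mul]
  exact mul_le_mul_of_nonneg_right (inv_anti₀ hε (le_of_lt hy)) (kernelW_nonneg a y)

theorem setIntegral_Ioi_split {g : ℝ → ℝ} {c d : ℝ} (hcd : c ≤ d) (hg : IntegrableOn g (Ioi c)) :
    ∫ y in Ioi c, g y = (∫ y in Ioc c d, g y) + ∫ y in Ioi d, g y := by
  rw [← Ioc_union_Ioi_eq_Ioi hcd, setIntegral_union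
    (Set.disjoint_left.2 fun y h1 h2 => absurd h1.2 (not_le.2 h2) : Disjoint (Ioc c d) (Ioi d))
    measurableSet_Ioi (hg.mono_set Ioc_subset_Ioi_self) (hg.mono_set (Ioi_subset_Ioi hcd))]

/-! ### The operator `H_a` -/

namespace SP

theorem abs_sub_le_supNorm (f : SP) (x y : ℝ) : |f y - f x| ≤ supNorm (D f) * |y - x| :=
  convex_univ.norm_image_sub_le_of_norm_hasDerivWithin_le (f := f) (f' := D f)
    (fun z _ => (f.hasDerivAt z).hasDerivWithinAt) (fun z _ => (D f).abs_le_supNorm z)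
    (mem_univ x) (mem_univ y)

/-- The operator `H_a`, as an absolutely convergent integral. -/
noncomputable def Hfun (a : ℝ) (f : SP) (x : ℝ) : ℝ :=
  ∫ y in Ioi 0, (f (x - y) - f (x + y)) * kernelK a y

theorem norm_integrand_le (a : ℝ) (f : SP) (x : ℝ) {y : ℝ} (hy : 0 < y) :
    ‖(f (x - y) - f (x + y)) * kernelK a y‖ ≤ 2 * supNorm (D f) * kernelW a y := by
  have h := f.abs_sub_le_supNorm (x + y) (x - y)
  rw [norm_mul, Real.norm_of_nonneg (kernelK_nonneg a hy), ← mul_kernelK a hy.ne', Real.norm_eq_abs]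
  have e : |x - y - (x + y)| = 2 * y := by
    rw [show x - y - (x + y) = -(2 * y) by ring, abs_neg, abs_of_pos (by linarith)]
  rw [e] at h
  nlinarith [kernelK_nonneg a hy]

theorem aestronglyMeasurable_integrand (a : ℝ) (f : SP) (x : ℝ) (μ : Measure ℝ) :
    AEStronglyMeasurable (fun y => (f (x - y) - f (x + y)) * kernelK a y) μ := by
  have := f.continuous.measurable
  exact Measurable.aestronglyMeasurable (by fun_prop)

theorem integrableOn_integrand (a : ℝ) (f : SP) (x : ℝ) :
    IntegrableOn (fun y => (f (x - y) - f (x + y)) * kernelK a y) (Ioi 0) := by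
  refine ((integrable_kernelW a).integrableOn.const_mul (2 * supNorm (D f))).mono'
    (aestronglyMeasurable_integrand a f x _) ?_
  filter_upwards [ae_restrict_mem measurableSet_Ioi] with y hy
  exact norm_integrand_le a f x hy

theorem hasDerivAt_Hfun (a : ℝ) (f : SP) (x : ℝ) : HasDerivAt (Hfun a f) (Hfun a (D f) x) x := by
  refine (hasDerivAt_integral_of_dominated_loc_of_deriv_le (s := univ)
    (bound := fun y => 2 * supNorm (D (D f)) * kernelW a y)
    (F' := fun x y => (D f (x - y) - D f (x + y)) * kernelK a y)
    univ_mem (.of_forall fun x => aestronglyMeasurable_integrand a f x _)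
    (integrableOn_integrand a f x) (aestronglyMeasurable_integrand a (D f) x _) ?_ ?_ ?_).2
  · filter_upwards [ae_restrict_mem measurableSet_Ioi] with y hy x _
    exact norm_integrand_le a (D f) x hy
  · exact (integrable_kernelW a).integrableOn.const_mul _
  · filter_upwards with y x _
    refine HasDerivAt.mul_const (HasDerivAt.sub ?_ ?_) _
    · exact (f.hasDerivAt (x - y)).comp_sub_const x y
    · exact (f.hasDerivAt (x + y)).comp_add_const x y

theorem isSmoothPeriodic_Hfun (a : ℝ) (f : SP) : IsSmoothPeriodic (Hfun a f) where
  smooth := by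
    have key : ∀ n : ℕ, ∀ f : SP, ContDiff ℝ n (Hfun a f) := by
      intro n
      induction n with
      | zero => exact fun f => contDiff_zero.2 (continuous_iff_continuousAt.2 fun x =>
          (hasDerivAt_Hfun a f x).continuousAt)
      | succ n ih =>
        intro f
        rw [Nat.cast_succ, contDiff_succ_iff_deriv]
        refine ⟨fun x => (hasDerivAt_Hfun a f x).differentiableAt, by simp, ?_⟩
        rw [show deriv (Hfun a f) = Hfun a (D f) from funext fun x => (hasDerivAt_Hfun a f x).deriv]
        exact ih _
    exact contDiff_infty.2 fun n => key n f
  periodic x := by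
    have h : ∀ z, f (z + 2 * Real.pi) = f z := f.periodic
    simp only [Hfun]
    congr 1; ext y
    rw [show x + 2 * Real.pi - y = x - y + 2 * Real.pi by ring,
      show x + 2 * Real.pi + y = x + y + 2 * Real.pi by ring, h, h]

/-- The operator `H_a` on smooth periodic functions. -/
noncomputable def H (a : ℝ) : SP →ₗ[ℝ] SP where
  toFun f := mk (Hfun a f) (isSmoothPeriodic_Hfun a f)
  map_add' f g := by
    ext x
    simp only [mk_apply, add_apply, Hfun]
    rw [← integral_add (integrableOn_integrand a f x) (integrableOn_integrand a g x)]
    congr 1; ext y; ring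
  map_smul' c f := by
    ext x
    simp only [mk_apply, smul_apply, Hfun, RingHom.id_apply]
    rw [← integral_const_mul]
    congr 1; ext y; ring

theorem H_apply (a : ℝ) (f : SP) (x : ℝ) :
    H a f x = ∫ y in Ioi 0, (f (x - y) - f (x + y)) * kernelK a y := rfl

theorem D_H (a : ℝ) (f : SP) : D (H a f) = H a (D f) :=
  D_eq_of_hasDerivAt fun x => hasDerivAt_Hfun a f x

/-- Oddness of the kernel folds the truncated integral onto `(ε, ∞)`. The folded integrand is
bounded near `0`, so the missing piece is `O(ε)`. -/
theorem isHa_H (a : ℝ) (f : SP) (x : ℝ) : IsHa a f x (H a f x) := by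
  have hint : ∀ ε > 0, ∀ s : ℝ, IntegrableOn (fun y => f (x + s * y) * kernelK a y) (Ioi ε) := by
    intro ε hε s
    have hm := f.continuous.measurable
    refine ((integrableOn_kernelK a hε).const_mul (supNorm f)).mono'
      (Measurable.aestronglyMeasurable (by fun_prop)) ?_
    filter_upwards [ae_restrict_mem measurableSet_Ioi] with y hy
    have hy0 : 0 < y := hε.trans hy
    rw [norm_mul, Real.norm_of_nonneg (kernelK_nonneg a hy0)]
    exact mul_le_mul_of_nonneg_right (f.abs_le_supNorm _) (kernelK_nonneg a hy0)
  have key : ∀ ε > 0, ∫ y in {y : ℝ | ε < |y|}, f (x - y) * kernelK a y =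
      ∫ y in Ioi ε, (f (x - y) - f (x + y)) * kernelK a y := by
    intro ε hε
    have hset : {y : ℝ | ε < |y|} = Iio (-ε) ∪ Ioi ε := by
      ext y; simp [lt_abs, or_comm, lt_neg]
    have hdisj : Disjoint (Iio (-ε)) (Ioi ε) :=
      Set.disjoint_left.2 fun y (h1 : y < -ε) (h2 : ε < y) => by linarith
    have h1 : IntegrableOn (fun y => f (x - y) * kernelK a y) (Ioi ε) := by
      simpa [sub_eq_add_neg] using hint ε hε (-1)
    have h2 : IntegrableOn (fun y => f (x + y) * kernelK a y) (Ioi ε) := by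
      simpa using hint ε hε 1
    have h3 : IntegrableOn (fun y => f (x - y) * kernelK a y) (Iio (-ε)) := by
      rw [← (Measure.measurePreserving_neg (volume : Measure ℝ)).integrableOn_comp_preimage
        (MeasurableEquiv.neg ℝ).measurableEmbedding]
      have : (Neg.neg : ℝ → ℝ) ⁻¹' Iio (-ε) = Ioi ε := by ext; simp
      rw [this]
      refine h2.neg.congr (ae_of_all _ fun y => ?_)
      simp [kernelK_neg]
    rw [hset, setIntegral_union hdisj measurableSet_Ioi h3 h1, ← integral_Iic_eq_integral_Iio,
      ← integral_comp_neg_Ioi, add_comm, ← integral_add h1]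
    · congr 1; ext y; rw [kernelK_neg, sub_neg_eq_add]; ring
    · refine h2.neg.congr (ae_of_all _ fun y => ?_)
      simp [kernelK_neg]
  have hbd : ∀ ε > 0, ‖(∫ y in Ioi ε, (f (x - y) - f (x + y)) * kernelK a y) - H a f x‖ ≤
      2 * supNorm (D f) * Real.pi⁻¹ * ε := by
    intro ε hε
    have h0 := integrableOn_integrand a f x
    rw [H_apply, setIntegral_Ioi_split (le_of_lt hε) h0, sub_add_cancel_right, norm_neg]
    refine (norm_setIntegral_le_of_norm_le_const (C := 2 * supNorm (D f) * Real.pi⁻¹) (by simp)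
      fun y hy => ?_).trans (by simp [hε.le])
    refine (norm_integrand_le a f x hy.1).trans ?_
    exact mul_le_mul_of_nonneg_left (kernelW_le a y) (by linarith [supNorm_nonneg (D f)])
  rw [IsHa, tendsto_iff_norm_sub_tendsto_zero]
  have hlim : Tendsto (fun ε : ℝ => 2 * supNorm (D f) * Real.pi⁻¹ * ε) (𝓝[>] 0) (𝓝 0) := by
    have : Tendsto (fun ε : ℝ => 2 * supNorm (D f) * Real.pi⁻¹ * ε) (𝓝 0)
        (𝓝 (2 * supNorm (D f) * Real.pi⁻¹ * 0)) := tendsto_id.const_mul _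
    rw [mul_zero] at this
    exact this.mono_left nhdsWithin_le_nhds
  refine squeeze_zero' (.of_forall fun _ => norm_nonneg _) ?_ hlim
  filter_upwards [self_mem_nhdsWithin] with ε hε
  rw [key ε hε]
  exact hbd ε hε

theorem eq_H_of_isHa {a : ℝ} {f : SP} {x v : ℝ} (h : IsHa a f x v) : v = H a f x :=
  tendsto_nhds_unique h (isHa_H a f x)

/-- Logarithmic bound for `H_a f` in terms of `‖f‖_∞` and the `L²` norm of `f'`. -/
theorem abs_H_le (a : ℝ) (f : SP) (x : ℝ) {δ : ℝ} (hδ : 0 < δ) (hδ1 : δ ≤ 1) :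
    |H a f x| ≤ 4 * √δ * ‖D f‖ + 2 * supNorm f * (Real.log δ⁻¹ + ∫ y in Ioi 1, kernelK a y) := by
  have h0 := integrableOn_integrand a f x
  have hsplit : H a f x = (∫ y in Ioc 0 δ, (f (x - y) - f (x + y)) * kernelK a y) +
      ∫ y in Ioi δ, (f (x - y) - f (x + y)) * kernelK a y := setIntegral_Ioi_split hδ.le h0
  have hK1 := integrableOn_kernelK a one_pos
  have hKδ := integrableOn_kernelK a hδ
  have hKle : ∀ y : ℝ, 0 < y → kernelK a y ≤ Real.pi⁻¹ * y⁻¹ := fun y hy => by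
    rw [kernelK_eq a hy.ne', div_eq_mul_inv]
    exact mul_le_mul_of_nonneg_right (kernelW_le a y) (by positivity)
  have hpi : Real.pi⁻¹ ≤ 1 := inv_le_one_of_one_le₀ (by linarith [Real.pi_gt_three])
  -- Near the singularity the Hölder-`1/2` bound leaves the integrable function `y ^ (-1/2)`.
  -- Between `δ` and `1` the bound `K_a(y) ≤ 1/y` gives the logarithm, and the tail beyond `1` is a
  -- constant.
  have hnear : ‖∫ y in Ioc 0 δ, (f (x - y) - f (x + y)) * kernelK a y‖ ≤ 4 * √δ * ‖D f‖ := by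
    have hii : IntervalIntegrable (fun y : ℝ => y ^ (-(1 / 2) : ℝ)) volume 0 δ :=
      intervalIntegral.intervalIntegrable_rpow' (by norm_num)
    have hb : ∀ y ∈ Ioc 0 δ, ‖(f (x - y) - f (x + y)) * kernelK a y‖ ≤
        2 * ‖D f‖ * y ^ (-(1 / 2) : ℝ) := by
      intro y hy
      have h1 := f.abs_sub_le (a := x - y) (b := x + y) (by linarith [hy.1])
        (by linarith [hy.2, Real.pi_gt_three])
      rw [abs_sub_comm, show x + y - (x - y) = 2 * y by ring] at h1
      have h2 : √(2 * y) ≤ 2 * √y := by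
        rw [Real.sqrt_le_left (by positivity), mul_pow, Real.sq_sqrt hy.1.le]
        linarith [hy.1]
      have h3 : y ^ (-(1 / 2) : ℝ) = √y * y⁻¹ := by
        rw [Real.rpow_neg hy.1.le, ← Real.sqrt_eq_rpow]
        have := Real.mul_self_sqrt hy.1.le
        have hs : 0 < √y := Real.sqrt_pos.2 hy.1
        rw [← this]
        field_simp
        rw [Real.sqrt_sq hs.le]
      rw [norm_mul, Real.norm_of_nonneg (kernelK_nonneg a hy.1), h3, Real.norm_eq_abs]
      have h4 : kernelK a y ≤ y⁻¹ := (hKle y hy.1).trans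
        (mul_le_of_le_one_left (inv_nonneg.2 hy.1.le) hpi)
      calc |f (x - y) - f (x + y)| * kernelK a y ≤ (√(2 * y) * ‖D f‖) * y⁻¹ :=
            mul_le_mul h1 h4 (kernelK_nonneg a hy.1) (by positivity)
        _ ≤ (2 * √y * ‖D f‖) * y⁻¹ := by gcongr; exact inv_nonneg.2 hy.1.le
        _ = _ := by ring
    have hI : ∫ y in Ioc 0 δ, 2 * ‖D f‖ * y ^ (-(1 / 2) : ℝ) = 4 * √δ * ‖D f‖ := by
      rw [← intervalIntegral.integral_of_le hδ.le, intervalIntegral.integral_const_mul,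
        integral_rpow (by norm_num), Real.sqrt_eq_rpow]
      norm_num
      ring
    rw [← hI]
    refine norm_integral_le_of_norm_le ?_ ((ae_restrict_iff' measurableSet_Ioc).2 (ae_of_all _ hb))
    exact ((intervalIntegrable_iff_integrableOn_Ioc_of_le hδ.le).1 hii).const_mul _
  have hfar : ‖∫ y in Ioi δ, (f (x - y) - f (x + y)) * kernelK a y‖ ≤
      2 * supNorm f * ∫ y in Ioi δ, kernelK a y := by
    rw [← integral_const_mul]
    refine norm_integral_le_of_norm_le (hKδ.const_mul _) ?_
    filter_upwards [ae_restrict_mem measurableSet_Ioi] with y hy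
    have hy0 : 0 < y := hδ.trans hy
    rw [norm_mul, Real.norm_of_nonneg (kernelK_nonneg a hy0)]
    refine mul_le_mul_of_nonneg_right ?_ (kernelK_nonneg a hy0)
    refine (norm_sub_le _ _).trans ?_
    have h1 := f.abs_le_supNorm (x - y)
    have h2 := f.abs_le_supNorm (x + y)
    simp only [Real.norm_eq_abs]
    linarith
  have hKint : ∫ y in Ioi δ, kernelK a y ≤ Real.log δ⁻¹ + ∫ y in Ioi 1, kernelK a y := by
    rw [setIntegral_Ioi_split hδ1 hKδ]
    refine add_le_add ?_ le_rfl
    have hinv : IntervalIntegrable (fun y : ℝ => y⁻¹) volume δ 1 :=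
      intervalIntegral.intervalIntegrable_inv (fun y hy => by
        rw [uIcc_of_le hδ1] at hy; exact (hδ.trans_le hy.1).ne') continuousOn_id
    have : Real.log δ⁻¹ = ∫ y in Ioc δ 1, y⁻¹ := by
      rw [← intervalIntegral.integral_of_le hδ1, integral_inv_of_pos hδ one_pos, one_div]
    rw [this]
    refine setIntegral_mono_on (hKδ.mono_set Ioc_subset_Ioi_self)
      ((intervalIntegrable_iff_integrableOn_Ioc_of_le hδ1).1 hinv) measurableSet_Ioc fun y hy => ?_
    have hy0 : 0 < y := hδ.trans hy.1
    exact (hKle y hy0).trans (mul_le_of_le_one_left (inv_nonneg.2 hy0.le) hpi)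
  rw [hsplit]
  refine (abs_add_le _ _).trans (add_le_add hnear (hfar.trans ?_))
  exact mul_le_mul_of_nonneg_left hKint (by linarith [supNorm_nonneg f])

end SP

/-! ### The Fourier multiplier of the kernel -/

theorem hasDerivAt_kernelK (a : ℝ) {y : ℝ} (hy : 0 < y) :
    HasDerivAt (kernelK a)
      (-(Real.pi⁻¹ * a ^ 2 * (3 * y ^ 2 + a ^ 2) / (y * (y ^ 2 + a ^ 2)) ^ 2)) y := by
  have hne : y * (y ^ 2 + a ^ 2) ≠ 0 := by positivity
  have h : HasDerivAt (fun y : ℝ => Real.pi⁻¹ * a ^ 2 / (y * (y ^ 2 + a ^ 2)))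
      ((0 * (y * (y ^ 2 + a ^ 2)) - Real.pi⁻¹ * a ^ 2 *
        (1 * (y ^ 2 + a ^ 2) + y * (2 * y))) / (y * (y ^ 2 + a ^ 2)) ^ 2) y := by
    refine (hasDerivAt_const y (Real.pi⁻¹ * a ^ 2)).div ((hasDerivAt_id y).mul ?_) hne
    simpa using (hasDerivAt_pow 2 y).add_const (a ^ 2)
  have he : kernelK a = fun y : ℝ => Real.pi⁻¹ * a ^ 2 / (y * (y ^ 2 + a ^ 2)) := by
    ext y
    rw [kernelK, one_div, mul_inv, div_eq_mul_inv, div_eq_mul_inv, mul_inv]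
    ring
  rw [he]
  convert h using 1
  ring

theorem tendsto_kernelK (a : ℝ) : Tendsto (kernelK a) atTop (𝓝 0) := by
  refine squeeze_zero' (g := fun y => Real.pi⁻¹ / y) ?_ ?_ (tendsto_const_nhds.div_atTop tendsto_id)
  · filter_upwards [eventually_gt_atTop 0] with y hy using kernelK_nonneg a hy
  · filter_upwards [eventually_gt_atTop 0] with y hy
    rw [kernelK_eq a hy.ne']
    exact div_le_div_of_nonneg_right (kernelW_le a y) hy.le

/-- Split at the wavelength scale `1/s`. Below it, `|sin(sy)| ≤ sy` gives at most `1/π`. Above it,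
integration by parts gives a boundary term and the total variation of the decreasing kernel, each at
most `1/π`. The sum is `3/π ≤ 1`, uniformly in `s` and `a`. -/
theorem abs_integral_sin_kernelK_le_of_pos (a : ℝ) {s : ℝ} (hs : 0 < s) :
    |∫ y in Ioi 0, Real.sin (s * y) * kernelK a y| ≤ 1 := by
  have hδ : 0 < s⁻¹ := inv_pos.2 hs
  have hpi0 := Real.pi_pos
  have hbound : ∀ y : ℝ, 0 < y → ‖Real.sin (s * y) * kernelK a y‖ ≤ s * kernelW a y := fun y hy => by
    rw [norm_mul, Real.norm_of_nonneg (kernelK_nonneg a hy), ← mul_kernelK a hy.ne', ← mul_assoc]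
    refine mul_le_mul_of_nonneg_right ?_ (kernelK_nonneg a hy)
    have := Real.abs_sin_le_abs (x := s * y)
    rwa [abs_of_pos (mul_pos hs hy)] at this
  have hint : IntegrableOn (fun y => Real.sin (s * y) * kernelK a y) (Ioi 0) := by
    refine ((integrable_kernelW a).integrableOn.const_mul s).mono'
      (Measurable.aestronglyMeasurable (by fun_prop)) ?_
    filter_upwards [ae_restrict_mem measurableSet_Ioi] with y hy using hbound y hy
  rw [setIntegral_Ioi_split hδ.le hint]
  have hnear : ‖∫ y in Ioc 0 s⁻¹, Real.sin (s * y) * kernelK a y‖ ≤ Real.pi⁻¹ := by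
    refine (norm_setIntegral_le_of_norm_le_const (C := s * Real.pi⁻¹) (by simp)
      fun y hy => (hbound y hy.1).trans ?_).trans (le_of_eq ?_)
    · exact mul_le_mul_of_nonneg_left (kernelW_le a y) hs.le
    · simp [hδ.le, mul_right_comm, mul_inv_cancel₀ hs.ne']
  set K' : ℝ → ℝ := fun y =>
    -(Real.pi⁻¹ * a ^ 2 * (3 * y ^ 2 + a ^ 2) / (y * (y ^ 2 + a ^ 2)) ^ 2) with hK'
  have hd : ∀ y ∈ Ioi s⁻¹, HasDerivAt (kernelK a) (K' y) y := fun y hy =>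
    hasDerivAt_kernelK a (hδ.trans hy)
  have hneg : ∀ y ∈ Ioi s⁻¹, K' y ≤ 0 := fun y hy => neg_nonpos.2 (by positivity)
  have hcont : ContinuousWithinAt (kernelK a) (Ici s⁻¹) s⁻¹ :=
    (hasDerivAt_kernelK a hδ).continuousAt.continuousWithinAt
  have hK'int : IntegrableOn K' (Ioi s⁻¹) :=
    integrableOn_Ioi_deriv_of_nonpos hcont hd hneg (tendsto_kernelK a)
  have hK'val : ∫ y in Ioi s⁻¹, K' y = 0 - kernelK a s⁻¹ :=
    integral_Ioi_of_hasDerivAt_of_nonpos hcont hd hneg (tendsto_kernelK a)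
  set v : ℝ → ℝ := fun y => -(Real.cos (s * y) / s) with hv
  have hvb : ∀ y, ‖v y‖ ≤ s⁻¹ := fun y => by
    rw [hv, norm_neg, norm_div, Real.norm_of_nonneg hs.le, div_eq_mul_inv]
    exact mul_le_of_le_one_left hδ.le (Real.abs_cos_le_one _)
  have hvd : ∀ y ∈ Ioi s⁻¹, HasDerivAt v (Real.sin (s * y)) y := fun y _ => by
    have h1 : HasDerivAt (fun y => s * y) s y := by simpa using (hasDerivAt_id y).const_mul s
    have := (h1.cos.div_const s).neg
    refine this.congr_deriv ?_
    rw [neg_mul, neg_div, neg_neg, mul_div_cancel_right₀ _ hs.ne']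
  have hpv : IntegrableOn (K' * v) (Ioi s⁻¹) :=
    hK'int.mul_bdd (c := s⁻¹) (Continuous.aestronglyMeasurable (by fun_prop))
      (ae_of_all _ hvb)
  have hvc : Continuous v := by fun_prop
  have hparts := integral_Ioi_mul_deriv_eq_deriv_mul (a := s⁻¹) (u := kernelK a) (v := v) (u' := K')
    (v' := fun y => Real.sin (s * y)) (a' := kernelK a s⁻¹ * v s⁻¹) (b' := 0) hd hvd
    ((hint.mono_set (Ioi_subset_Ioi hδ.le)).congr (ae_of_all _ fun y => by simp [mul_comm]))
    hpv (((hasDerivAt_kernelK a hδ).continuousAt.mul hvc.continuousAt).tendsto.mono_left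
      nhdsWithin_le_nhds)
    (by
      refine squeeze_zero_norm (a := fun y => |kernelK a y| * s⁻¹) (fun y => ?_) ?_
      · rw [Pi.mul_apply, norm_mul]
        exact mul_le_mul_of_nonneg_left (hvb y) (norm_nonneg _)
      · simpa using (tendsto_kernelK a).abs.mul_const s⁻¹)
  have hKs : kernelK a s⁻¹ * s⁻¹ ≤ Real.pi⁻¹ := by
    rw [mul_comm, mul_kernelK a hδ.ne']
    exact kernelW_le a _
  have hrem : ‖∫ y in Ioi s⁻¹, K' y * v y‖ ≤ kernelK a s⁻¹ * s⁻¹ := by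
    have h1 : ∫ y in Ioi s⁻¹, -K' y * s⁻¹ = kernelK a s⁻¹ * s⁻¹ := by
      rw [integral_mul_const, integral_neg, hK'val]; ring
    rw [← h1]
    refine norm_integral_le_of_norm_le (hK'int.neg.mul_const _) ?_
    filter_upwards [ae_restrict_mem measurableSet_Ioi] with y hy
    rw [norm_mul, Real.norm_of_nonpos (hneg y hy)]
    exact mul_le_mul_of_nonneg_left (hvb y) (neg_nonneg.2 (hneg y hy))
  have hfar : ‖∫ y in Ioi s⁻¹, Real.sin (s * y) * kernelK a y‖ ≤ 2 * Real.pi⁻¹ := by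
    have : ∫ y in Ioi s⁻¹, Real.sin (s * y) * kernelK a y =
        ∫ y in Ioi s⁻¹, kernelK a y * Real.sin (s * y) := by
      congr 1; ext y; ring
    rw [this, hparts, zero_sub]
    refine (norm_sub_le _ _).trans ?_
    have h2 : ‖-(kernelK a s⁻¹ * v s⁻¹)‖ ≤ kernelK a s⁻¹ * s⁻¹ := by
      rw [norm_neg, norm_mul, Real.norm_of_nonneg (kernelK_nonneg a hδ)]
      exact mul_le_mul_of_nonneg_left (hvb _) (kernelK_nonneg a hδ)
    linarith
  have hpi : 3 * Real.pi⁻¹ ≤ 1 := by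
    rw [← div_eq_mul_inv, div_le_one hpi0]; exact Real.pi_gt_three.le
  refine (abs_add_le _ _).trans ?_
  simp only [Real.norm_eq_abs] at hnear hfar
  linarith

theorem abs_integral_sin_kernelK_le (a s : ℝ) :
    |∫ y in Ioi 0, Real.sin (s * y) * kernelK a y| ≤ 1 := by
  rcases lt_trichotomy s 0 with hs | rfl | hs
  · have := abs_integral_sin_kernelK_le_of_pos a (neg_pos.2 hs)
    simpa only [neg_mul, Real.sin_neg, integral_neg, abs_neg] using this
  · simp
  · exact abs_integral_sin_kernelK_le_of_pos a hs

/-! ### Antisymmetry of `H_a` -/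

namespace SP

theorem integral_shift (f g : SP) (y : ℝ) :
    ∫ x in (-Real.pi)..Real.pi, f (x - y) * g x = ∫ x in (-Real.pi)..Real.pi, f x * g (x + y) := by
  have hp : Function.Periodic (fun x => f x * g (x + y)) (2 * Real.pi) := fun x => by
    have h1 := f.periodic x
    have h2 := g.periodic (x + y)
    simp only [h1, show x + 2 * Real.pi + y = x + y + 2 * Real.pi by ring, h2]
  have h := intervalIntegral.integral_comp_sub_right (a := -Real.pi) (b := Real.pi)
    (fun x => f x * g (x + y)) y
  simp only [sub_add_cancel] at h
  rw [h]
  have h2 := hp.intervalIntegral_add_eq (-Real.pi - y) (-Real.pi)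
  convert h2 using 2 <;> ring

theorem integral_shift_sub (f g : SP) (y : ℝ) :
    ∫ x in (-Real.pi)..Real.pi, (f (x - y) - f (x + y)) * g x =
      -∫ x in (-Real.pi)..Real.pi, f x * (g (x - y) - g (x + y)) := by
  have h1 := integral_shift f g y
  have h2 := integral_shift f g (-y)
  simp only [sub_neg_eq_add, ← sub_eq_add_neg] at h2
  have e1 : ∀ x, (f (x - y) - f (x + y)) * g x = f (x - y) * g x - f (x + y) * g x := fun x => by ring
  have e2 : ∀ x, f x * (g (x - y) - g (x + y)) = f x * g (x - y) - f x * g (x + y) := fun x => by ring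
  have c1 := f.continuous
  have c2 := g.continuous
  simp only [e1, e2]
  rw [intervalIntegral.integral_sub, intervalIntegral.integral_sub, h1, h2]
  · ring
  all_goals exact Continuous.intervalIntegrable (by fun_prop) _ _

/-- After Fubini, translation invariance of the integral over a period moves the shifts by `±y` to
the other factor, where they exchange roles. -/
theorem inner_H_left (a : ℝ) (f g : SP) : inner ℝ (H a f) g = -inner ℝ f (H a g) := by
  have swap : ∀ p q : SP, ∫ x in (-Real.pi)..Real.pi, H a p x * q x =
      ∫ y in Ioi 0, (∫ x in (-Real.pi)..Real.pi, (p (x - y) - p (x + y)) * q x) * kernelK a y := by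
    intro p q
    have m1 := p.continuous.measurable
    have m2 := q.continuous.measurable
    simp only [intervalIntegral.integral_of_le neg_pi_lt_pi.le, H_apply, ← integral_mul_const]
    rw [integral_integral_swap]
    · congr 1; ext y; congr 1; ext x; ring
    · have hb : Integrable (fun z : ℝ × ℝ => (1 : ℝ) * (2 * supNorm (D p) * supNorm q * kernelW a z.2))
          ((volume.restrict (Ioc (-Real.pi) Real.pi)).prod (volume.restrict (Ioi 0))) :=
        Integrable.mul_prod (integrable_const (1 : ℝ))
          ((integrable_kernelW a).integrableOn.const_mul (2 * supNorm (D p) * supNorm q))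
      refine hb.mono' (Measurable.aestronglyMeasurable (by unfold Function.uncurry; fun_prop)) ?_
      rw [Measure.prod_restrict]
      filter_upwards [ae_restrict_mem (measurableSet_Ioc.prod measurableSet_Ioi)] with z hz
      have h1 := norm_integrand_le a p z.1 hz.2
      have h2 := q.abs_le_supNorm z.1
      rw [Function.uncurry, norm_mul]
      calc _ ≤ 2 * supNorm (D p) * kernelW a z.2 * supNorm q :=
            mul_le_mul h1 h2 (abs_nonneg _) (mul_nonneg (by linarith [supNorm_nonneg (D p)])
              (kernelW_nonneg _ _))
        _ = _ := by ring
  have e1 : inner ℝ (H a f) g = ∫ x in (-Real.pi)..Real.pi, H a f x * g x := rfl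
  have e2 : inner ℝ f (H a g) = ∫ x in (-Real.pi)..Real.pi, H a g x * f x := by
    rw [real_inner_comm]; rfl
  rw [e1, e2, swap f g, swap g f, ← integral_neg]
  congr 1; ext y
  rw [integral_shift_sub]
  simp only [mul_comm (f _)]
  ring

/-! ### Fourier analysis -/

/-- The function `cos (n x)`. -/
noncomputable def cosSP (n : ℤ) : SP := mk (fun x => Real.cos (n * x)) {
  smooth := Real.contDiff_cos.comp (contDiff_const.mul contDiff_id)
  periodic := fun x => by
    simp only [mul_add, Real.cos_add_int_mul_two_pi] }

/-- The function `sin (n x)`. -/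
noncomputable def sinSP (n : ℤ) : SP := mk (fun x => Real.sin (n * x)) {
  smooth := Real.contDiff_sin.comp (contDiff_const.mul contDiff_id)
  periodic := fun x => by
    simp only [mul_add, Real.sin_add_int_mul_two_pi] }

@[simp] theorem cosSP_apply (n : ℤ) (x : ℝ) : cosSP n x = Real.cos (n * x) := rfl
@[simp] theorem sinSP_apply (n : ℤ) (x : ℝ) : sinSP n x = Real.sin (n * x) := rfl

theorem D_cosSP (n : ℤ) : D (cosSP n) = (-n : ℝ) • sinSP n := by
  refine D_eq_of_hasDerivAt fun x => ?_
  have h1 : HasDerivAt (fun y : ℝ => (n : ℝ) * y) n x := by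
    simpa using (hasDerivAt_id x).const_mul (n : ℝ)
  refine h1.cos.congr_deriv ?_
  rw [smul_apply, sinSP_apply]; ring

theorem D_sinSP (n : ℤ) : D (sinSP n) = (n : ℝ) • cosSP n := by
  refine D_eq_of_hasDerivAt fun x => ?_
  have h1 : HasDerivAt (fun y : ℝ => (n : ℝ) * y) n x := by
    simpa using (hasDerivAt_id x).const_mul (n : ℝ)
  refine h1.sin.congr_deriv ?_
  rw [smul_apply, cosSP_apply]; ring

theorem H_cosSP (a : ℝ) (n : ℤ) :
    H a (cosSP n) = (2 * ∫ y in Ioi 0, Real.sin (n * y) * kernelK a y) • sinSP n := by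
  ext x
  rw [H_apply, smul_apply, sinSP_apply, mul_right_comm, ← integral_const_mul]
  congr 1; ext y
  simp only [cosSP_apply, mul_add, mul_sub, Real.cos_add, Real.cos_sub]
  ring

theorem H_sinSP (a : ℝ) (n : ℤ) :
    H a (sinSP n) = (-(2 * ∫ y in Ioi 0, Real.sin (n * y) * kernelK a y)) • cosSP n := by
  ext x
  rw [H_apply, smul_apply, cosSP_apply, neg_mul, mul_right_comm, ← neg_mul, ← integral_const_mul]
  congr 1; ext y
  simp only [sinSP_apply, mul_add, mul_sub, Real.sin_add, Real.sin_sub]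
  ring

/-- Parseval in real form. The sum over all integers counts each nonzero frequency twice, which
makes the constant exactly `2π`. -/
theorem hasSum_inner_sq (f : SP) :
    HasSum (fun n : ℤ => inner ℝ f (cosSP n) ^ 2 + inner ℝ f (sinSP n) ^ 2)
      (2 * Real.pi * ‖f‖ ^ 2) := by
  have hc : Continuous fun x => (f x : ℂ) := Complex.continuous_ofReal.comp f.continuous
  have hL2 : MemLp (fun x => (f x : ℂ)) 2 (volume.restrict (Ioc (-Real.pi) Real.pi)) :=
    MemLp.of_bound hc.aestronglyMeasurable (supNorm f) (ae_of_all _ fun x => by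
      simpa using f.abs_le_supNorm x)
  have h := (hasSum_sq_fourierCoeffOn neg_pi_lt_pi hL2).mul_left ((2 * Real.pi) ^ 2)
  have hpi := Real.pi_pos
  have hR : 2 * Real.pi * ‖f‖ ^ 2 = (2 * Real.pi) ^ 2 *
      ((Real.pi - -Real.pi)⁻¹ • ∫ x in (-Real.pi)..Real.pi, ‖(f x : ℂ)‖ ^ 2) := by
    rw [smul_eq_mul, norm_sq, integral_def]
    have : ∀ x, ‖(f x : ℂ)‖ ^ 2 = (f * f) x := fun x => by simp [sq]
    simp only [this]
    rw [show Real.pi - -Real.pi = 2 * Real.pi by ring]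
    field_simp
  rw [hR]
  suffices hE : ∀ n : ℤ, inner ℝ f (cosSP n) ^ 2 + inner ℝ f (sinSP n) ^ 2 =
      (2 * Real.pi) ^ 2 * ‖fourierCoeffOn neg_pi_lt_pi (fun x => (f x : ℂ)) n‖ ^ 2 by
    simpa only [hE] using h
  intro n
  have e1 : ∫ x in (-Real.pi)..Real.pi, fourier (-n) (x : AddCircle (Real.pi - -Real.pi)) •
      (f x : ℂ) = (inner ℝ f (cosSP n) : ℂ) - (inner ℝ f (sinSP n) : ℂ) * Complex.I := by
    rw [inner_def, inner_def, integral_def, integral_def, ← intervalIntegral.integral_ofReal,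
      ← intervalIntegral.integral_ofReal, ← intervalIntegral.integral_mul_const,
      ← intervalIntegral.integral_sub]
    · congr 1; ext x
      rw [fourier_coe_apply]
      have : 2 * Real.pi * Complex.I * ((-n : ℤ) : ℂ) * (x : ℂ) / ((Real.pi - -Real.pi : ℝ) : ℂ) =
          ((-(n * x) : ℝ) : ℂ) * Complex.I := by
        have : (Real.pi : ℂ) ≠ 0 := Complex.ofReal_ne_zero.2 hpi.ne'
        push_cast
        field_simp
        ring
      rw [this, Complex.exp_mul_I, ← Complex.ofReal_cos, ← Complex.ofReal_sin]
      simp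
      ring
    · exact Continuous.intervalIntegrable (Complex.continuous_ofReal.comp (f * cosSP n).continuous) _ _
    · exact Continuous.intervalIntegrable
        ((Complex.continuous_ofReal.comp (f * sinSP n).continuous).mul continuous_const) _ _
  rw [fourierCoeffOn_eq_integral, e1, norm_smul, mul_pow ‖(1 / (Real.pi - -Real.pi) : ℝ)‖, ← Complex.normSq_eq_norm_sq,
    Complex.normSq_apply]
  simp only [Complex.sub_re, Complex.ofReal_re, Complex.re_ofReal_mul, Complex.I_re, mul_zero,
    sub_zero, Complex.sub_im, Complex.ofReal_im, Complex.im_ofReal_mul, Complex.I_im, mul_one,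
    zero_sub, Real.norm_eq_abs, sq_abs]
  rw [show Real.pi - -Real.pi = 2 * Real.pi by ring]
  field_simp

/-- By antisymmetry the coefficients of `H a f` are those of `f` with sine and cosine exchanged, up
to sign, and multiplied by `2m` with `|m| ≤ 1`. Parseval concludes. -/
theorem norm_H_le (a : ℝ) (f : SP) : ‖H a f‖ ≤ 2 * ‖f‖ := by
  have h1 := hasSum_inner_sq (H a f)
  have h2 := (hasSum_inner_sq f).mul_left 4
  have h3 : 2 * Real.pi * ‖H a f‖ ^ 2 ≤ 4 * (2 * Real.pi * ‖f‖ ^ 2) := by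
    refine hasSum_le (fun n => ?_) h1 h2
    rw [inner_H_left, inner_H_left, H_cosSP, H_sinSP, inner_smul_right, inner_smul_right]
    set m := ∫ y in Ioi 0, Real.sin (n * y) * kernelK a y
    have hm : m ^ 2 ≤ 1 := by
      rw [sq_le_one_iff_abs_le_one]; exact abs_integral_sin_kernelK_le a n
    nlinarith [sq_nonneg (inner ℝ f (cosSP n)), sq_nonneg (inner ℝ f (sinSP n))]
  refine le_of_sq_le_sq ?_ (by positivity)
  nlinarith [Real.pi_pos]

/-- `H_a` as a bounded operator in `L²`. -/
noncomputable def Hc (a : ℝ) : SP →L[ℝ] SP := (H a).mkContinuous 2 (norm_H_le a)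

theorem Hc_apply (a : ℝ) (f : SP) : Hc a f = H a f := rfl

/-- Only frequencies `|n| ≥ M` remain, and two derivatives multiply each of them by `n²`. This is
the source of the Galerkin convergence rate. -/
theorem norm_le_of_inner_eq_zero {f : SP} {M : ℕ}
    (h : ∀ n : ℤ, |n| < M → inner ℝ f (cosSP n) = 0 ∧ inner ℝ f (sinSP n) = 0) :
    M ^ 2 * ‖f‖ ≤ ‖D (D f)‖ := by
  have h1 := (hasSum_inner_sq f).mul_left ((M : ℝ) ^ 4)
  have h2 := hasSum_inner_sq (D (D f))
  have h3 : (M : ℝ) ^ 4 * (2 * Real.pi * ‖f‖ ^ 2) ≤ 2 * Real.pi * ‖D (D f)‖ ^ 2 := by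
    refine hasSum_le (fun n => ?_) h1 h2
    simp only [inner_D_left, D_cosSP, D_sinSP, inner_smul_right]
    rcases lt_or_ge |n| (M : ℤ) with hn | hn
    · rw [(h n hn).1, (h n hn).2]; simp
    · have hn' : (M : ℝ) ≤ |(n : ℝ)| := by exact_mod_cast hn
      have hn2 : (M : ℝ) ^ 2 ≤ (n : ℝ) ^ 2 := by
        rw [← sq_abs (n : ℝ)]; gcongr
      have hn4 : (M : ℝ) ^ 4 ≤ (n : ℝ) ^ 4 := by
        have := pow_le_pow_left₀ (by positivity) hn2 2
        nlinarith
      nlinarith [mul_le_mul_of_nonneg_right hn4 (add_nonneg (sq_nonneg (inner ℝ f (cosSP n)))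
        (sq_nonneg (inner ℝ f (sinSP n))))]
  refine le_of_sq_le_sq ?_ (norm_nonneg _)
  nlinarith [Real.pi_pos]

end SP

/-! ### Energy estimates for the nonlinearity -/

namespace SP

theorem D_pow_add (j k : ℕ) (f : SP) : (D ^ (j + k)) f = (D ^ j) ((D ^ k) f) := by
  rw [pow_add]; rfl

theorem D_pow_H (a : ℝ) (k : ℕ) (f : SP) : (D ^ k) (H a f) = H a ((D ^ k) f) := by
  induction k with
  | zero => rfl
  | succ k ih => rw [D_pow_succ', ih, D_H, D_pow_succ']

theorem norm_D_pow_mul_le {k : ℕ} {B : ℝ} {u v : SP}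
    (h : ∀ i j, i + j = k → ‖(D ^ i) u * (D ^ j) v‖ ≤ B) : ‖(D ^ k) (u * v)‖ ≤ 2 ^ k * B := by
  induction k generalizing u v with
  | zero => simpa using h 0 0 rfl
  | succ k ih =>
    rw [D_pow_succ, D_mul, map_add]
    have h1 := ih (u := D u) (v := v) fun i j hij => by
      simpa only [D_pow_succ] using h (i + 1) j (by omega)
    have h2 := ih (u := u) (v := D v) fun i j hij => by
      simpa only [D_pow_succ] using h i (j + 1) (by omega)
    refine (norm_add_le _ _).trans ?_
    rw [pow_succ]
    linarith

/-- Leibniz expansion: in every surviving term at least one derivative falls on `u`, and the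
binomial coefficients add up to at most `2 ^ k`. -/
theorem norm_commutator_le {k : ℕ} {B : ℝ} {u v : SP}
    (h : ∀ i j, i + 1 + j = k → ‖(D ^ (i + 1)) u * (D ^ j) v‖ ≤ B) (hB : 0 ≤ B) :
    ‖(D ^ k) (u * v) - u * (D ^ k) v‖ ≤ 2 ^ k * B := by
  induction k generalizing u v with
  | zero => simpa using hB
  | succ k ih =>
    have e : (D ^ (k + 1)) (u * v) - u * (D ^ (k + 1)) v =
        (D ^ k) (D u * v) + ((D ^ k) (u * D v) - u * (D ^ k) (D v)) := by
      rw [D_pow_succ, D_mul, map_add, D_pow_succ]; abel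
    rw [e]
    have h1 := norm_D_pow_mul_le (k := k) (B := B) (u := D u) (v := v) fun i j hij => by
      simpa only [D_pow_succ] using h i j (by omega)
    have h2 := ih (u := u) (v := D v) fun i j hij => by
      simpa only [D_pow_succ] using h i (j + 1) (by omega)
    refine (norm_add_le _ _).trans ?_
    rw [pow_succ]
    linarith

theorem norm_D_pow_mul_le_of_bounds {k : ℕ} {M M' : ℝ} {u v : SP} (hM : 0 ≤ M)
    (hu : ∀ i ≤ k + 1, ‖(D ^ i) u‖ ≤ M) (hv : ∀ i ≤ k, ‖(D ^ i) v‖ ≤ M') :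
    ‖(D ^ k) (u * v)‖ ≤ 2 ^ k * (4 * M * M') := by
  refine norm_D_pow_mul_le fun i j hij => (norm_mul_le _ _).trans ?_
  have h1 := supNorm_le_norm_add ((D ^ i) u)
  have h2 := hu i (by omega)
  have h3 := hu (i + 1) (by omega)
  rw [D_pow_succ'] at h3
  exact mul_le_mul (by linarith) (hv j (by omega)) (norm_nonneg _) (by linarith)

/-- The nonlinearity: the equation is `∂ₜ ρ = nonlin g a ρ`. -/
noncomputable def nonlin (g a : ℝ) (f : SP) : SP := (-g) • (H a f * D f)

theorem nonlin_apply (g a : ℝ) (f : SP) (x : ℝ) : nonlin g a f x = -(g * H a f x * D f x) := by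
  simp [nonlin, mul_assoc]

theorem nonlin_sub (g a : ℝ) (r f : SP) :
    nonlin g a r - nonlin g a f = (-g) • (H a f * D (r - f) + H a (r - f) * D r) := by
  simp only [nonlin, map_sub, ← smul_sub]
  congr 1
  ring

theorem norm_D_pow_H_le (a : ℝ) (k : ℕ) (f : SP) : ‖(D ^ k) (H a f)‖ ≤ 2 * ‖(D ^ k) f‖ := by
  rw [D_pow_H]; exact norm_H_le _ _

/-- A crude estimate that loses one derivative. It serves to pass to the limit in the equation,
where every norm is already controlled. -/
theorem norm_D_pow_nonlin_sub_le (g a : ℝ) {k : ℕ} {M ε : ℝ} {r f : SP} (hM : 0 ≤ M) (hε : 0 ≤ ε)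
    (hr : ∀ i ≤ k + 1, ‖(D ^ i) r‖ ≤ M) (hf : ∀ i ≤ k + 1, ‖(D ^ i) f‖ ≤ M)
    (hw : ∀ i ≤ k + 1, ‖(D ^ i) (r - f)‖ ≤ ε) :
    ‖(D ^ k) (nonlin g a r - nonlin g a f)‖ ≤ |g| * (2 ^ k * (16 * M)) * ε := by
  rw [nonlin_sub, map_smul, map_add, norm_smul, Real.norm_eq_abs, abs_neg, mul_assoc]
  refine mul_le_mul_of_nonneg_left ((norm_add_le _ _).trans ?_) (abs_nonneg _)
  have h1 := norm_D_pow_mul_le_of_bounds (k := k) (M := 2 * M) (M' := ε) (u := H a f)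
    (v := D (r - f)) (by linarith)
    (fun i hi => (norm_D_pow_H_le a i f).trans (by linarith [hf i hi]))
    (fun i hi => by rw [← D_pow_succ]; exact hw _ (by omega))
  have h2 := norm_D_pow_mul_le_of_bounds (k := k) (M := 2 * ε) (M' := M) (u := H a (r - f))
    (v := D r) (by linarith)
    (fun i hi => (norm_D_pow_H_le a i _).trans (by linarith [hw i hi]))
    (fun i hi => by rw [← D_pow_succ]; exact hr _ (by omega))
  linarith

theorem nonlin_zero (g a : ℝ) : nonlin g a 0 = 0 := by simp [nonlin]

theorem norm_D_pow_nonlin_le (g a : ℝ) {k : ℕ} {M : ℝ} {f : SP} (hM : 0 ≤ M)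
    (hf : ∀ i ≤ k + 1, ‖(D ^ i) f‖ ≤ M) :
    ‖(D ^ k) (nonlin g a f)‖ ≤ |g| * (2 ^ k * (16 * M)) * M := by
  simpa [nonlin_zero] using norm_D_pow_nonlin_sub_le g a (r := f) (f := 0) hM hM hf
    (by simpa using fun i _ => hM) (by simpa using hf)

theorem abs_inner_transport_le (p w : SP) :
    |inner ℝ w (p * D w)| ≤ 1 / 2 * supNorm (D p) * ‖w‖ ^ 2 := by
  rw [inner_mul_D, abs_mul]
  have := abs_inner_mul_le w w (D p)
  norm_num
  nlinarith

theorem supNorm_H_D_le (a : ℝ) (f : SP) : supNorm (H a (D f)) ≤ 6 * ‖D (D f)‖ := by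
  have h1 := supNorm_D_le (H a f)
  have h2 := norm_H_le a (D (D f))
  rw [D_H, D_H] at h1
  linarith

/-- The transport term `H a f * D (r - f)` is integrated by parts and the other term uses `L²`
boundedness of `H a`. The asymmetry matters for uniqueness: `r` enters only through `supNorm (D r)`,
which is available for an arbitrary smooth solution. -/
theorem abs_inner_nonlin_sub_le (g a : ℝ) (r f : SP) :
    |inner ℝ (r - f) (nonlin g a r - nonlin g a f)| ≤
      |g| * (supNorm (H a (D f)) + 2 * supNorm (D r)) * ‖r - f‖ ^ 2 := by
  set w := r - f with hw
  rw [nonlin_sub, ← hw, inner_smul_right, abs_mul, abs_neg, mul_assoc]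
  refine mul_le_mul_of_nonneg_left ?_ (abs_nonneg _)
  rw [inner_add_right]
  have h1 := abs_inner_transport_le (H a f) w
  rw [D_H] at h1
  have h2 := abs_inner_mul_le w (H a w) (D r)
  rw [mul_comm (D r)] at h2
  have h3 : ‖w‖ * ‖H a w‖ ≤ 2 * ‖w‖ ^ 2 := by nlinarith [norm_H_le a w, norm_nonneg w]
  have h4 := mul_le_mul_of_nonneg_left h3 (supNorm_nonneg (D r))
  have h5 := mul_nonneg (supNorm_nonneg (H a (D f))) (sq_nonneg ‖w‖)
  refine (abs_add_le _ _).trans ?_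
  nlinarith

theorem abs_inner_nonlin_le (g a : ℝ) (f : SP) :
    |inner ℝ f (nonlin g a f)| ≤ |g| * supNorm (H a (D f)) * ‖f‖ ^ 2 := by
  rw [nonlin, inner_smul_right, abs_mul, abs_neg, mul_assoc]
  refine mul_le_mul_of_nonneg_left ?_ (abs_nonneg _)
  have h1 := abs_inner_transport_le (H a f) f
  rw [D_H] at h1
  have h5 := mul_nonneg (supNorm_nonneg (H a (D f))) (sq_nonneg ‖f‖)
  linarith

/-- Of the terms of `D²(H f · D f)`, only `H f · D³ f` exceeds second order, and it is a transport
term. The others pair two second-order factors in `L²` with a first-order factor in supremum norm.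
-/
theorem abs_inner_D_D_nonlin_le (g a : ℝ) (f : SP) :
    |inner ℝ (D (D f)) (D (D (nonlin g a f)))| ≤
      |g| * (3 * supNorm (H a (D f)) + 2 * supNorm (D f)) * ‖D (D f)‖ ^ 2 := by
  have e : D (D (nonlin g a f)) = (-g) • (H a f * D (D (D f)) + ((2 : ℝ) • (H a (D f) * D (D f))
      + D f * H a (D (D f)))) := by
    simp only [nonlin, map_smul, D_mul, map_add, D_H]
    congr 1
    rw [two_smul]
    ring
  set w := D (D f) with hw
  rw [e, inner_smul_right, abs_mul, abs_neg, mul_assoc]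
  refine mul_le_mul_of_nonneg_left ?_ (abs_nonneg _)
  rw [inner_add_right, inner_add_right, inner_smul_right]
  have h1 := abs_inner_transport_le (H a f) w
  rw [D_H] at h1
  have h2 := abs_inner_mul_le w w (H a (D f))
  have h3 := abs_inner_mul_le w (H a w) (D f)
  have h4 : ‖w‖ * ‖H a w‖ ≤ 2 * ‖w‖ ^ 2 := by nlinarith [norm_H_le a w, norm_nonneg w]
  have h5 := mul_le_mul_of_nonneg_left h4 (supNorm_nonneg (D f))
  have h6 := mul_nonneg (supNorm_nonneg (H a (D f))) (sq_nonneg ‖w‖)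
  refine (abs_add_le _ _).trans ?_
  have h7 := abs_add_le (2 * inner ℝ w (H a (D f) * w)) (inner ℝ w (D f * H a w))
  rw [abs_mul, abs_two] at h7
  nlinarith

/-- The `H²` energy. -/
noncomputable def energy (f : SP) : ℝ := ‖f‖ ^ 2 + ‖D (D f)‖ ^ 2

theorem energy_nonneg (f : SP) : 0 ≤ energy f := by unfold energy; positivity

theorem norm_le_sqrt_energy (f : SP) : ‖f‖ ≤ √(energy f) :=
  Real.le_sqrt_of_sq_le (by unfold energy; linarith [sq_nonneg ‖D (D f)‖])

theorem norm_D_D_le_sqrt_energy (f : SP) : ‖D (D f)‖ ≤ √(energy f) :=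
  Real.le_sqrt_of_sq_le (by unfold energy; linarith [sq_nonneg ‖f‖])

theorem abs_energy_rate_le (g a : ℝ) (f : SP) :
    |inner ℝ f (nonlin g a f)| + |inner ℝ (D (D f)) (D (D (nonlin g a f)))| ≤
      |g| * (3 * supNorm (H a (D f)) + 2 * supNorm (D f)) * energy f := by
  have h1 := abs_inner_nonlin_le g a f
  have h2 := abs_inner_D_D_nonlin_le g a f
  have h3 : 0 ≤ |g| * (2 * supNorm (H a (D f)) + 2 * supNorm (D f)) * ‖f‖ ^ 2 :=
    mul_nonneg (mul_nonneg (abs_nonneg _) (by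
      linarith [supNorm_nonneg (H a (D f)), supNorm_nonneg (D f)])) (sq_nonneg _)
  unfold energy
  nlinarith

theorem abs_energy_rate_le' (g a : ℝ) (f : SP) :
    |inner ℝ f (nonlin g a f)| + |inner ℝ (D (D f)) (D (D (nonlin g a f)))| ≤
      24 * |g| * (energy f * √(energy f)) := by
  refine (abs_energy_rate_le g a f).trans ?_
  have h1 := supNorm_H_D_le a f
  have h2 := supNorm_D_le f
  have h3 := norm_D_D_le_sqrt_energy f
  have h4 : |g| * (3 * supNorm (H a (D f)) + 2 * supNorm (D f)) ≤ |g| * (24 * √(energy f)) :=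
    mul_le_mul_of_nonneg_left (by linarith) (abs_nonneg _)
  refine (mul_le_mul_of_nonneg_right h4 (energy_nonneg f)).trans (le_of_eq (by ring))

theorem norm_D_pow_le_of_le {i k : ℕ} (hi : 1 ≤ i) (hik : i ≤ k) (f : SP) :
    ‖(D ^ i) f‖ ≤ 9 ^ (k - i) * ‖(D ^ k) f‖ := by
  induction k, hik using Nat.le_induction with
  | base => simp
  | succ k hik ih =>
    refine ih.trans ?_
    obtain ⟨m, rfl⟩ : ∃ m, k = m + 1 := ⟨k - 1, by omega⟩
    rw [show m + 1 + 1 - i = (m + 1 - i) + 1 by omega, pow_succ (9 : ℝ), mul_assoc]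
    refine mul_le_mul_of_nonneg_left ?_ (by positivity)
    rw [D_pow_succ', D_pow_succ' (m + 1), D_pow_succ']
    exact norm_D_le _

/-- For `k ≥ 3` the rate is linear in `‖D ^ k f‖²`, with a coefficient built from lower derivatives
only. Hence all higher norms stay bounded for as long as the `H²` energy does. -/
theorem abs_inner_D_pow_nonlin_le (g a : ℝ) {k : ℕ} (hk : 3 ≤ k) {f : SP} {M : ℝ}
    (hM : ∀ i, 1 ≤ i → i < k → ‖(D ^ i) f‖ ≤ M) :
    |inner ℝ ((D ^ k) f) ((D ^ k) (nonlin g a f))| ≤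
      |g| * ((3 + 2 ^ k * (6 * 9 ^ k)) * M) * ‖(D ^ k) f‖ ^ 2 := by
  have hM0 : 0 ≤ M := (norm_nonneg _).trans (hM 1 le_rfl (by omega))
  set w := (D ^ k) f with hw
  have h2M : ‖D (D f)‖ ≤ M := hM 2 (by omega) (by omega)
  set B := 6 * 9 ^ k * M * ‖w‖ with hB
  have hB0 : 0 ≤ B := by positivity
  have h9 : (1 : ℝ) ≤ 9 ^ k := one_le_pow₀ (by norm_num)
  have hBle : 6 * M * ‖w‖ ≤ B := by
    rw [hB]
    have : 0 ≤ M * ‖w‖ := by positivity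
    nlinarith
  have hcomm : ‖(D ^ k) (H a f * D f) - H a f * (D ^ k) (D f)‖ ≤ 2 ^ k * B := by
    refine norm_commutator_le (fun i j hij => ?_) hB0
    rw [D_pow_H, ← D_pow_succ]
    -- If all `k` derivatives fall on one factor, the other is `D f` or `H a (D f)` and is bounded
    -- in supremum norm by `M`. In the mixed terms the supremum norm is placed on the `D f` factor,
    -- of order at most `k` after embedding, and the factor with `H a` has order below `k`.
    rcases Nat.eq_zero_or_pos i with rfl | hi
    · have h1 := norm_mul_le (H a ((D ^ (0 + 1)) f)) ((D ^ (j + 1)) f)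
      have h2 := supNorm_H_D_le a f
      have h3 : (D ^ (0 + 1)) f = D f := by simp
      rw [h3] at h1 ⊢
      rw [show j + 1 = k by omega] at h1 ⊢
      refine h1.trans (le_trans ?_ hBle)
      exact mul_le_mul_of_nonneg_right (by linarith) (norm_nonneg _)
    · rw [mul_comm]
      have h1 := norm_mul_le ((D ^ (j + 1)) f) (H a ((D ^ (i + 1)) f))
      have h2 := norm_H_le a ((D ^ (i + 1)) f)
      have h3 := supNorm_D_le ((D ^ j) f)
      rw [← D_pow_succ', ← D_pow_succ'] at h3
      refine h1.trans ?_
      rcases Nat.eq_zero_or_pos j with rfl | hj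
      · have h4 : ‖(D ^ (0 + 1 + 1)) f‖ ≤ M := hM _ (by omega) (by omega)
        rw [show i + 1 = k by omega] at h2 ⊢
        refine le_trans ?_ hBle
        calc _ ≤ (3 * M) * (2 * ‖w‖) := mul_le_mul (by linarith) h2 (norm_nonneg _) (by positivity)
          _ = _ := by ring
      · have h4 := norm_D_pow_le_of_le (i := j + 1 + 1) (k := k) (by omega) (by omega) f
        have h5 := hM (i + 1) (by omega) (by omega)
        have h6 : (9 : ℝ) ^ (k - (j + 1 + 1)) ≤ 9 ^ k := pow_le_pow_right₀ (by norm_num) (by omega)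
        have h7 : ‖(D ^ (j + 1 + 1)) f‖ ≤ 9 ^ k * ‖w‖ :=
          h4.trans (mul_le_mul_of_nonneg_right h6 (norm_nonneg _))
        calc _ ≤ (3 * (9 ^ k * ‖w‖)) * (2 * M) :=
              mul_le_mul (by linarith) (by linarith) (norm_nonneg _) (by positivity)
          _ = B := by rw [hB]; ring
  have hmain := abs_inner_transport_le (H a f) w
  rw [D_H] at hmain
  have hsup := supNorm_H_D_le a f
  have e : inner ℝ w ((D ^ k) (H a f * D f)) = inner ℝ w (H a f * D w) +
      inner ℝ w ((D ^ k) (H a f * D f) - H a f * (D ^ k) (D f)) := by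
    rw [← inner_add_right, hw, ← D_pow_succ', D_pow_succ]
    congr 1; abel
  rw [nonlin, map_smul, inner_smul_right, abs_mul, abs_neg, e, mul_assoc]
  refine mul_le_mul_of_nonneg_left ((abs_add_le _ _).trans ?_) (abs_nonneg _)
  have h8 := (abs_real_inner_le_norm w ((D ^ k) (H a f * D f) - H a f * (D ^ k) (D f))).trans
    (mul_le_mul_of_nonneg_left hcomm (norm_nonneg w))
  have h9 : |inner ℝ w (H a f * D w)| ≤ 3 * M * ‖w‖ ^ 2 :=
    hmain.trans (mul_le_mul_of_nonneg_right (by linarith) (sq_nonneg _))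
  have h10 : ‖w‖ * (2 ^ k * B) = 2 ^ k * (6 * 9 ^ k) * M * ‖w‖ ^ 2 := by rw [hB]; ring
  linarith

end SP

/-- Grönwall's inequality on `[0, τ]`. -/
theorem le_exp_of_deriv_le {E E' : ℝ → ℝ} {τ A δ : ℝ}
    (hE : ∀ t ∈ Icc 0 τ, HasDerivWithinAt E (E' t) (Icc 0 τ) t) (hδ : 0 ≤ δ)
    (hle : ∀ t ∈ Icc 0 τ, E' t ≤ A * E t + A * δ) {t : ℝ} (ht : t ∈ Icc 0 τ) :
    E t ≤ (E 0 + δ) * Real.exp (A * t) := by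
  have hanti : AntitoneOn (fun s => (E s + δ) * Real.exp (-(A * s))) (Icc 0 τ) := by
    have hexp : ∀ s : ℝ, HasDerivAt (fun s => Real.exp (-(A * s))) (Real.exp (-(A * s)) * -A) s := by
      intro s
      have : HasDerivAt (fun s => -(A * s)) (-A) s := by
        simpa using! ((hasDerivAt_id s).const_mul A).fun_neg
      exact this.exp
    refine antitoneOn_of_hasDerivWithinAt_nonpos (convex_Icc 0 τ)
      (f' := fun s => E' s * Real.exp (-(A * s)) + (E s + δ) * (Real.exp (-(A * s)) * -A))
      (fun s hs => (((hE s hs).add_const δ).mul (hexp s).hasDerivWithinAt).continuousWithinAt)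
      (fun s hs => (((hE s (interior_subset hs)).add_const δ).mul
        (hexp s).hasDerivWithinAt).mono interior_subset) fun s hs => ?_
    have := hle s (interior_subset hs)
    have h2 : E' s * Real.exp (-(A * s)) + (E s + δ) * (Real.exp (-(A * s)) * -A) =
        (E' s - (A * E s + A * δ)) * Real.exp (-(A * s)) := by ring
    rw [h2]
    exact mul_nonpos_of_nonpos_of_nonneg (by linarith) (Real.exp_pos _).le
  have h := hanti (left_mem_Icc.2 (ht.1.trans ht.2)) ht ht.1
  simp only [mul_zero, neg_zero, Real.exp_zero, mul_one] at h
  rw [Real.exp_neg, ← div_eq_mul_inv, div_le_iff₀ (Real.exp_pos _)] at h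
  linarith

/-! ### Even trigonometric polynomials and their projections -/

namespace SP

/-- Even functions. -/
def IsEven (f : SP) : Prop := ∀ x, f (-x) = f x

theorem inner_sinSP_of_isEven {f : SP} (hf : IsEven f) (n : ℤ) : inner ℝ f (sinSP n) = 0 := by
  have h := intervalIntegral.integral_comp_neg (a := -Real.pi) (b := Real.pi)
    (fun x => (f * sinSP n) x)
  have h2 : ∀ x, (f * sinSP n) (-x) = -(f * sinSP n) x := fun x => by
    simp [hf x]
  simp only [h2, neg_neg, intervalIntegral.integral_neg] at h
  rw [inner_def, integral_def]
  linarith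

theorem isEven_nonlin (g a : ℝ) {f : SP} (hf : IsEven f) : IsEven (nonlin g a f) := by
  have h1 : ∀ x, H a f (-x) = -H a f x := fun x => by
    rw [H_apply, H_apply, ← integral_neg]
    congr 1; ext y
    rw [show -x - y = -(x + y) by ring, show -x + y = -(x - y) by ring, hf, hf]
    ring
  have h2 : ∀ x, D f (-x) = -D f x := fun x => by
    have : f = fun y => f (-y) := funext fun y => (hf y).symm
    rw [D_apply, D_apply]
    conv_rhs => rw [this]
    rw [deriv_comp_neg, neg_neg]
  intro x
  rw [nonlin_apply, nonlin_apply, h1, h2]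
  ring

/-- Even trigonometric polynomials of degree at most `N`. -/
noncomputable def cosSpan (N : ℕ) : Submodule ℝ SP :=
  Submodule.span ℝ (range fun n : Fin (N + 1) => cosSP n)

instance (N : ℕ) : FiniteDimensional ℝ (cosSpan N) :=
  FiniteDimensional.span_of_finite ℝ (finite_range _)

theorem cosSP_neg (n : ℤ) : cosSP (-n) = cosSP n := by
  ext x; simp

theorem cosSP_mem {N : ℕ} {n : ℤ} (hn : |n| < (N + 1 : ℕ)) : cosSP n ∈ cosSpan N := by
  have h : cosSP n = cosSP n.natAbs := by
    rcases Int.natAbs_eq n with h | h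
    · rw [← h]
    · conv_lhs => rw [h, cosSP_neg]
  rw [h]
  exact Submodule.subset_span ⟨⟨n.natAbs, by
    rw [Int.abs_eq_natAbs] at hn; exact_mod_cast hn⟩, rfl⟩

theorem isEven_of_mem {N : ℕ} {f : SP} (hf : f ∈ cosSpan N) : IsEven f := by
  induction hf using Submodule.span_induction with
  | mem f h => obtain ⟨n, rfl⟩ := h; intro x; simp
  | zero => intro x; rfl
  | add f g _ _ hf hg => intro x; simp [hf x, hg x]
  | smul c f _ hf => intro x; simp [hf x]

theorem D_D_mem {N : ℕ} {f : SP} (hf : f ∈ cosSpan N) : D (D f) ∈ cosSpan N := by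
  induction hf using Submodule.span_induction with
  | mem f h =>
    obtain ⟨n, rfl⟩ := h
    simp only [D_cosSP, map_smul, D_sinSP]
    exact Submodule.smul_mem _ _ (Submodule.smul_mem _ _ (Submodule.subset_span ⟨n, rfl⟩))
  | zero => simp
  | add f g _ _ hf hg => simpa only [map_add] using Submodule.add_mem _ hf hg
  | smul c f _ hf => simpa only [map_smul] using Submodule.smul_mem _ c hf

theorem D_pow_two_mul_mem {N : ℕ} {f : SP} (hf : f ∈ cosSpan N) (k : ℕ) :
    (D ^ (2 * k)) f ∈ cosSpan N := by
  induction k with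
  | zero => simpa using hf
  | succ k ih =>
    rw [show 2 * (k + 1) = 2 * k + 1 + 1 by ring, D_pow_succ', D_pow_succ']
    exact D_D_mem ih

/-- The orthogonal projection onto even trigonometric polynomials of degree at most `N`. -/
noncomputable def proj (N : ℕ) : SP →L[ℝ] SP := (cosSpan N).starProjection

theorem proj_mem (N : ℕ) (f : SP) : proj N f ∈ cosSpan N :=
  (cosSpan N).starProjection_apply_mem f

theorem norm_proj_le (N : ℕ) (f : SP) : ‖proj N f‖ ≤ ‖f‖ :=
  (cosSpan N).norm_starProjection_apply_le f

theorem inner_sub_proj {N : ℕ} (f : SP) {h : SP} (hh : h ∈ cosSpan N) :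
    inner ℝ (f - proj N f) h = 0 :=
  Submodule.starProjection_inner_eq_zero f h hh

/-- A single derivative turns cosines into sines and leaves the space. Only even powers of `D`
commute with the projection, which is why orders `2 * k` recur below. -/
theorem proj_D_D (N : ℕ) (f : SP) : proj N (D (D f)) = D (D (proj N f)) := by
  refine (Submodule.eq_starProjection_of_mem_of_inner_eq_zero (D_D_mem (proj_mem N f))
    fun w hw => ?_)
  rw [← map_sub, ← map_sub, inner_D_left, inner_D_left, neg_neg]
  exact inner_sub_proj f (D_D_mem hw)

theorem proj_D_pow (N k : ℕ) (f : SP) : proj N ((D ^ (2 * k)) f) = (D ^ (2 * k)) (proj N f) := by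
  induction k with
  | zero => rfl
  | succ k ih =>
    rw [show 2 * (k + 1) = 2 * k + 1 + 1 by ring, D_pow_succ', D_pow_succ', proj_D_D, ih,
      D_pow_succ', D_pow_succ']

theorem inner_D_pow_left (k : ℕ) (u v : SP) :
    inner ℝ ((D ^ k) u) v = (-1) ^ k * inner ℝ u ((D ^ k) v) := by
  induction k generalizing u with
  | zero => simp
  | succ k ih => rw [D_pow_succ, ih, inner_D_left, D_pow_succ', pow_succ]; ring

/-- All derivatives are moved onto `f`, where `D ^ (2 * k) f` is again in the space. Energy
estimates for Galerkin solutions thus reduce to those without projection. -/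
theorem inner_D_pow_proj {N : ℕ} {f : SP} (hf : f ∈ cosSpan N) (k : ℕ) (u : SP) :
    inner ℝ ((D ^ k) f) ((D ^ k) (proj N u)) = inner ℝ ((D ^ k) f) ((D ^ k) u) := by
  have h := inner_sub_proj u (D_pow_two_mul_mem hf k)
  rw [two_mul, D_pow_add, real_inner_comm, inner_D_pow_left, map_sub, inner_sub_right] at h
  have := mul_eq_zero.1 h
  have h1 : ((-1 : ℝ) ^ k) ≠ 0 := pow_ne_zero _ (by norm_num)
  linarith [this.resolve_left h1]

theorem norm_sub_proj_le {f : SP} (hf : IsEven f) (N : ℕ) :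
    ((N + 1 : ℕ) : ℝ) ^ 2 * ‖f - proj N f‖ ≤ 2 * ‖D (D f)‖ := by
  have h1 : IsEven (f - proj N f) := fun x => by
    simp [hf x, isEven_of_mem (proj_mem N f) x]
  refine (norm_le_of_inner_eq_zero fun n hn =>
    ⟨inner_sub_proj f (cosSP_mem hn), inner_sinSP_of_isEven h1 n⟩).trans ?_
  rw [map_sub, map_sub, ← proj_D_D]
  have := norm_sub_le (D (D f)) (proj N (D (D f)))
  linarith [norm_proj_le N (D (D f))]

theorem norm_D_pow_le_two_mul (k : ℕ) (f : SP) : ‖(D ^ k) f‖ ≤ 9 ^ k * ‖(D ^ (2 * k)) f‖ := by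
  rcases Nat.eq_zero_or_pos k with rfl | hk
  · simp
  · have := norm_D_pow_le_of_le (i := k) (k := 2 * k) hk (by omega) f
    rwa [show 2 * k - k = k by omega] at this

theorem isEven_D_pow {f : SP} (hf : IsEven f) (k : ℕ) : IsEven ((D ^ (2 * k)) f) := by
  have h2 : ∀ p : SP, IsEven p → IsEven (D (D p)) := fun p hp x => by
    have e1 : ∀ x, D p (-x) = -D p x := fun x => by
      have : p = fun y => p (-y) := funext fun y => (hp y).symm
      rw [D_apply, D_apply]
      conv_rhs => rw [this]
      rw [deriv_comp_neg, neg_neg]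
    have e2 : D p = fun y => -D p (-y) := funext fun y => by rw [e1, neg_neg]
    rw [D_apply, D_apply]
    conv_rhs => rw [e2]
    rw [deriv.fun_neg, deriv_comp_neg, neg_neg]
  induction k with
  | zero => simpa using hf
  | succ k ih =>
    rw [show 2 * (k + 1) = 2 * k + 1 + 1 by ring, D_pow_succ', D_pow_succ']
    exact h2 _ ih

/-- Raise `k` to the even order `2k` by Poincaré, commute with the projection there, and use the
frequency gap. Evenness of `f` disposes of the sine modes. -/
theorem norm_D_pow_sub_proj_le {f : SP} (hf : IsEven f) (N k : ℕ) :
    ((N + 1 : ℕ) : ℝ) ^ 2 * ‖(D ^ k) (f - proj N f)‖ ≤ 9 ^ k * (2 * ‖(D ^ (2 * k + 2)) f‖) := by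
  have h1 := norm_D_pow_le_two_mul k (f - proj N f)
  rw [map_sub (D ^ (2 * k)), ← proj_D_pow] at h1
  have h2 := norm_sub_proj_le (isEven_D_pow hf k) N
  rw [← D_pow_succ', ← D_pow_succ'] at h2
  calc _ ≤ ((N + 1 : ℕ) : ℝ) ^ 2 * (9 ^ k * ‖(D ^ (2 * k)) f - proj N ((D ^ (2 * k)) f)‖) :=
        mul_le_mul_of_nonneg_left h1 (by positivity)
    _ = 9 ^ k * (((N + 1 : ℕ) : ℝ) ^ 2 * ‖(D ^ (2 * k)) f - proj N ((D ^ (2 * k)) f)‖) := by ring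
    _ ≤ _ := mul_le_mul_of_nonneg_left h2 (by positivity)

theorem energy_proj_le (N : ℕ) (f : SP) : energy (proj N f) ≤ energy f := by
  unfold energy
  rw [← proj_D_D]
  gcongr
  · exact norm_proj_le N f
  · exact norm_proj_le N _

/-! ### Truncated equations -/

/-- The cutoff equals `1` for energy at most `2R` and vanishes for energy at least `3R`. The vector
field on this finite-dimensional space becomes compactly supported, hence globally Lipschitz, so
that solutions exist on any prescribed interval. -/
theorem exists_truncated_ode (g a : ℝ) (N : ℕ) {R : ℝ} (hR : 0 < R) (b₀ : cosSpan N) {τ : ℝ}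
    (hτ : 0 ≤ τ) :
    ∃ b : ℝ → cosSpan N, b 0 = b₀ ∧ ∀ t ∈ Icc 0 τ, HasDerivWithinAt b
      (Real.smoothTransition (3 - energy (b t) / R) •
        (cosSpan N).orthogonalProjectionOnto (nonlin g a (b t))) (Icc 0 τ) t := by
  have hbil : IsBilinearMap ℝ fun b c : cosSpan N =>
      (cosSpan N).orthogonalProjectionOnto ((-g) • (H a b * D c)) := by
    constructor <;> intros <;> simp [add_mul, mul_add]
    all_goals rw [smul_comm]
  set B := hbil.toContinuousBilinearMap with hB
  set T : cosSpan N →L[ℝ] SP := ((D ^ 2) ∘ₗ (cosSpan N).subtype).toContinuousLinearMap with hT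
  have hTapp : ∀ b : cosSpan N, T b = D (D b) := fun b => rfl
  set X : cosSpan N → cosSpan N := fun b => Real.smoothTransition (3 - energy (b : SP) / R) • B b b with hX
  have hen : ∀ b : cosSpan N, energy (b : SP) = ‖b‖ ^ 2 + ‖T b‖ ^ 2 := fun b => rfl
  have hXs : ContDiff ℝ 1 X := by
    refine ContDiff.smul (Real.smoothTransition.contDiff.comp ?_) (B.contDiff.clm_apply contDiff_id)
    simp only [hen]
    exact contDiff_const.sub (((contDiff_norm_sq ℝ).add (T.contDiff.norm_sq ℝ)).div_const R)
  have hXc : HasCompactSupport X := by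
    refine HasCompactSupport.intro (isCompact_closedBall (0 : cosSpan N) √(3 * R)) fun b hb => ?_
    rw [mem_closedBall_zero_iff, not_le] at hb
    have hb' := Real.lt_sq_of_sqrt_lt hb
    have : 3 - energy (b : SP) / R ≤ 0 := by
      rw [sub_nonpos, le_div_iff₀ hR, hen]
      nlinarith [sq_nonneg ‖T b‖]
    simp [hX, Real.smoothTransition.zero_of_nonpos this]
  obtain ⟨K, hK⟩ := ContDiff.lipschitzWith_of_hasCompactSupport (𝕂 := ℝ) hXc hXs one_ne_zero
  obtain ⟨C, hC⟩ := hXs.continuous.bounded_above_of_compact_support hXc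
  have hC0 : 0 ≤ C := (norm_nonneg _).trans (hC 0)
  -- The field is bounded by `C` everywhere, so a ball of radius `C τ` contains the trajectory up to
  -- time `τ`.
  have hpl : IsPicardLindelof (fun _ => X) (⟨0, le_rfl, hτ⟩ : Icc 0 τ) b₀
      (C.toNNReal * τ.toNNReal) 0 C.toNNReal K := by
    refine IsPicardLindelof.of_time_independent (fun x _ => ?_) hK.lipschitzOnWith ?_
    · rw [Real.coe_toNNReal _ hC0]; exact hC x
    · simp [Real.coe_toNNReal _ hC0, hτ]
  obtain ⟨b, hb0, hb⟩ := hpl.exists_eq_forall_mem_Icc_hasDerivWithinAt₀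
  exact ⟨b, hb0, hb⟩

/-- A lower bound for the time of existence in terms of the initial energy. -/
noncomputable def lifespan (g R : ℝ) : ℝ := R / (48 * |g| * (3 * R * √(3 * R)) + 1)

theorem lifespan_pos (g : ℝ) {R : ℝ} (hR : 0 < R) : 0 < lifespan g R := by
  unfold lifespan; positivity

theorem HasTD.energy {F : ℝ → SP} {G : SP} {I : Set ℝ} {t : ℝ} (h : HasTD F G I t) :
    HasDerivWithinAt (fun s => energy (F s))
      (2 * inner ℝ (F t) G + 2 * inner ℝ (D (D (F t))) (D (D G))) I t :=
  (h 0).norm_sq.fun_add (h 2).norm_sq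

/-- The lifespan is chosen so short that the energy cannot grow from `R` past `2R`; there the cutoff
is inactive, and the truncated equation is the Galerkin equation. -/
theorem exists_galerkin (g a : ℝ) (N : ℕ) {R : ℝ} (hR : 0 < R) {ρ₀ : SP} (hρ₀ : energy ρ₀ ≤ R) :
    ∃ ρ : ℝ → SP, (∀ t, ρ t ∈ cosSpan N) ∧ ρ 0 = proj N ρ₀ ∧
      ∀ t ∈ Icc 0 (lifespan g R), energy (ρ t) ≤ 2 * R ∧
        HasTD ρ (proj N (nonlin g a (ρ t))) (Icc 0 (lifespan g R)) t := by
  set τ := lifespan g R with hτ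
  set V := cosSpan N
  have hτ0 := lifespan_pos g hR
  obtain ⟨b, hb0, hb⟩ := exists_truncated_ode g a N hR (V.orthogonalProjectionOnto ρ₀) hτ0.le
  set χ : ℝ → ℝ := fun t => Real.smoothTransition (3 - energy (b t) / R) with hχ
  have htd : ∀ t ∈ Icc 0 τ, HasTD (fun s => (b s : SP)) (χ t • proj N (nonlin g a (b t)))
      (Icc 0 τ) t := fun t ht k => by
    have := ((((D ^ k) ∘ₗ V.subtype).toContinuousLinearMap).hasFDerivAt).comp_hasDerivWithinAt t
      (hb t ht)
    exact this
  have hinit : energy (b 0 : SP) ≤ R := by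
    rw [hb0]; exact (energy_proj_le N ρ₀).trans hρ₀
  -- `L` bounds the energy rate where the cutoff is nonzero, that is for energy below `3R`. It is
  -- the denominator of `lifespan g R`, so `L τ = R`.
  set L := 48 * |g| * (3 * R * √(3 * R)) + 1 with hL
  have hL0 : 0 < L := by positivity
  have hrate : ∀ t ∈ Icc 0 τ, ‖2 * inner ℝ (b t : SP) (χ t • proj N (nonlin g a (b t))) +
      2 * inner ℝ (D (D (b t))) (D (D (χ t • proj N (nonlin g a (b t)))))‖ ≤ L := by
    intro t _
    have hmem : (b t : SP) ∈ cosSpan N := (b t).2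
    have e0 := inner_D_pow_proj hmem 0 (nonlin g a (b t))
    have e2 := inner_D_pow_proj hmem 2 (nonlin g a (b t))
    change inner ℝ (b t : SP) (proj N _) = inner ℝ (b t : SP) _ at e0
    change inner ℝ (D (D (b t))) (D (D (proj N _))) = inner ℝ (D (D (b t))) (D (D _)) at e2
    rw [map_smul, map_smul, inner_smul_right, inner_smul_right, e0, e2]
    have h1 := abs_energy_rate_le' g a (b t)
    have hχ0 : 0 ≤ χ t := Real.smoothTransition.nonneg _
    have hχ1 : χ t ≤ 1 := Real.smoothTransition.le_one _
    set p := inner ℝ (b t : SP) (nonlin g a (b t))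
    set q := inner ℝ (D (D (b t))) (D (D (nonlin g a (b t))))
    have h2 : |2 * (χ t * p) + 2 * (χ t * q)| ≤ χ t * (2 * (|p| + |q|)) := by
      rw [show 2 * (χ t * p) + 2 * (χ t * q) = χ t * (2 * (p + q)) by ring, abs_mul,
        abs_of_nonneg hχ0, abs_mul, abs_two]
      exact mul_le_mul_of_nonneg_left (by linarith [abs_add_le p q]) hχ0
    rw [Real.norm_eq_abs]
    refine h2.trans ?_
    rcases le_or_gt (energy (b t : SP)) (3 * R) with h3 | h3
    · have h4 : √(energy (b t : SP)) ≤ √(3 * R) := Real.sqrt_le_sqrt h3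
      have h5 : energy (b t : SP) * √(energy (b t : SP)) ≤ 3 * R * √(3 * R) :=
        mul_le_mul h3 h4 (Real.sqrt_nonneg _) (by positivity)
      have h6 := mul_le_mul_of_nonneg_left h5 (show 0 ≤ 24 * |g| by positivity)
      have h7 : 0 ≤ 2 * (|p| + |q|) := by positivity
      have h8 := mul_le_of_le_one_left h7 hχ1
      linarith
    · have : χ t = 0 := Real.smoothTransition.zero_of_nonpos (by
        rw [sub_nonpos, le_div_iff₀ hR]; exact h3.le)
      rw [this, zero_mul]
      exact hL0.le
  have henergy : ∀ t ∈ Icc 0 τ, energy (b t : SP) ≤ 2 * R := by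
    intro t ht
    have := (convex_Icc 0 τ).norm_image_sub_le_of_norm_hasDerivWithin_le
      (fun s hs => (htd s hs).energy) hrate (left_mem_Icc.2 hτ0.le) ht
    rw [sub_zero, Real.norm_eq_abs, Real.norm_of_nonneg ht.1] at this
    have h2 : L * t ≤ R := by
      have : L * τ = R := by rw [hτ, lifespan, mul_div_cancel₀ _ hL0.ne']
      rw [← this]
      exact mul_le_mul_of_nonneg_left ht.2 hL0.le
    linarith [le_abs_self (energy (b t : SP) - energy (b 0 : SP))]
  refine ⟨fun t => b t, fun t => (b t).2, by
    change (b 0 : SP) = _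
    rw [hb0]; rfl, fun t ht => ⟨henergy t ht, ?_⟩⟩
  have hone : χ t = 1 := Real.smoothTransition.one_of_one_le (by
    have : energy (b t : SP) / R ≤ 2 := by rw [div_le_iff₀ hR]; exact henergy t ht
    linarith)
  have := htd t ht
  rwa [hone, one_smul] at this

end SP

/-! ### Limits of approximate solutions -/

namespace SP

theorem tendsto_of_tendstoUniformly {f : ℕ → SP} {F : SP}
    (h : TendstoUniformly (fun n x => f n x) F atTop) : Tendsto f atTop (𝓝 F) := by
  rw [tendsto_iff_norm_sub_tendsto_zero]
  refine squeeze_zero (g := fun n => supNorm (f n - F : SP) * 3) (fun _ => norm_nonneg _)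
    (fun n => (norm_le_supNorm _).trans
      (mul_le_mul_of_nonneg_left norm_one_le (supNorm_nonneg _))) ?_
  rw [← zero_mul (3 : ℝ)]
  refine Tendsto.mul_const 3 ?_
  rw [Metric.tendsto_atTop]
  intro ε hε
  obtain ⟨n₀, hn₀⟩ := eventually_atTop.1 (Metric.tendstoUniformly_iff.1 h (ε / 2) (half_pos hε))
  refine ⟨n₀, fun n hn => ?_⟩
  rw [Real.dist_eq, sub_zero, abs_of_nonneg (supNorm_nonneg _)]
  refine lt_of_le_of_lt (supNorm_le fun x => ?_) (half_lt_self hε)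
  have := hn₀ n hn x
  rw [dist_comm, Real.dist_eq] at this
  exact this.le

/-- Completeness for all Sobolev norms at once. The derivatives converge uniformly, and the uniform
limits `G k` are successive derivatives of `G 0`. -/
theorem exists_tendsto {f : ℕ → SP}
    (h : ∀ k : ℕ, ∀ ε > 0, ∃ n₀, ∀ n ≥ n₀, ∀ m ≥ n₀, ‖(D ^ k) (f n - f m)‖ ≤ ε) :
    ∃ F : SP, ∀ k : ℕ, Tendsto (fun n => (D ^ k) (f n)) atTop (𝓝 ((D ^ k) F)) := by
  have hsup : ∀ k : ℕ, ∀ ε > 0, ∃ n₀, ∀ n ≥ n₀, ∀ m ≥ n₀, ∀ x,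
      |(D ^ k) (f n) x - (D ^ k) (f m) x| < ε := by
    intro k ε hε
    obtain ⟨n₀, h₀⟩ := h k (ε / 8) (by positivity)
    obtain ⟨n₁, h₁⟩ := h (k + 1) (ε / 8) (by positivity)
    refine ⟨max n₀ n₁, fun n hn m hm x => ?_⟩
    have e0 := h₀ n ((le_max_left _ _).trans hn) m ((le_max_left _ _).trans hm)
    have e1 := h₁ n ((le_max_right _ _).trans hn) m ((le_max_right _ _).trans hm)
    rw [D_pow_succ'] at e1
    have e2 := (((D ^ k) (f n - f m)).abs_le_supNorm x).trans (supNorm_le_norm_add _)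
    rw [map_sub, sub_apply] at e2
    rw [map_sub] at e0 e1
    linarith
  have hcau : ∀ k x, CauchySeq fun n => (D ^ k) (f n) x := fun k x => by
    rw [Metric.cauchySeq_iff]
    intro ε hε
    obtain ⟨n₀, h₀⟩ := hsup k ε hε
    exact ⟨n₀, fun n hn m hm => h₀ n hn m hm x⟩
  choose G hG using fun k x => cauchySeq_tendsto_of_complete (hcau k x)
  have hunif : ∀ k, TendstoUniformly (fun n x => (D ^ k) (f n) x) (G k) atTop := fun k => by
    rw [← tendstoUniformlyOn_univ]
    refine UniformCauchySeqOn.tendstoUniformlyOn_of_tendsto ?_ fun x _ => hG k x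
    rw [Metric.uniformCauchySeqOn_iff]
    intro ε hε
    obtain ⟨n₀, h₀⟩ := hsup k ε hε
    exact ⟨n₀, fun n hn m hm x _ => h₀ n hn m hm x⟩
  have hder : ∀ k x, HasDerivAt (G k) (G (k + 1) x) x := fun k x =>
    hasDerivAt_of_tendstoUniformly (f' := fun n x => (D ^ (k + 1)) (f n) x) (hunif (k + 1))
      (.of_forall fun n x => by rw [D_pow_succ']; exact ((D ^ k) (f n)).hasDerivAt x)
      (hG k) x
  have hsm : ∀ n : ℕ, ∀ k, ContDiff ℝ n (G k) := by
    intro n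
    induction n with
    | zero => exact fun k => contDiff_zero.2 (continuous_iff_continuousAt.2 fun x =>
        (hder k x).continuousAt)
    | succ n ih =>
      intro k
      rw [Nat.cast_succ, contDiff_succ_iff_deriv]
      refine ⟨fun x => (hder k x).differentiableAt, by simp, ?_⟩
      rw [show deriv (G k) = G (k + 1) from funext fun x => (hder k x).deriv]
      exact ih _
  have hper : Function.Periodic (G 0) (2 * Real.pi) := fun x =>
    tendsto_nhds_unique (hG 0 (x + 2 * Real.pi)) (by
      have : ∀ n, (D ^ 0) (f n) (x + 2 * Real.pi) = (D ^ 0) (f n) x := fun n =>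
        ((D ^ 0) (f n)).periodic x
      simpa only [this] using hG 0 x)
  set F : SP := mk (G 0) ⟨contDiff_infty.2 fun n => hsm n 0, hper⟩ with hF
  have hDF : ∀ k, ⇑((D ^ k) F) = G k := by
    intro k
    induction k with
    | zero => rfl
    | succ k ih =>
      rw [D_pow_succ', coe_D, ih]
      exact funext fun x => (hder k x).deriv
  refine ⟨F, fun k => tendsto_of_tendstoUniformly ?_⟩
  rw [hDF]
  exact hunif k

/-- Uniform `L²` smallness together with bounds on higher derivatives yields smallness of all
derivatives. -/
theorem exists_small_of_bounds {M : ℕ → ℝ} (k : ℕ) {ε : ℝ} (hε : 0 < ε) :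
    ∃ δ > 0, ∀ w : SP, (∀ i, ‖(D ^ i) w‖ ≤ M i) → ‖w‖ ≤ δ → ‖(D ^ k) w‖ ≤ ε := by
  induction k generalizing ε with
  | zero => exact ⟨ε, hε, fun w _ h => h⟩
  | succ k ih =>
    -- Interpolation bounds `‖D^(k+1) w‖²` by `‖D^k w‖ ‖D^(k+2) w‖`, and the last factor is at most
    -- `|M (k + 2)| + 1`.
    obtain ⟨δ, hδ, h⟩ := ih (ε := ε ^ 2 / (|M (k + 2)| + 1)) (by positivity)
    refine ⟨δ, hδ, fun w hw hwδ => ?_⟩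
    have h1 := h w hw hwδ
    have h2 := norm_D_sq_le ((D ^ k) w)
    have h3 := hw (k + 2)
    rw [show k + 2 = k + 1 + 1 by ring, D_pow_succ', D_pow_succ'] at h3
    have h4 : ‖D (D ((D ^ k) w))‖ ≤ |M (k + 2)| + 1 := by linarith [le_abs_self (M (k + 2))]
    rw [D_pow_succ']
    refine le_of_sq_le_sq (h2.trans ?_) hε.le
    calc _ ≤ ε ^ 2 / (|M (k + 2)| + 1) * (|M (k + 2)| + 1) :=
          mul_le_mul h1 h4 (norm_nonneg _) (by positivity)
      _ = ε ^ 2 := div_mul_cancel₀ _ (by positivity)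

/-- Limits of approximate solutions are solutions. -/
theorem hasTD_of_tendsto {τ : ℝ} {f G : ℕ → ℝ → SP} {F Γ : ℝ → SP}
    (hf : ∀ n, ∀ t ∈ Icc 0 τ, HasTD (f n) (G n t) (Icc 0 τ) t)
    (hF : ∀ k : ℕ, ∀ t ∈ Icc 0 τ, Tendsto (fun n => (D ^ k) (f n t)) atTop (𝓝 ((D ^ k) (F t))))
    (hG : ∀ k : ℕ, ∀ ε > 0, ∃ n₀, ∀ n ≥ n₀, ∀ t ∈ Icc 0 τ, ‖(D ^ k) (G n t - Γ t)‖ ≤ ε)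
    (hΓ : ∀ k : ℕ, ContinuousOn (fun t => (D ^ k) (Γ t)) (Icc 0 τ)) {t : ℝ} (ht : t ∈ Icc 0 τ) :
    HasTD F (Γ t) (Icc 0 τ) t := by
  intro k
  rw [hasDerivWithinAt_iff_isLittleO, Asymptotics.isLittleO_iff]
  intro c hc
  obtain ⟨δ, hδ, hcont⟩ := Metric.continuousWithinAt_iff.1 (hΓ k t ht) (c / 2) (half_pos hc)
  filter_upwards [self_mem_nhdsWithin, inter_mem_nhdsWithin (Icc 0 τ) (Metric.ball_mem_nhds t hδ)]
    with s hs hsδ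
  have hsub : uIcc t s ⊆ Icc 0 τ := by
    rw [← segment_eq_uIcc]; exact (convex_Icc 0 τ).segment_subset ht hs
  obtain ⟨n₀, hn₀⟩ := hG k (c / 2) (half_pos hc)
  -- The mean value inequality is applied to the approximations, whose time derivatives are
  -- uniformly close to `Γ`; only the resulting bound passes to the limit.
  refine le_of_tendsto ((((hF k s hs).sub (hF k t ht)).sub_const _).norm) ?_
  filter_upwards [eventually_ge_atTop n₀] with n hn
  have hder : ∀ r ∈ uIcc t s, HasDerivWithinAt
      (fun r => (D ^ k) (f n r) - r • (D ^ k) (Γ t)) ((D ^ k) (G n r) - (1 : ℝ) • (D ^ k) (Γ t))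
      (uIcc t s) r := fun r hr =>
    ((hf n r (hsub hr) k).mono hsub).fun_sub ((hasDerivWithinAt_id r _).smul_const _)
  have hbd : ∀ r ∈ uIcc t s, ‖(D ^ k) (G n r) - (1 : ℝ) • (D ^ k) (Γ t)‖ ≤ c := by
    intro r hr
    have h1 := hn₀ n hn r (hsub hr)
    have h2 := (hcont (hsub hr) (lt_of_le_of_lt (by
      rw [Real.dist_eq, Real.dist_eq]; exact abs_sub_left_of_mem_uIcc hr) hsδ.2)).le
    rw [dist_eq_norm] at h2
    rw [map_sub] at h1
    have h3 := norm_add_le ((D ^ k) (G n r) - (D ^ k) (Γ r)) ((D ^ k) (Γ r) - (D ^ k) (Γ t))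
    rw [sub_add_sub_cancel] at h3
    rw [one_smul]
    linarith
  have := (convex_uIcc t s).norm_image_sub_le_of_norm_hasDerivWithin_le hder hbd
    left_mem_uIcc right_mem_uIcc
  refine le_trans (le_of_eq ?_) this
  congr 1
  rw [sub_smul]; abel

end SP

/-! ### Local existence -/

namespace SP

theorem tendsto_apply {ι : Type*} {l : Filter ι} {f : ι → SP} {F : SP}
    (h : ∀ k : ℕ, Tendsto (fun n => (D ^ k) (f n)) l (𝓝 ((D ^ k) F))) (x : ℝ) :
    Tendsto (fun n => f n x) l (𝓝 (F x)) := by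
  have h0 := tendsto_iff_norm_sub_tendsto_zero.1 (h 0)
  have h1 := tendsto_iff_norm_sub_tendsto_zero.1 (h 1)
  rw [tendsto_iff_norm_sub_tendsto_zero]
  refine squeeze_zero (fun _ => norm_nonneg _) (fun n => ?_) (by simpa using h0.add (h1.const_mul 3))
  have := ((f n - F).abs_le_supNorm x).trans (supNorm_le_norm_add _)
  rw [map_sub] at this
  exact this

theorem tSmooth_zero_of_hasTD {I : Set ℝ} {F G : ℝ → SP} (h : ∀ t ∈ I, HasTD F (G t) I t) :
    TSmooth I 0 F := fun k t ht => (h t ht k).continuousWithinAt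

theorem TSmooth.nonlin {I : Set ℝ} {n : ℕ} {F : ℝ → SP} (h : TSmooth I n F) (g a : ℝ) :
    TSmooth I n fun t => nonlin g a (F t) :=
  ((h.map_clm (Hc a) fun f => (D_H a f).symm).mul h.map_D).const_smul (-g)

/-- Orders up to `2` come from the energy. Higher orders follow by strong induction, since the rate
at order `k` is linear with coefficients from lower orders, so Grönwall applies on the whole
interval. -/
theorem exists_uniform_bounds {g a R : ℝ} (hR : 0 < R) {ρ₀ : SP} {f : ℕ → ℝ → SP}
    (hmem : ∀ N t, f N t ∈ cosSpan N) (hinit : ∀ N, f N 0 = proj N ρ₀)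
    (hf : ∀ N, ∀ t ∈ Icc 0 (lifespan g R), energy (f N t) ≤ 2 * R ∧
        HasTD (f N) (proj N (nonlin g a (f N t))) (Icc 0 (lifespan g R)) t) (k : ℕ) :
    ∃ C, ∀ N, ∀ t ∈ Icc 0 (lifespan g R), ‖(D ^ k) (f N t)‖ ≤ C := by
  set τ := lifespan g R with hτ
  have hτ0 : 0 < τ := lifespan_pos g hR
  have h2 : ∀ N, ∀ t ∈ Icc 0 τ, ‖D (D (f N t))‖ ≤ √(2 * R) := fun N t ht =>
    (norm_D_D_le_sqrt_energy _).trans (Real.sqrt_le_sqrt (hf N t ht).1)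
  induction k using Nat.strong_induction_on with
  | _ k ih =>
  match k, ih with
  | 0, _ => exact ⟨√(2 * R), fun N t ht =>
      (norm_le_sqrt_energy _).trans (Real.sqrt_le_sqrt (hf N t ht).1)⟩
  | 1, _ => exact ⟨9 * √(2 * R), fun N t ht => (norm_D_le _).trans
      (mul_le_mul_of_nonneg_left (h2 N t ht) (by norm_num))⟩
  | 2, _ => exact ⟨√(2 * R), h2⟩
  | j + 3, ih =>
    set k := j + 3 with hk
    choose! C hC using ih
    set M := ∑ i ∈ Finset.range k, |C i| with hM
    have hMi : ∀ i < k, ∀ N, ∀ t ∈ Icc 0 τ, ‖(D ^ i) (f N t)‖ ≤ M := fun i hi N t ht =>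
      (hC i hi N t ht).trans ((le_abs_self _).trans
        (Finset.single_le_sum (f := fun i => |C i|) (fun i _ => abs_nonneg _)
          (Finset.mem_range.2 hi)))
    have hM0 : 0 ≤ M := Finset.sum_nonneg fun i _ => abs_nonneg _
    set A := 2 * (|g| * ((3 + 2 ^ k * (6 * 9 ^ k)) * M)) with hA
    have hA0 : 0 ≤ A := by positivity
    -- The projected initial value is bounded uniformly in `N` at the even order `2k`, where the
    -- projection commutes with differentiation.
    refine ⟨√((9 ^ k * ‖(D ^ (2 * k)) ρ₀‖) ^ 2 * Real.exp (A * τ)), fun N t ht => ?_⟩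
    refine Real.le_sqrt_of_sq_le ?_
    have hE : ∀ t ∈ Icc 0 τ, HasDerivWithinAt (fun t => ‖(D ^ k) (f N t)‖ ^ 2)
        (2 * inner ℝ ((D ^ k) (f N t)) ((D ^ k) (nonlin g a (f N t)))) (Icc 0 τ) t := fun t ht => by
      rw [← inner_D_pow_proj (hmem N t)]
      exact ((hf N t ht).2 k).norm_sq
    have hgr := le_exp_of_deriv_le (A := A) (δ := 0) hE le_rfl (fun t ht => by
      have := abs_inner_D_pow_nonlin_le g a (k := k) (by omega) (f := f N t) (M := M)
        fun i _ hi => hMi i hi N t ht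
      have h3 := le_abs_self (inner ℝ ((D ^ k) (f N t)) ((D ^ k) (nonlin g a (f N t))))
      rw [hA]
      linarith) ht
    refine hgr.trans ?_
    rw [add_zero]
    refine mul_le_mul ?_ (Real.exp_le_exp.2 (mul_le_mul_of_nonneg_left ht.2 hA0))
      (Real.exp_pos _).le (by positivity)
    rw [hinit]
    refine pow_le_pow_left₀ (norm_nonneg _) ((norm_D_pow_le_two_mul k _).trans ?_) 2
    rw [← proj_D_pow]
    exact mul_le_mul_of_nonneg_left (norm_proj_le _ _) (by positivity)

theorem le_div_of_sq_mul_le {n : ℕ} {x C : ℝ} (hx : 0 ≤ x)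
    (h : ((n + 1 : ℕ) : ℝ) ^ 2 * x ≤ C) : x ≤ C * (1 / ((n : ℝ) + 1)) := by
  have h1 : (1 : ℝ) ≤ (n : ℝ) + 1 := by linarith [n.cast_nonneg (α := ℝ)]
  rw [mul_one_div, le_div_iff₀ (by linarith)]
  push_cast at h
  nlinarith [mul_le_mul_of_nonneg_right h1 (mul_nonneg hx (by linarith : (0 : ℝ) ≤ (n : ℝ) + 1))]

/-- Galerkin solutions are Cauchy in `L²` by Grönwall, since projection errors decay in `N`.
Interpolation with the uniform bounds upgrades this to every derivative. -/
theorem exists_local_solution (g a : ℝ) {R : ℝ} (hR : 0 < R) {ρ₀ : SP} (heven : IsEven ρ₀)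
    (hρ₀ : energy ρ₀ ≤ R) :
    ∃ ρ : ℝ → SP, ρ 0 = ρ₀ ∧ ∀ t ∈ Icc 0 (lifespan g R), IsEven (ρ t) ∧
      HasTD ρ (nonlin g a (ρ t)) (Icc 0 (lifespan g R)) t := by
  choose f hmem hinit hf using fun N => exists_galerkin g a N hR hρ₀
  set τ := lifespan g R with hτ
  have hτ0 : 0 < τ := lifespan_pos g hR
  choose C hC using exists_uniform_bounds hR hmem hinit hf
  set M : ℕ → ℝ := fun k => ∑ i ∈ Finset.range (k + 1), |C i| with hM
  have hM0 : ∀ k, 0 ≤ M k := fun k => Finset.sum_nonneg fun i _ => abs_nonneg _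
  have hfM : ∀ k, ∀ i ≤ k, ∀ N, ∀ t ∈ Icc 0 τ, ‖(D ^ i) (f N t)‖ ≤ M k := fun k i hi N t ht =>
    (hC i N t ht).trans ((le_abs_self _).trans
      (Finset.single_le_sum (f := fun i => |C i|) (fun i _ => abs_nonneg _)
        (Finset.mem_range.2 (by omega))))
  have hproj : ∀ k, ∃ K, 0 ≤ K ∧ ∀ N, ∀ t ∈ Icc 0 τ, ‖(D ^ k) (nonlin g a (f N t) -
      proj N (nonlin g a (f N t)))‖ ≤ K * (1 / ((N : ℝ) + 1)) := fun k => by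
    set K := 9 ^ k * (2 * (|g| * (2 ^ (2 * k + 2) * (16 * M (2 * k + 2 + 1))) * M (2 * k + 2 + 1)))
      with hK
    have := hM0 (2 * k + 2 + 1)
    refine ⟨K, by positivity, fun N t ht => le_div_of_sq_mul_le (norm_nonneg _) ?_⟩
    refine (norm_D_pow_sub_proj_le (isEven_nonlin g a (isEven_of_mem (hmem N t))) N k).trans ?_
    refine mul_le_mul_of_nonneg_left (mul_le_mul_of_nonneg_left ?_ (by norm_num)) (by positivity)
    exact norm_D_pow_nonlin_le g a this fun i hi => hfM _ i hi N t ht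
  have hproj₀ : ∀ N, ‖ρ₀ - proj N ρ₀‖ ≤ 2 * ‖D (D ρ₀)‖ * (1 / ((N : ℝ) + 1)) := fun N =>
    le_div_of_sq_mul_le (norm_nonneg _) (norm_sub_proj_le heven N)
  obtain ⟨B, hB, hcau⟩ : ∃ B, 0 ≤ B ∧ ∀ q N m : ℕ, q ≤ N → q ≤ m → ∀ t ∈ Icc 0 τ,
      ‖f N t - f m t‖ ^ 2 ≤ B * (1 / ((q : ℝ) + 1)) ^ 2 := by
    obtain ⟨K, hK0, hK⟩ := hproj 0
    have hm2 := hM0 2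
    -- The extra `1` absorbs `‖w‖²` in `4 ‖w‖ K η ≤ ‖w‖² + 4 K² η²`. It also gives `A ≥ 1`, which
    -- lets the error `4 K² η²` take the form `A δ` that Grönwall expects.
    set A := 2 * (|g| * (12 * M 2)) + 1 with hA
    have hA1 : 1 ≤ A := by
      have : 0 ≤ 2 * (|g| * (12 * M 2)) := by positivity
      linarith
    set K₀ := 2 * ‖D (D ρ₀)‖ with hK₀
    refine ⟨(4 * K₀ ^ 2 + 4 * K ^ 2) * Real.exp (A * τ), by positivity,
      fun q N m hqN hqm t ht => ?_⟩
    set η := 1 / ((q : ℝ) + 1) with hη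
    have hη0 : 0 ≤ η := by positivity
    have hle : ∀ n : ℕ, q ≤ n → 1 / ((n : ℝ) + 1) ≤ η := fun n hn =>
      one_div_le_one_div_of_le (by positivity) (by gcongr)
    have hE : ∀ t ∈ Icc 0 τ, HasDerivWithinAt (fun t => ‖f N t - f m t‖ ^ 2)
        (2 * inner ℝ (f N t - f m t) (proj N (nonlin g a (f N t)) - proj m (nonlin g a (f m t))))
        (Icc 0 τ) t := fun t ht => (((hf N t ht).2.sub (hf m t ht).2) 0).norm_sq
    have hgr := le_exp_of_deriv_le (A := A) (δ := 4 * K ^ 2 * η ^ 2) hE (by positivity)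
      (fun t ht => by
        set w := f N t - f m t with hw
        set p := nonlin g a (f N t) - nonlin g a (f m t) with hp
        set u := nonlin g a (f N t) - proj N (nonlin g a (f N t)) with hu
        set v := nonlin g a (f m t) - proj m (nonlin g a (f m t)) with hv
        have e : proj N (nonlin g a (f N t)) - proj m (nonlin g a (f m t)) = p - u + v := by
          rw [hp, hu, hv]; abel
        have hu' : ‖u‖ ≤ K * η := (hK N t ht).trans (mul_le_mul_of_nonneg_left (hle N hqN) hK0)
        have hv' : ‖v‖ ≤ K * η := (hK m t ht).trans (mul_le_mul_of_nonneg_left (hle m hqm) hK0)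
        have h1 : |inner ℝ w p| ≤ |g| * (12 * M 2) * ‖w‖ ^ 2 := by
          refine (abs_inner_nonlin_sub_le g a (f N t) (f m t)).trans ?_
          have e1 := supNorm_H_D_le a (f m t)
          have e2 := supNorm_D_le (f N t)
          have e3 : ‖D (D (f m t))‖ ≤ M 2 := hfM 2 2 le_rfl m t ht
          have e4 : ‖D (D (f N t))‖ ≤ M 2 := hfM 2 2 le_rfl N t ht
          exact mul_le_mul_of_nonneg_right
            (mul_le_mul_of_nonneg_left (by linarith) (abs_nonneg _)) (sq_nonneg _)
        have h2 : |inner ℝ w u| ≤ ‖w‖ * (K * η) := (abs_real_inner_le_norm _ _).trans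
          (mul_le_mul_of_nonneg_left hu' (norm_nonneg _))
        have h3 : |inner ℝ w v| ≤ ‖w‖ * (K * η) := (abs_real_inner_le_norm _ _).trans
          (mul_le_mul_of_nonneg_left hv' (norm_nonneg _))
        rw [e, inner_add_right, inner_sub_right]
        have h4 := (abs_le.1 h1).2
        have h5 := (abs_le.1 h2).1
        have h6 := (abs_le.1 h3).2
        have h7 : 0 ≤ (‖w‖ - 2 * (K * η)) ^ 2 := sq_nonneg _
        have h8 : 4 * K ^ 2 * η ^ 2 ≤ A * (4 * K ^ 2 * η ^ 2) :=
          le_mul_of_one_le_left (by positivity) hA1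
        rw [hA] at h8 ⊢
        nlinarith) ht
    refine hgr.trans ?_
    have h0 : ‖f N 0 - f m 0‖ ≤ 2 * (K₀ * η) := by
      rw [hinit, hinit, show proj N ρ₀ - proj m ρ₀ = (ρ₀ - proj m ρ₀) - (ρ₀ - proj N ρ₀) by abel]
      refine (norm_sub_le _ _).trans ?_
      have h1 := (hproj₀ N).trans (mul_le_mul_of_nonneg_left (hle N hqN) (by positivity))
      have h2 := (hproj₀ m).trans (mul_le_mul_of_nonneg_left (hle m hqm) (by positivity))
      linarith
    have h1 := pow_le_pow_left₀ (norm_nonneg _) h0 2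
    have h2 : Real.exp (A * t) ≤ Real.exp (A * τ) :=
      Real.exp_le_exp.2 (mul_le_mul_of_nonneg_left ht.2 (by linarith))
    calc _ ≤ ((2 * (K₀ * η)) ^ 2 + 4 * K ^ 2 * η ^ 2) * Real.exp (A * τ) := by gcongr
      _ = _ := by ring
  have hcauk : ∀ k : ℕ, ∀ ε > 0, ∃ n₀, ∀ n ≥ n₀, ∀ m ≥ n₀, ∀ t ∈ Icc 0 τ,
      ‖(D ^ k) (f n t - f m t)‖ ≤ ε := by
    intro k ε hε
    obtain ⟨δ, hδ, hsmall⟩ := exists_small_of_bounds (M := fun i => 2 * C i) k hε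
    obtain ⟨q, hq⟩ := exists_nat_one_div_lt (show 0 < δ / (√B + 1) by positivity)
    refine ⟨q, fun n hn m hm t ht => hsmall _ (fun i => ?_) ?_⟩
    · rw [map_sub]
      refine (norm_sub_le _ _).trans ?_
      linarith [hC i n t ht, hC i m t ht]
    · have h1 := hcau q n m hn hm t ht
      rw [lt_div_iff₀ (by positivity)] at hq
      refine le_of_sq_le_sq (h1.trans ?_) hδ.le
      have h2 : √B * (1 / ((q : ℝ) + 1)) ≤ δ := by
        have : 0 ≤ 1 / ((q : ℝ) + 1) := by positivity
        linarith
      have h3 := pow_le_pow_left₀ (by positivity) h2 2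
      rwa [mul_pow, Real.sq_sqrt hB] at h3
  have hlim : ∀ t ∈ Icc 0 τ, ∃ F : SP, ∀ k : ℕ,
      Tendsto (fun n => (D ^ k) (f n t)) atTop (𝓝 ((D ^ k) F)) := fun t ht =>
    exists_tendsto fun k ε hε => by
      obtain ⟨n₀, h⟩ := hcauk k ε hε
      exact ⟨n₀, fun n hn m hm => h n hn m hm t ht⟩
  choose! F hF using hlim
  have hunif : ∀ k : ℕ, ∀ ε > 0, ∀ᶠ n in atTop, ∀ t ∈ Icc 0 τ, ‖(D ^ k) (f n t - F t)‖ ≤ ε := by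
    intro k ε hε
    obtain ⟨n₀, h⟩ := hcauk k ε hε
    filter_upwards [eventually_ge_atTop n₀] with n hn t ht
    rw [map_sub]
    refine le_of_tendsto ((tendsto_const_nhds.sub (hF t ht k)).norm) ?_
    filter_upwards [eventually_ge_atTop n₀] with m hm
    have := h n hn m hm t ht
    rwa [map_sub] at this
  have hFM : ∀ k, ∀ i ≤ k, ∀ t ∈ Icc 0 τ, ‖(D ^ i) (F t)‖ ≤ M k := fun k i hi t ht =>
    le_of_tendsto (hF t ht i).norm (.of_forall fun n => hfM k i hi n t ht)
  have hFs : TSmooth (Icc 0 τ) 0 F := fun k => by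
    refine continuousOn_of_uniform_approx_of_continuousOn fun u hu => ?_
    obtain ⟨ε, hε, hεu⟩ := Metric.mem_uniformity_dist.1 hu
    obtain ⟨n, hn⟩ := (hunif k (ε / 2) (half_pos hε)).exists
    refine ⟨fun t => (D ^ k) (f n t), tSmooth_zero_of_hasTD (fun t ht => (hf n t ht).2) k,
      fun t ht => hεu ?_⟩
    have := hn t ht
    rw [map_sub] at this
    rw [dist_comm, dist_eq_norm]
    linarith
  have h0mem : (0 : ℝ) ∈ Icc 0 τ := left_mem_Icc.2 hτ0.le
  refine ⟨F, ?_, fun t ht => ⟨fun x => ?_, ?_⟩⟩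
  · have h1 : Tendsto (fun n => f n 0) atTop (𝓝 (F 0)) := hF 0 h0mem 0
    refine tendsto_nhds_unique h1 ?_
    rw [tendsto_iff_norm_sub_tendsto_zero]
    refine squeeze_zero (fun _ => norm_nonneg _) (fun n => ?_)
      (by simpa using tendsto_one_div_add_atTop_nhds_zero_nat.const_mul (2 * ‖D (D ρ₀)‖))
    rw [hinit, norm_sub_rev]
    exact (hproj₀ n).trans (by simp)
  · refine tendsto_nhds_unique (tendsto_apply (hF t ht) (-x)) ?_
    have : ∀ n, f n t (-x) = f n t x := fun n => isEven_of_mem (hmem n t) x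
    simpa only [this] using tendsto_apply (hF t ht) x
  · refine hasTD_of_tendsto (Γ := fun t => nonlin g a (F t)) (fun n t ht => (hf n t ht).2)
      (fun k t ht => hF t ht k) (fun k ε hε => ?_) (fun k => hFs.nonlin g a k) ht
    obtain ⟨K, hK0, hK⟩ := hproj k
    set K₂ := |g| * (2 ^ k * (16 * M (k + 1))) with hK₂
    have hK₂0 : 0 ≤ K₂ := by have := hM0 (k + 1); positivity
    have e1 : ∀ᶠ n : ℕ in atTop, K * (1 / ((n : ℝ) + 1)) ≤ ε / 2 := by
      have : Tendsto (fun n : ℕ => K * (1 / ((n : ℝ) + 1))) atTop (𝓝 0) := by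
        simpa using tendsto_one_div_add_atTop_nhds_zero_nat.const_mul K
      exact this.eventually (eventually_le_nhds (half_pos hε))
    have e2 : ∀ᶠ n in atTop, ∀ i ∈ Finset.range (k + 2), ∀ t ∈ Icc 0 τ,
        ‖(D ^ i) (f n t - F t)‖ ≤ ε / (2 * (K₂ + 1)) :=
      (Finset.eventually_all _).2 fun i _ => hunif i _ (by positivity)
    obtain ⟨n₀, hn₀⟩ := eventually_atTop.1 (e1.and e2)
    refine ⟨n₀, fun n hn t ht => ?_⟩
    obtain ⟨h1, h2⟩ := hn₀ n hn
    have h3 := norm_D_pow_nonlin_sub_le g a (k := k) (r := f n t) (f := F t) (hM0 (k + 1))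
      (ε := ε / (2 * (K₂ + 1))) (by positivity) (fun i hi => hfM _ i hi n t ht)
      (fun i hi => hFM _ i hi t ht) (fun i hi => h2 i (Finset.mem_range.2 (by omega)) t ht)
    have h4 := (hK n t ht).trans h1
    have h5 : K₂ * (ε / (2 * (K₂ + 1))) ≤ ε / 2 := by
      rw [mul_div_assoc', div_le_div_iff₀ (by positivity) (by norm_num)]
      nlinarith
    have e : proj n (nonlin g a (f n t)) - nonlin g a (F t) =
        (nonlin g a (f n t) - nonlin g a (F t)) -
          (nonlin g a (f n t) - proj n (nonlin g a (f n t))) := by abel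
    rw [e, map_sub]
    refine (norm_sub_le _ _).trans ?_
    linarith

end SP

/-! ### Solution curves and their joint smoothness -/

namespace SP

/-- An even solution of the equation on `[0, T)`, as a curve of smooth periodic functions. -/
structure IsSol (g a T : ℝ) (ρ : ℝ → SP) : Prop where
  pos : 0 < T
  even : ∀ t ∈ Ico 0 T, IsEven (ρ t)
  hasTD : ∀ t ∈ Ico 0 T, HasTD ρ (nonlin g a (ρ t)) (Ico 0 T) t

namespace IsSol
variable {g a T : ℝ} {ρ : ℝ → SP}

/-- Bootstrap: the equation expresses the time derivative by an operation that preserves `TSmooth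
n`, so each order yields the next. -/
theorem tSmooth (h : IsSol g a T ρ) (n : ℕ) : TSmooth (Ico 0 T) n ρ := by
  induction n with
  | zero => exact tSmooth_zero_of_hasTD h.hasTD
  | succ n ih => exact ⟨_, h.hasTD, ih.nonlin g a⟩

theorem isSmoothSolution (h : IsSol g a T ρ) : IsSmoothSolution a g (ρ 0) T fun t => ρ t where
  pos := h.pos
  smooth := contDiffOn_infty.2 fun n => (h.tSmooth n).contDiffOn (uniqueDiffOn_Ico 0 T)
  periodic t _ := (ρ t).periodic
  initial _ := rfl
  equation t ht x := ⟨H a (ρ t) x, isHa_H a (ρ t) x, by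
    simpa only [nonlin_apply, D_apply] using (h.hasTD t ht).apply x⟩

end IsSol

/-! ### Uniqueness of smooth solutions -/

open Classical in
/-- A smooth solution as a curve of smooth periodic functions. -/
noncomputable def toCurve (ρ : ℝ → ℝ → ℝ) (t : ℝ) : SP :=
  if h : IsSmoothPeriodic (ρ t) then mk (ρ t) h else 0

theorem toCurve_apply {ρ : ℝ → ℝ → ℝ} {t : ℝ} (h : IsSmoothPeriodic (ρ t)) (x : ℝ) :
    toCurve ρ t x = ρ t x := by
  rw [toCurve, dif_pos h]; rfl

theorem coe_toCurve {ρ : ℝ → ℝ → ℝ} {t : ℝ} (h : IsSmoothPeriodic (ρ t)) :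
    ⇑(toCurve ρ t) = ρ t := funext (toCurve_apply h)

/-- A curve with a jointly continuous pointwise time derivative is differentiable in `L²`. -/
theorem hasDerivWithinAt_of_pointwise {r N : ℝ → SP} {τ : ℝ}
    (hr : ∀ t ∈ Icc 0 τ, ∀ x, HasDerivWithinAt (fun s => r s x) (N t x) (Icc 0 τ) t)
    (hN : ContinuousOn (fun p : ℝ × ℝ => N p.1 p.2) (Icc 0 τ ×ˢ univ)) {t : ℝ}
    (ht : t ∈ Icc 0 τ) : HasDerivWithinAt r (N t) (Icc 0 τ) t := by
  rw [hasDerivWithinAt_iff_isLittleO, Asymptotics.isLittleO_iff]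
  intro c hc
  have hK : IsCompact (Icc 0 τ ×ˢ Icc (-Real.pi) Real.pi) := isCompact_Icc.prod isCompact_Icc
  have hu := hK.uniformContinuousOn_of_continuous
    (hN.mono (prod_mono_right (subset_univ _)))
  obtain ⟨δ, hδ, hu⟩ := Metric.uniformContinuousOn_iff.1 hu (c / 3) (by positivity)
  have hclose : ∀ s ∈ Icc 0 τ, |s - t| < δ → ∀ x, |N s x - N t x| ≤ c / 3 := fun s hs hst x => by
    obtain ⟨y, hy, hxy⟩ := (N s - N t).exists_mem_Icc x
    have h1 : dist (s, y) (t, y) < δ := by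
      rw [Prod.dist_eq, dist_self, max_eq_left dist_nonneg]; exact hst
    have h2 := hu (s, y) ⟨hs, hy⟩ (t, y) ⟨ht, hy⟩ h1
    rw [← sub_apply, hxy]
    exact h2.le
  have hball : Metric.ball t δ ∈ 𝓝[Icc 0 τ] t := mem_nhdsWithin_of_mem_nhds (Metric.ball_mem_nhds t hδ)
  filter_upwards [hball, self_mem_nhdsWithin] with s hsb hs
  have hpt : ∀ x, |(r s - r t - (s - t) • N t) x| ≤ c / 3 * |s - t| := fun x => by
    have hconv : Convex ℝ (Icc 0 τ ∩ Metric.ball t δ) := (convex_Icc 0 τ).inter (convex_ball t δ)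
    have := hconv.norm_image_sub_le_of_norm_hasDerivWithin_le (C := c / 3)
      (f := fun σ => r σ x - σ * N t x) (f' := fun σ => N σ x - 1 * N t x) (x := t) (y := s)
      (fun σ hσ => ((hr σ hσ.1 x).mono inter_subset_left).fun_sub
        ((hasDerivWithinAt_id σ _).mul_const _))
      (fun σ hσ => by rw [one_mul]; exact hclose σ hσ.1 hσ.2 x)
      ⟨ht, Metric.mem_ball_self hδ⟩ ⟨hs, hsb⟩
    simp only [Real.norm_eq_abs] at this
    simp only [sub_apply, smul_apply]
    refine le_of_eq_of_le ?_ this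
    congr 1; ring
  refine (norm_le_supNorm _).trans ?_
  calc _ ≤ c / 3 * |s - t| * 3 := mul_le_mul (supNorm_le hpt) norm_one_le (norm_nonneg _)
        (by positivity)
    _ = _ := by rw [Real.norm_eq_abs]; ring

end SP

namespace IsSmoothSolution
open SP
variable {a g T : ℝ} {ρ₀ : ℝ → ℝ} {ρ : ℝ → ℝ → ℝ}

theorem isSmoothPeriodic (h : IsSmoothSolution a g ρ₀ T ρ) {t : ℝ} (ht : t ∈ Ico 0 T) :
    IsSmoothPeriodic (ρ t) where
  smooth := by
    rw [← contDiffOn_univ]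
    exact h.smooth.comp (f := fun x : ℝ => (t, x)) (contDiff_prodMk_right t).contDiffOn
      fun x _ => ⟨ht, mem_univ _⟩
  periodic := h.periodic t ht

theorem differentiableWithinAt (h : IsSmoothSolution a g ρ₀ T ρ) {t : ℝ} (ht : t ∈ Ico 0 T) (x : ℝ) :
    HasFDerivWithinAt (fun p : ℝ × ℝ => ρ p.1 p.2)
      (fderivWithin ℝ (fun p : ℝ × ℝ => ρ p.1 p.2) (Ico 0 T ×ˢ univ) (t, x)) (Ico 0 T ×ˢ univ) (t, x) :=
  (h.smooth.differentiableOn (by simp) (t, x) ⟨ht, mem_univ _⟩).hasFDerivWithinAt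

theorem continuousOn_fderivWithin (h : IsSmoothSolution a g ρ₀ T ρ) (v : ℝ × ℝ) :
    ContinuousOn (fun p : ℝ × ℝ => fderivWithin ℝ (fun p : ℝ × ℝ => ρ p.1 p.2) (Ico 0 T ×ˢ univ) p v)
      (Ico 0 T ×ˢ univ) :=
  (h.smooth.continuousOn_fderivWithin ((uniqueDiffOn_Ico 0 T).prod uniqueDiffOn_univ)
    (by simp)).clm_apply continuousOn_const

theorem fderivWithin_snd (h : IsSmoothSolution a g ρ₀ T ρ) {t : ℝ} (ht : t ∈ Ico 0 T) (x : ℝ) :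
    fderivWithin ℝ (fun p : ℝ × ℝ => ρ p.1 p.2) (Ico 0 T ×ˢ univ) (t, x) (0, 1) =
      D (toCurve ρ t) x := by
  have h1 : HasDerivWithinAt (fun y : ℝ => (t, y)) ((0 : ℝ), (1 : ℝ)) univ x :=
    ((hasDerivAt_const x t).prodMk (hasDerivAt_id x)).hasDerivWithinAt
  have h2 := (h.differentiableWithinAt ht x).comp_hasDerivWithinAt x h1
    fun y _ => (⟨ht, mem_univ _⟩ : (t, y) ∈ Ico 0 T ×ˢ univ)
  rw [hasDerivWithinAt_univ] at h2
  rw [D_apply, coe_toCurve (h.isSmoothPeriodic ht)]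
  exact h2.deriv.symm

theorem hasDerivWithinAt_apply (h : IsSmoothSolution a g ρ₀ T ρ) {t : ℝ} (ht : t ∈ Ico 0 T) (x : ℝ) :
    HasDerivWithinAt (fun s => ρ s x) (nonlin g a (toCurve ρ t) x) (Ico 0 T) t := by
  obtain ⟨v, hv, hd⟩ := h.equation t ht x
  rw [← coe_toCurve (h.isSmoothPeriodic ht)] at hv hd
  rw [nonlin_apply, ← eq_H_of_isHa hv, D_apply]
  exact hd

theorem fderivWithin_fst (h : IsSmoothSolution a g ρ₀ T ρ) {t : ℝ} (ht : t ∈ Ico 0 T) (x : ℝ) :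
    fderivWithin ℝ (fun p : ℝ × ℝ => ρ p.1 p.2) (Ico 0 T ×ˢ univ) (t, x) (1, 0) =
      nonlin g a (toCurve ρ t) x := by
  have h1 : HasDerivWithinAt (fun s : ℝ => (s, x)) ((1 : ℝ), (0 : ℝ)) (Ico 0 T) t :=
    ((hasDerivAt_id t).prodMk (hasDerivAt_const t x)).hasDerivWithinAt
  have h2 := (h.differentiableWithinAt ht x).comp_hasDerivWithinAt t h1
    fun s hs => (⟨hs, mem_univ _⟩ : (s, x) ∈ Ico 0 T ×ˢ univ)
  exact (uniqueDiffOn_Ico 0 T t ht).eq_deriv _ h2 (h.hasDerivWithinAt_apply ht x)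

theorem exists_supNorm_le (h : IsSmoothSolution a g ρ₀ T ρ) {τ : ℝ} (hτ : τ < T) :
    ∃ M, ∀ t ∈ Icc 0 τ, supNorm (D (toCurve ρ t)) ≤ M := by
  have hK : IsCompact (Icc 0 τ ×ˢ Icc (-Real.pi) Real.pi) := isCompact_Icc.prod isCompact_Icc
  obtain ⟨M, hM⟩ := hK.exists_bound_of_continuousOn ((h.continuousOn_fderivWithin (0, 1)).mono
    (prod_mono (fun t ht => ⟨ht.1, ht.2.trans_lt hτ⟩) (subset_univ _)))
  refine ⟨M, fun t ht => supNorm_le fun x => ?_⟩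
  obtain ⟨y, hy, hxy⟩ := (D (toCurve ρ t)).exists_mem_Icc x
  have := hM (t, y) ⟨ht, hy⟩
  rw [h.fderivWithin_snd ⟨ht.1, ht.2.trans_lt hτ⟩, ← hxy] at this
  exact this

theorem hasDerivWithinAt_toCurve (h : IsSmoothSolution a g ρ₀ T ρ) {τ : ℝ} (hτ : τ < T) {t : ℝ}
    (ht : t ∈ Icc 0 τ) :
    HasDerivWithinAt (toCurve ρ) (nonlin g a (toCurve ρ t)) (Icc 0 τ) t := by
  have hsub : Icc 0 τ ⊆ Ico 0 T := fun t ht => ⟨ht.1, ht.2.trans_lt hτ⟩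
  refine hasDerivWithinAt_of_pointwise (N := fun t => nonlin g a (toCurve ρ t)) (fun t ht x => ?_)
    ?_ ht
  · exact ((h.hasDerivWithinAt_apply (hsub ht) x).mono hsub).congr
      (fun s hs => toCurve_apply (h.isSmoothPeriodic (hsub hs)) x)
      (toCurve_apply (h.isSmoothPeriodic (hsub ht)) x)
  · refine ((h.continuousOn_fderivWithin (1, 0)).mono (prod_mono_left hsub)).congr ?_
    rintro ⟨t, x⟩ ⟨ht, -⟩
    exact (h.fderivWithin_fst (hsub ht) x).symm

/-- A smooth solution agrees with a solution curve with the same initial value. -/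
theorem eq_of_isSol {T' : ℝ} {r : ℝ → SP} (h : IsSmoothSolution a g ρ₀ T ρ) (hr : IsSol g a T' r)
    (h0 : ⇑(r 0) = ρ₀) {t : ℝ} (ht : t ∈ Ico 0 T) (ht' : t < T') : ρ t = r t := by
  set q := toCurve ρ with hq
  have hsub : Icc 0 t ⊆ Ico 0 T' := fun s hs => ⟨hs.1, hs.2.trans_lt ht'⟩
  obtain ⟨M, hM⟩ := h.exists_supNorm_le ht.2
  obtain ⟨M', hM'⟩ := isCompact_Icc.exists_bound_of_continuousOn
    ((hr.tSmooth 0 2).mono hsub)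
  have hM'' : ∀ s ∈ Icc 0 t, supNorm (H a (D (r s))) ≤ 6 * M' := fun s hs =>
    (supNorm_H_D_le a (r s)).trans (mul_le_mul_of_nonneg_left (hM' s hs) (by norm_num))
  have hE : ∀ s ∈ Icc 0 t, HasDerivWithinAt (fun s => ‖q s - r s‖ ^ 2)
      (2 * inner ℝ (q s - r s) (nonlin g a (q s) - nonlin g a (r s))) (Icc 0 t) s := fun s hs =>
    ((h.hasDerivWithinAt_toCurve ht.2 hs).fun_sub
      ((hr.hasTD s (hsub hs)).mono hsub).hasDerivWithinAt).norm_sq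
  -- With `δ = 0` and equal initial values Grönwall forces the difference to vanish. Evenness of the
  -- arbitrary solution is not needed.
  have hgr := le_exp_of_deriv_le (A := 2 * (|g| * (6 * M' + 2 * M))) (δ := 0) hE le_rfl
    (fun s hs => by
      have h1 := (le_abs_self _).trans (abs_inner_nonlin_sub_le g a (q s) (r s))
      have h2 : |g| * (supNorm (H a (D (r s))) + 2 * supNorm (D (q s))) * ‖q s - r s‖ ^ 2 ≤
          |g| * (6 * M' + 2 * M) * ‖q s - r s‖ ^ 2 := by
        have := hM s hs
        have := hM'' s hs
        gcongr
      linarith) (right_mem_Icc.2 ht.1)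
  have hq0 : q 0 = r 0 := by
    refine DFunLike.coe_injective ?_
    rw [hq, coe_toCurve (h.isSmoothPeriodic ⟨le_rfl, h.pos⟩), h0]
    exact funext h.initial
  rw [hq0] at hgr
  have h3 : ‖q t - r t‖ = 0 := by
    have : ‖q t - r t‖ ^ 2 ≤ 0 := by simpa using hgr
    exact pow_eq_zero_iff (two_ne_zero) |>.1 (le_antisymm this (sq_nonneg _))
  rw [← coe_toCurve (h.isSmoothPeriodic ht), ← hq, sub_eq_zero.1 (norm_eq_zero.1 h3)]

end IsSmoothSolution

/-! ### Symmetry, monotonicity and pointwise bounds -/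

namespace SP

namespace IsEven
variable {f : SP}

theorem pi_add (hf : IsEven f) (y : ℝ) : f (Real.pi + y) = f (Real.pi - y) := by
  rw [← hf, ← f.periodic (-(Real.pi + y))]; congr 1; ring

theorem H_zero (hf : IsEven f) (a : ℝ) : H a f 0 = 0 := by
  rw [H_apply]; simp [hf _]

theorem H_pi (hf : IsEven f) (a : ℝ) : H a f Real.pi = 0 := by
  rw [H_apply]; simp [hf.pi_add]

theorem D_neg (hf : IsEven f) (x : ℝ) : D f (-x) = -D f x := by
  have h1 : HasDerivAt (fun y => f (-y)) (-D f (-x)) x := by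
    simpa using! (f.hasDerivAt (-x)).comp x (hasDerivAt_neg x)
  rw [funext hf] at h1
  linarith [h1.unique (f.hasDerivAt x)]

theorem D_zero (hf : IsEven f) : D f 0 = 0 := by
  have := hf.D_neg 0
  rw [neg_zero] at this; linarith

theorem D_pi (hf : IsEven f) : D f Real.pi = 0 := by
  have h1 := hf.D_neg Real.pi
  have h2 := (D f).periodic (-Real.pi)
  rw [show -Real.pi + 2 * Real.pi = Real.pi by ring] at h2
  linarith

theorem exists_mem_Icc (hf : IsEven f) (x : ℝ) : ∃ y ∈ Icc 0 Real.pi, f x = f y := by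
  obtain ⟨y, hy, hxy⟩ := f.exists_mem_Icc x
  rcases le_total 0 y with h | h
  · exact ⟨y, ⟨h, hy.2⟩, hxy⟩
  · exact ⟨-y, ⟨by linarith, by linarith [hy.1]⟩, by rw [hxy, hf]⟩

theorem monotoneOn (hf : ∀ x ∈ Icc 0 Real.pi, 0 ≤ D f x) : MonotoneOn f (Icc 0 Real.pi) :=
  monotoneOn_of_deriv_nonneg (convex_Icc _ _) f.continuous.continuousOn
    f.differentiable.differentiableOn fun x hx => hf x (interior_subset hx)

end IsEven

namespace IsSol
variable {g a T : ℝ} {ρ : ℝ → SP}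

theorem apply_eq_of_H_eq_zero (h : IsSol g a T ρ) {x : ℝ} (hx : ∀ t ∈ Ico 0 T, H a (ρ t) x = 0)
    {t : ℝ} (ht : t ∈ Ico 0 T) : ρ t x = ρ 0 x := by
  have := (convex_Ico 0 T).norm_image_sub_le_of_norm_hasDerivWithin_le (C := 0)
    (f := fun s => ρ s x) (fun s hs => (h.hasTD s hs).apply x)
    (fun s hs => by simp [nonlin_apply, hx s hs]) ⟨le_rfl, h.pos⟩ ht
  rw [zero_mul] at this
  exact sub_eq_zero.1 (norm_le_zero_iff.1 this)

theorem apply_zero (h : IsSol g a T ρ) {t : ℝ} (ht : t ∈ Ico 0 T) : ρ t 0 = ρ 0 0 :=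
  h.apply_eq_of_H_eq_zero (fun s hs => (h.even s hs).H_zero a) ht

theorem apply_pi (h : IsSol g a T ρ) {t : ℝ} (ht : t ∈ Ico 0 T) : ρ t Real.pi = ρ 0 Real.pi :=
  h.apply_eq_of_H_eq_zero (fun s hs => (h.even s hs).H_pi a) ht

theorem exists_norm_le (h : IsSol g a T ρ) {τ : ℝ} (hτ : τ < T) (k : ℕ) :
    ∃ M, ∀ t ∈ Icc 0 τ, ‖(D ^ k) (ρ t)‖ ≤ M :=
  isCompact_Icc.exists_bound_of_continuousOn
    ((h.tSmooth 0 k).mono fun _ ht => ⟨ht.1, ht.2.trans_lt hτ⟩)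

/-- Monotonicity on `[0, π]` is preserved, by the minimum principle for `∂ₓ ρ`. -/
theorem D_nonneg (h : IsSol g a T ρ) (h0 : ∀ x ∈ Icc 0 Real.pi, 0 ≤ D (ρ 0) x) {t x : ℝ}
    (ht : t ∈ Ico 0 T) (hx : x ∈ Icc 0 Real.pi) : 0 ≤ D (ρ t) x := by
  have hsub : Icc 0 t ⊆ Ico 0 T := fun s hs => ⟨hs.1, hs.2.trans_lt ht.2⟩
  obtain ⟨M, hM⟩ := h.exists_norm_le ht.2 2
  -- `C` strictly exceeds `|g H_a(∂ₓρ)|` on the time interval, so the weight `exp(-Ct)` beats the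
  -- zeroth-order term in the equation for `∂ₓρ`.
  set C := |g| * (6 * M) + 1 with hC
  have hcont : ContinuousOn (fun p : ℝ × ℝ => Real.exp (-(C * p.1)) * D (ρ p.1) p.2)
      (Icc 0 t ×ˢ Icc 0 Real.pi) :=
    (by fun_prop : Continuous fun p : ℝ × ℝ => Real.exp (-(C * p.1))).continuousOn.mul
      ((h.tSmooth 0).map_D.continuousOn_uncurry.mono (prod_mono hsub (subset_univ _)))
  obtain ⟨⟨s, y⟩, ⟨hs, hy⟩, hmin⟩ := (isCompact_Icc.prod isCompact_Icc).exists_isMinOn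
    ⟨(t, x), right_mem_Icc.2 ht.1, hx⟩ hcont
  simp only at hs hy
  by_contra! hneg
  have hneg' : D (ρ s) y < 0 := by
    have h1 := hmin (⟨right_mem_Icc.2 ht.1, hx⟩ : (t, x) ∈ Icc 0 t ×ˢ Icc 0 Real.pi)
    have h2 : Real.exp (-(C * t)) * D (ρ t) x < 0 := mul_neg_of_pos_of_neg (Real.exp_pos _) hneg
    have h3 : Real.exp (-(C * s)) * D (ρ s) y < 0 := lt_of_le_of_lt h1 h2
    exact (pos_iff_neg_of_mul_neg h3).1 (Real.exp_pos _)
  have hs0 : 0 < s := hs.1.lt_of_ne' fun hs0 => by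
    rw [hs0] at hneg'; exact absurd (h0 y hy) hneg'.not_ge
  have heven := h.even s (hsub hs)
  have hy0 : 0 < y := hy.1.lt_of_ne' fun hy0 => by
    rw [hy0, heven.D_zero] at hneg'; exact hneg'.false
  have hyπ : y < Real.pi := hy.2.lt_of_ne fun hyπ => by
    rw [hyπ, heven.D_pi] at hneg'; exact hneg'.false
  -- A negative minimum lies in the interior in `x` because `∂ₓρ` vanishes at `0` and `π`. There the
  -- transport term drops out.
  have hx0 : D (D (ρ s)) y = 0 := by
    have hloc : IsLocalMin (D (ρ s)) y := by
      filter_upwards [Icc_mem_nhds hy0 hyπ] with z hz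
      have := hmin (⟨hs, hz⟩ : (s, z) ∈ Icc 0 t ×ˢ Icc 0 Real.pi)
      exact le_of_mul_le_mul_left this (Real.exp_pos _)
    exact hloc.hasDerivAt_eq_zero ((D (ρ s)).hasDerivAt y)
  have hder : HasDerivWithinAt (fun σ => Real.exp (-(C * σ)) * D (ρ σ) y)
      (Real.exp (-(C * s)) * -(C * 1) * D (ρ s) y +
        Real.exp (-(C * s)) * D (nonlin g a (ρ s)) y) (Icc 0 t) s := by
    have h1 := (((hasDerivAt_id s).const_mul C).neg.exp).hasDerivWithinAt (s := Icc 0 t)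
    exact h1.fun_mul ((((h.hasTD s (hsub hs)).mono hsub).map_D).apply y)
  have hle : Real.exp (-(C * s)) * -(C * 1) * D (ρ s) y +
        Real.exp (-(C * s)) * D (nonlin g a (ρ s)) y ≤ 0 := by
    -- Looking only backwards in time covers `s = t`. Minimality makes the time derivative
    -- nonpositive, while the equation makes it positive.
    have hlm : IsLocalMinOn (fun σ => Real.exp (-(C * σ)) * D (ρ σ) y) (Icc 0 s) s := by
      filter_upwards [self_mem_nhdsWithin] with σ hσ
      exact hmin (⟨⟨hσ.1, hσ.2.trans hs.2⟩, hy⟩ : (σ, y) ∈ Icc 0 t ×ˢ Icc 0 Real.pi)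
    have hcone : (0 : ℝ) - s ∈ posTangentConeAt (Icc 0 s) s :=
      sub_mem_posTangentConeAt_of_segment_subset
        ((convex_Icc 0 s).segment_subset (right_mem_Icc.2 hs0.le) (left_mem_Icc.2 hs0.le))
    have := hlm.hasFDerivWithinAt_nonneg
      (hder.mono (Icc_subset_Icc_right hs.2)).hasFDerivWithinAt hcone
    simp at this
    nlinarith
  have hD : D (nonlin g a (ρ s)) y = -(g * H a (D (ρ s)) y * D (ρ s) y) := by
    simp [nonlin, D_mul, D_H, hx0, mul_assoc]
  have hbd : |g * H a (D (ρ s)) y| ≤ |g| * (6 * M) := by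
    rw [abs_mul]
    refine mul_le_mul_of_nonneg_left ?_ (abs_nonneg _)
    exact (abs_le_supNorm _ _).trans ((supNorm_H_D_le a _).trans
      (mul_le_mul_of_nonneg_left (hM s hs) (by norm_num)))
  rw [hD] at hle
  have hpos : 0 < C + g * H a (D (ρ s)) y := by linarith [(abs_le.1 hbd).1]
  have := mul_pos (mul_pos (Real.exp_pos (-(C * s))) hpos) (neg_pos.2 hneg')
  linarith

/-- Monotonicity puts the extreme values at `0` and `π`, and these are constant in time because the
velocity vanishes there. -/
theorem mem_Icc (h : IsSol g a T ρ) (h0 : ∀ x ∈ Icc 0 Real.pi, 0 ≤ D (ρ 0) x) {t : ℝ}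
    (ht : t ∈ Ico 0 T) (x : ℝ) : ρ t x ∈ Icc (ρ 0 0) (ρ 0 Real.pi) := by
  obtain ⟨y, hy, hxy⟩ := (h.even t ht).exists_mem_Icc x
  have hm : MonotoneOn (ρ t) (Icc 0 Real.pi) := IsEven.monotoneOn fun x hx => h.D_nonneg h0 ht hx
  rw [hxy, ← h.apply_zero ht, ← h.apply_pi ht]
  exact ⟨hm (left_mem_Icc.2 Real.pi_pos.le) hy hy.1, hm hy (right_mem_Icc.2 Real.pi_pos.le) hy.2⟩

end IsSol

end SP

/-! ### Trigonometry of the cotangent kernel -/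

/-- The function `cot (x / 2)`. -/
noncomputable def cotHalf (x : ℝ) : ℝ := Real.cos (x / 2) / Real.sin (x / 2)

theorem cotHalf_neg (x : ℝ) : cotHalf (-x) = -cotHalf x := by
  simp [cotHalf, neg_div, div_neg]

theorem cotHalf_periodic : Function.Periodic cotHalf (2 * Real.pi) := fun x => by
  rw [cotHalf, show (x + 2 * Real.pi) / 2 = x / 2 + Real.pi by ring, Real.cos_add_pi,
    Real.sin_add_pi, neg_div_neg_eq, cotHalf]

@[fun_prop] theorem measurable_cotHalf : Measurable cotHalf := by
  unfold cotHalf; fun_prop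

theorem cotHalf_pi : cotHalf Real.pi = 0 := by simp [cotHalf]

theorem sin_half_pos {x : ℝ} (h0 : 0 < x) (h : x ≤ Real.pi) : 0 < Real.sin (x / 2) :=
  Real.sin_pos_of_pos_of_lt_pi (by linarith) (by linarith)

theorem cos_half_nonneg {x : ℝ} (h0 : 0 ≤ x) (h : x ≤ Real.pi) : 0 ≤ Real.cos (x / 2) :=
  Real.cos_nonneg_of_mem_Icc ⟨by linarith, by linarith⟩

theorem cotHalf_nonneg {x : ℝ} (h0 : 0 ≤ x) (h : x ≤ Real.pi) : 0 ≤ cotHalf x :=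
  div_nonneg (cos_half_nonneg h0 h) (Real.sin_nonneg_of_nonneg_of_le_pi (by linarith) (by linarith))

theorem cotHalf_pos {x : ℝ} (h0 : 0 < x) (h : x < Real.pi) : 0 < cotHalf x :=
  div_pos (Real.cos_pos_of_mem_Ioo ⟨by linarith, by linarith⟩) (sin_half_pos h0 h.le)

theorem div_pi_le_sin_half {x : ℝ} (h0 : 0 ≤ x) (h : x ≤ Real.pi) : x / Real.pi ≤ Real.sin (x / 2) := by
  have := Real.mul_le_sin (x := x / 2) (by linarith) (by linarith)
  refine le_of_eq_of_le ?_ this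
  field_simp

theorem mul_cotHalf_le {x : ℝ} (h0 : 0 ≤ x) (h : x ≤ Real.pi) : x * cotHalf x ≤ Real.pi := by
  rcases h0.eq_or_lt with rfl | h0'
  · simp [Real.pi_pos.le]
  have hs := sin_half_pos h0' h
  have h1 := div_pi_le_sin_half h0 h
  rw [div_le_iff₀ Real.pi_pos] at h1
  rw [cotHalf, ← mul_div_assoc, div_le_iff₀ hs]
  nlinarith [Real.cos_le_one (x / 2)]

/-- The factor `π - x` is needed because the folded kernel `K_a(y) - K_a(2π - y)`, with which the
cotangent is compared, also vanishes at `π`. -/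
theorem mul_cotHalf_le' {x : ℝ} (h0 : 0 < x) (h : x ≤ Real.pi) :
    x * cotHalf x ≤ Real.pi / 2 * (Real.pi - x) := by
  have hs := sin_half_pos h0 h
  have h1 := div_pi_le_sin_half h0.le h
  rw [div_le_iff₀ Real.pi_pos] at h1
  have h2 : Real.cos (x / 2) ≤ (Real.pi - x) / 2 := by
    rw [← Real.sin_pi_div_two_sub, show Real.pi / 2 - x / 2 = (Real.pi - x) / 2 by ring]
    exact Real.sin_le (by linarith)
  rw [cotHalf, ← mul_div_assoc, div_le_iff₀ hs]
  calc x * Real.cos (x / 2) ≤ (Real.sin (x / 2) * Real.pi) * ((Real.pi - x) / 2) :=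
        mul_le_mul h1 h2 (cos_half_nonneg h0.le h) (mul_nonneg hs.le Real.pi_pos.le)
    _ = _ := by ring

theorem hasDerivAt_cotHalf {x : ℝ} (h : Real.sin (x / 2) ≠ 0) :
    HasDerivAt cotHalf (-((1 + cotHalf x ^ 2) / 2)) x := by
  have hid : HasDerivAt (fun x : ℝ => x / 2) (1 / 2) x := (hasDerivAt_id x).div_const 2
  refine (hid.cos.fun_div hid.sin h).congr_deriv ?_
  unfold cotHalf
  field_simp
  ring

theorem cotHalf_sub_mul {x z : ℝ} (hx : Real.sin (x / 2) ≠ 0) (h1 : Real.sin ((z - x) / 2) ≠ 0)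
    (h2 : Real.sin ((z + x) / 2) ≠ 0) :
    cotHalf x * (cotHalf (z - x) + cotHalf (-z - x)) =
      2 * Real.cos (x / 2) ^ 2 / (Real.sin (z / 2) ^ 2 - Real.sin (x / 2) ^ 2) := by
  have hprod : Real.sin (z / 2) ^ 2 - Real.sin (x / 2) ^ 2 =
      Real.sin ((z - x) / 2) * Real.sin ((z + x) / 2) := by
    rw [sub_div, add_div, Real.sin_sub, Real.sin_add]
    have e1 := Real.sin_sq_add_cos_sq (z / 2)
    have e2 := Real.sin_sq_add_cos_sq (x / 2)
    linear_combination Real.sin (z / 2) ^ 2 * (-e2) + Real.sin (x / 2) ^ 2 * e1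
  rw [show -z - x = -(z + x) by ring, cotHalf_neg, hprod]
  unfold cotHalf
  have h3 : Real.sin ((z + x) / 2) * Real.cos ((z - x) / 2) -
      Real.cos ((z + x) / 2) * Real.sin ((z - x) / 2) = 2 * Real.sin (x / 2) * Real.cos (x / 2) := by
    rw [← Real.sin_sub, ← Real.sin_two_mul]
    congr 1; ring
  field_simp
  linear_combination Real.cos (x / 2) * h3

/-- By the preceding identity this is `sin²(z/2) - sin²(x/2) ≤ cos²(x/2) sin²(z/2)`, that is,
`sin²(x/2) cos²(z/2) ≥ 0`. The lower bound no longer depends on `x`, so it can be integrated by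
parts. -/
theorem two_mul_one_add_cotHalf_sq_le {x z : ℝ} (hx : 0 < x) (hxz : x < z) (hz : z ≤ Real.pi) :
    2 * (1 + cotHalf z ^ 2) ≤ cotHalf x * (cotHalf (z - x) + cotHalf (-z - x)) := by
  have sx := sin_half_pos hx (hxz.le.trans hz)
  have sz := sin_half_pos (hx.trans hxz) hz
  have sd := sin_half_pos (sub_pos.2 hxz) (by linarith)
  have ss : 0 < Real.sin ((z + x) / 2) :=
    Real.sin_pos_of_pos_of_lt_pi (by linarith) (by linarith)
  rw [cotHalf_sub_mul sx.ne' sd.ne' ss.ne']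
  have hlt : Real.sin (x / 2) < Real.sin (z / 2) :=
    Real.sin_lt_sin_of_lt_of_le_pi_div_two (by linarith) (by linarith) (by linarith)
  have hpos : 0 < Real.sin (z / 2) ^ 2 - Real.sin (x / 2) ^ 2 := by nlinarith
  have h1 : 1 + cotHalf z ^ 2 = 1 / Real.sin (z / 2) ^ 2 := by
    unfold cotHalf
    field_simp
    exact Real.sin_sq_add_cos_sq _
  rw [h1, mul_one_div, div_le_div_iff₀ (by positivity) hpos, Real.cos_sq']
  nlinarith [Real.sin_sq_le_one (z / 2), sq_nonneg (Real.sin (x / 2))]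

/-- For `z < x` and monotone `f` the factor `f z - f x` is nonpositive too, so this range
contributes nonnegatively and may be discarded. -/
theorem cotHalf_mul_nonpos {x z : ℝ} (hz : 0 ≤ z) (hzx : z < x) (hx : x < Real.pi) :
    cotHalf x * (cotHalf (z - x) + cotHalf (-z - x)) ≤ 0 := by
  refine mul_nonpos_of_nonneg_of_nonpos (cotHalf_nonneg (hz.trans hzx.le) hx.le) ?_
  have sd := sin_half_pos (sub_pos.2 hzx) (by linarith)
  have ss : 0 < Real.sin ((z + x) / 2) :=
    Real.sin_pos_of_pos_of_lt_pi (by linarith) (by linarith)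
  rw [show z - x = -(x - z) by ring, show -z - x = -(z + x) by ring, cotHalf_neg, cotHalf_neg]
  have : cotHalf (x - z) + cotHalf (z + x) =
      Real.sin x / (Real.sin ((x - z) / 2) * Real.sin ((z + x) / 2)) := by
    unfold cotHalf
    rw [show Real.sin x = Real.sin ((x - z) / 2 + (z + x) / 2) by congr 1; ring, Real.sin_add]
    field_simp
    ring
  rw [← neg_add, this, neg_nonpos]
  exact div_nonneg (Real.sin_nonneg_of_nonneg_of_le_pi (by linarith) hx.le) (mul_pos sd ss).le

/-! ### The blow-up functional -/

namespace SP

/-- The difference quotient `(f (c + u) - f c) cot (u / 2)`. -/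
noncomputable def quot (f : SP) (c u : ℝ) : ℝ := (f (c + u) - f c) * cotHalf u

@[fun_prop] theorem measurable_quot (f : SP) (c : ℝ) : Measurable (quot f c) := by
  have := f.continuous.measurable
  unfold quot; fun_prop

theorem quot_periodic (f : SP) (c : ℝ) : Function.Periodic (quot f c) (2 * Real.pi) := fun u => by
  rw [quot, cotHalf_periodic u, ← add_assoc, f.periodic, quot]

theorem abs_quot_le (f : SP) (c u : ℝ) : |quot f c u| ≤ Real.pi * supNorm (D f) := by
  obtain ⟨y, hy, hxy⟩ := (quot_periodic f c).exists_mem_Ico (by positivity) u (-Real.pi)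
  rw [hxy, quot, abs_mul]
  have h1 := f.abs_sub_le_supNorm c (c + y)
  rw [add_sub_cancel_left] at h1
  have hyπ : |y| ≤ Real.pi := abs_le.2 ⟨hy.1, by linarith [hy.2]⟩
  have h2 : |y| * |cotHalf y| ≤ Real.pi := by
    have h3 : |cotHalf y| = cotHalf |y| := by
      rcases le_total 0 y with h | h
      · rw [abs_of_nonneg h] at hyπ ⊢
        exact abs_of_nonneg (cotHalf_nonneg h hyπ)
      · rw [abs_of_nonpos h] at hyπ ⊢
        rw [← abs_neg, ← cotHalf_neg]
        exact abs_of_nonneg (cotHalf_nonneg (by linarith) hyπ)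
    rw [h3]
    exact mul_cotHalf_le (abs_nonneg y) hyπ
  calc _ ≤ supNorm (D f) * |y| * |cotHalf y| := mul_le_mul_of_nonneg_right h1 (abs_nonneg _)
    _ = supNorm (D f) * (|y| * |cotHalf y|) := by ring
    _ ≤ supNorm (D f) * Real.pi := mul_le_mul_of_nonneg_left h2 (supNorm_nonneg _)
    _ = _ := mul_comm _ _

theorem _root_.intervalIntegrable_of_abs_le {f : ℝ → ℝ} (hf : Measurable f) {C : ℝ} (h : ∀ x, |f x| ≤ C)
    (a b : ℝ) : IntervalIntegrable f volume a b :=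
  (intervalIntegrable_const (c := C)).mono_fun hf.aestronglyMeasurable
    (ae_of_all _ fun x => (h x).trans (le_abs_self C))

theorem intervalIntegrable_quot (f : SP) (c a b : ℝ) : IntervalIntegrable (quot f c) volume a b :=
  intervalIntegrable_of_abs_le (by fun_prop) (f.abs_quot_le c) a b

/-- The blow-up functional `∫₀^π (f x - f 0) cot (x / 2) dx`. -/
noncomputable def J : SP →ₗ[ℝ] ℝ where
  toFun f := ∫ x in (0 : ℝ)..Real.pi, quot f 0 x
  map_add' f g := by
    rw [← intervalIntegral.integral_add (f.intervalIntegrable_quot 0 _ _) (g.intervalIntegrable_quot 0 _ _)]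
    congr 1; ext x; simp [quot]; ring
  map_smul' c f := by
    rw [RingHom.id_apply, smul_eq_mul, ← intervalIntegral.integral_const_mul]
    congr 1; ext x; simp [quot]; ring

theorem J_apply (f : SP) : J f = ∫ x in (0 : ℝ)..Real.pi, quot f 0 x := rfl

theorem abs_J_le (f : SP) : |J f| ≤ 3 * Real.pi ^ 2 * ‖D (D f)‖ := by
  have := intervalIntegral.norm_integral_le_of_norm_le_const (a := 0) (b := Real.pi)
    (f := quot f 0) (C := Real.pi * supNorm (D f)) fun x _ => f.abs_quot_le 0 x
  rw [sub_zero, abs_of_nonneg Real.pi_pos.le] at this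
  refine this.trans ?_
  have h := mul_le_mul_of_nonneg_left f.supNorm_D_le (sq_nonneg Real.pi)
  linarith

theorem J_sq_le (f : SP) : J f ^ 2 ≤ Real.pi * ∫ x in (0 : ℝ)..Real.pi, quot f 0 x ^ 2 := by
  have hq := f.intervalIntegrable_quot 0 0 Real.pi
  have hq2 : IntervalIntegrable (fun x => quot f 0 x ^ 2) volume 0 Real.pi :=
    intervalIntegrable_of_abs_le (by fun_prop) (C := (Real.pi * supNorm (D f)) ^ 2) (fun x => by
      rw [abs_pow]; exact pow_le_pow_left₀ (abs_nonneg _) (f.abs_quot_le 0 x) 2) _ _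
  set m := J f / Real.pi with hm
  have h : 0 ≤ ∫ x in (0 : ℝ)..Real.pi, (quot f 0 x ^ 2 - 2 * m * quot f 0 x + m ^ 2) :=
    intervalIntegral.integral_nonneg Real.pi_pos.le fun x _ => by
      nlinarith [sq_nonneg (quot f 0 x - m)]
  rw [intervalIntegral.integral_add (hq2.sub (hq.const_mul _)) intervalIntegrable_const,
    intervalIntegral.integral_sub hq2 (hq.const_mul _), intervalIntegral.integral_const_mul,
    intervalIntegral.integral_const, ← J_apply, sub_zero, smul_eq_mul] at h
  have hJ : J f = m * Real.pi := by rw [hm]; field_simp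
  rw [hJ] at h ⊢
  nlinarith [mul_nonneg Real.pi_pos.le h]

/-- Both sides unfold to the integral of `quot f x` over a full period, centred differently;
evenness folds the second one in `z`. -/
theorem integral_quot_add_quot_neg (f : SP) (hf : IsEven f) (x : ℝ) :
    ∫ y in (0 : ℝ)..Real.pi, (f (x + y) - f (x - y)) * cotHalf y =
      ∫ z in (0 : ℝ)..Real.pi, (f z - f x) * (cotHalf (z - x) + cotHalf (-z - x)) := by
  have hsym : ∀ q : ℝ → ℝ, (∀ a b, IntervalIntegrable q volume a b) →
      ∫ y in (0 : ℝ)..Real.pi, (q y + q (-y)) = ∫ y in (-Real.pi)..Real.pi, q y := fun q hq => by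
    rw [intervalIntegral.integral_add (hq _ _), intervalIntegral.integral_comp_neg, neg_zero, add_comm,
      intervalIntegral.integral_add_adjacent_intervals (hq _ _) (hq _ _)]
    simpa using (hq 0 (-Real.pi)).comp_mul_left (c := -1)
  have hL : ∀ y, (f (x + y) - f (x - y)) * cotHalf y = quot f x y + quot f x (-y) := fun y => by
    simp only [quot, cotHalf_neg, ← sub_eq_add_neg]; ring
  have hR : ∀ z, (f z - f x) * (cotHalf (z - x) + cotHalf (-z - x)) =
      quot f x (z - x) + quot f x (-z - x) := fun z => by
    simp only [quot, add_sub_cancel, hf z]; ring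
  simp only [hL, hR]
  rw [hsym _ (f.intervalIntegrable_quot x), hsym (fun z => quot f x (z - x)),
    intervalIntegral.integral_comp_sub_right]
  · have := (f.quot_periodic x).intervalIntegral_add_eq (-Real.pi) (-Real.pi - x)
    rw [show -Real.pi + 2 * Real.pi = Real.pi by ring,
      show -Real.pi - x + 2 * Real.pi = Real.pi - x by ring] at this
    exact this
  · exact fun a b => by
      simpa using (f.intervalIntegrable_quot x (a - x) (b - x)).comp_sub_right x

end SP

/-! ### Comparison of `H_a` with the periodic Hilbert transform -/

theorem kernelW_anti (a : ℝ) {x y : ℝ} (hx : 0 ≤ x) (hxy : x ≤ y) : kernelW a y ≤ kernelW a x := by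
  rcases eq_or_ne a 0 with rfl | ha
  · simp [kernelW]
  have : 0 < a ^ 2 := by positivity
  unfold kernelW
  gcongr

theorem kernelK_anti (a : ℝ) {x y : ℝ} (hx : 0 < x) (hxy : x ≤ y) : kernelK a y ≤ kernelK a x := by
  rw [kernelK_eq a hx.ne', kernelK_eq a (hx.trans_le hxy).ne']
  exact div_le_div₀ (kernelW_nonneg a x) (kernelW_anti a hx.le hxy) hx hxy

/-- Since `y K_a(y) = kernelW a y` decreases, the difference is at least `kernelW a π` times `1/y -
1/(2π - y)`, which behaves like the cotangent at both ends. -/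
theorem cotHalf_le_kernelK_sub (a : ℝ) {y : ℝ} (h0 : 0 < y) (h : y ≤ Real.pi) :
    2 * kernelW a Real.pi / Real.pi ^ 2 * cotHalf y ≤
      kernelK a y - kernelK a (2 * Real.pi - y) := by
  have hπ := Real.pi_pos
  have hy' : 0 < 2 * Real.pi - y := by linarith
  have hm := kernelW_nonneg a Real.pi
  rw [kernelK_eq a h0.ne', kernelK_eq a hy'.ne']
  have h1 : kernelW a (2 * Real.pi - y) / (2 * Real.pi - y) ≤ kernelW a y / (2 * Real.pi - y) :=
    div_le_div_of_nonneg_right (kernelW_anti a h0.le (by linarith)) hy'.le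
  have h2 : kernelW a y / y - kernelW a y / (2 * Real.pi - y) =
      kernelW a y * (2 * (Real.pi - y) / (y * (2 * Real.pi - y))) := by
    field_simp; ring
  have h3 : (Real.pi - y) / (Real.pi * y) ≤ 2 * (Real.pi - y) / (y * (2 * Real.pi - y)) := by
    rw [div_le_div_iff₀ (by positivity) (by positivity)]
    nlinarith [mul_nonneg (mul_nonneg h0.le h0.le) (sub_nonneg.2 h)]
  have h4 : 2 / Real.pi ^ 2 * cotHalf y ≤ (Real.pi - y) / (Real.pi * y) := by
    rw [le_div_iff₀ (by positivity), div_mul_eq_mul_div, div_mul_eq_mul_div, div_le_iff₀ (by positivity)]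
    have := mul_le_mul_of_nonneg_left (mul_cotHalf_le' h0 h) (by positivity : 0 ≤ 2 * Real.pi)
    linarith
  have h5 : kernelW a Real.pi * (2 / Real.pi ^ 2 * cotHalf y) ≤
      kernelW a y * (2 * (Real.pi - y) / (y * (2 * Real.pi - y))) :=
    mul_le_mul (kernelW_anti a h0.le h) (h4.trans h3)
      (mul_nonneg (by positivity) (cotHalf_nonneg h0.le h)) (kernelW_nonneg a y)
  have h6 : 2 * kernelW a Real.pi / Real.pi ^ 2 * cotHalf y =
      kernelW a Real.pi * (2 / Real.pi ^ 2 * cotHalf y) := by ring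
  linarith

namespace SP

/-- An even periodic `f` depends on the distance to `2πℤ`, and `x - y` is at least as close to it as
`x + y`. -/
theorem IsEven.apply_sub_le_apply_add {f : SP} (hf : IsEven f) (hD : ∀ x ∈ Icc 0 Real.pi, 0 ≤ D f x)
    {x y : ℝ} (hx : x ∈ Icc 0 Real.pi) (hy : y ∈ Icc 0 Real.pi) : f (x - y) ≤ f (x + y) := by
  have hm := monotoneOn hD
  have habs : f (x - y) = f |x - y| := by
    rcases le_total 0 (x - y) with h | h
    · rw [abs_of_nonneg h]
    · rw [abs_of_nonpos h, hf]
  have h1 : |x - y| ≤ x + y := abs_le.2 ⟨by linarith [hx.1], by linarith [hy.1]⟩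
  have h2 : |x - y| ≤ 2 * Real.pi - (x + y) := abs_le.2 ⟨by linarith [hy.2], by linarith [hx.2]⟩
  have h3 : |x - y| ≤ Real.pi := by linarith
  rw [habs]
  rcases le_total (x + y) Real.pi with h | h
  · exact hm ⟨abs_nonneg _, h3⟩ ⟨by linarith [hx.1, hy.1], h⟩ h1
  · have : f (x + y) = f (2 * Real.pi - (x + y)) := by
      rw [← hf (2 * Real.pi - (x + y)), ← f.periodic (-(2 * Real.pi - (x + y)))]
      congr 1; ring
    rw [this]
    exact hm ⟨abs_nonneg _, h3⟩ ⟨by linarith [hx.2, hy.2], by linarith⟩ h2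

/-- Comparison of `-H_a f` with the periodic Hilbert transform. -/
theorem IsEven.mul_integral_cotHalf_le {f : SP} (hf : IsEven f)
    (hD : ∀ x ∈ Icc 0 Real.pi, 0 ≤ D f x) (a : ℝ) {x : ℝ} (hx : x ∈ Icc 0 Real.pi) :
    2 * kernelW a Real.pi / Real.pi ^ 2 *
      ∫ y in (0 : ℝ)..Real.pi, (f (x + y) - f (x - y)) * cotHalf y ≤ -H a f x := by
  have hπ := Real.pi_pos
  set Δ : ℝ → ℝ := fun y => f (x + y) - f (x - y) with hΔ
  have hΔ0 : ∀ y ∈ Icc 0 Real.pi, 0 ≤ Δ y := fun y hy =>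
    sub_nonneg.2 (hf.apply_sub_le_apply_add hD hx hy)
  have hΔp : ∀ (n : ℕ) (y : ℝ), Δ (2 * Real.pi * n + y) = Δ y := fun n y => by
    have h1 := f.periodic.nat_mul n (x + y)
    have h2 := f.periodic.nat_mul n (x - y - n * (2 * Real.pi))
    rw [sub_add_cancel] at h2
    simp only [hΔ]
    rw [show x + (2 * Real.pi * n + y) = x + y + n * (2 * Real.pi) by ring, h1,
      show x - (2 * Real.pi * n + y) = x - y - n * (2 * Real.pi) by ring, ← h2]
  have hΔr : ∀ y, Δ (2 * Real.pi - y) = -Δ y := fun y => by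
    have h1 := f.periodic (x - y)
    have h2 := f.periodic (x - (2 * Real.pi - y))
    simp only [hΔ]
    rw [show x + (2 * Real.pi - y) = x - y + 2 * Real.pi by ring, h1, ← h2]
    rw [show x - (2 * Real.pi - y) + 2 * Real.pi = x + y by ring]
    ring
  have hint0 : IntegrableOn (fun y => Δ y * kernelK a y) (Ioi 0) := by
    refine (integrableOn_integrand a f x).neg.congr (ae_of_all _ fun y => ?_)
    simp only [hΔ, Pi.neg_apply]; ring
  have hint : ∀ b c : ℝ, 0 ≤ b → b ≤ c → IntervalIntegrable (fun y => Δ y * kernelK a y) volume b c :=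
    fun b c hb hbc => (intervalIntegrable_iff_integrableOn_Ioc_of_le hbc).2
      (hint0.mono_set fun y hy => hb.trans_lt hy.1)
  have hneg : -H a f x = ∫ y in Ioi 0, Δ y * kernelK a y := by
    rw [H_apply, ← integral_neg]
    congr 1; ext y; simp only [hΔ]; ring
  -- `Δ` is periodic and odd under `y ↦ 2π - y`, so each period folds onto `[0, π]` with a
  -- difference of kernel values.
  have hperiod : ∀ n : ℕ, ∫ y in (2 * Real.pi * n)..(2 * Real.pi * n + 2 * Real.pi),
      Δ y * kernelK a y = ∫ y in (0 : ℝ)..Real.pi, Δ y *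
        (kernelK a (2 * Real.pi * n + y) - kernelK a (2 * Real.pi * n + (2 * Real.pi - y))) := fun n => by
    have hn : 0 ≤ 2 * Real.pi * (n : ℝ) := by positivity
    have hI : ∀ b c : ℝ, 0 ≤ b → b ≤ c →
        IntervalIntegrable (fun y => Δ y * kernelK a (2 * Real.pi * n + y)) volume b c :=
      fun b c hb hbc => by
        have := (hint (2 * Real.pi * n + b) (2 * Real.pi * n + c) (by linarith)
          (by linarith)).comp_add_left (2 * Real.pi * n)
        simpa only [hΔp, add_sub_cancel_left] using this
    have e1 : ∫ y in (2 * Real.pi * n)..(2 * Real.pi * n + 2 * Real.pi), Δ y * kernelK a y =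
        ∫ y in (0 : ℝ)..(2 * Real.pi), Δ y * kernelK a (2 * Real.pi * n + y) := by
      have := intervalIntegral.integral_comp_add_left (a := 0) (b := 2 * Real.pi)
        (fun y => Δ y * kernelK a y) (2 * Real.pi * n)
      rw [add_zero] at this
      rw [← this]
      simp only [hΔp]
    have e2 : ∫ y in Real.pi..(2 * Real.pi), Δ y * kernelK a (2 * Real.pi * n + y) =
        ∫ y in (0 : ℝ)..Real.pi, -(Δ y * kernelK a (2 * Real.pi * n + (2 * Real.pi - y))) := by
      have := intervalIntegral.integral_comp_sub_left (a := 0) (b := Real.pi)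
        (fun y => Δ y * kernelK a (2 * Real.pi * n + y)) (2 * Real.pi)
      rw [sub_zero, show 2 * Real.pi - Real.pi = Real.pi by ring] at this
      rw [← this]
      simp only [hΔr, neg_mul]
    have hI2 : IntervalIntegrable
        (fun y => -(Δ y * kernelK a (2 * Real.pi * n + (2 * Real.pi - y)))) volume 0 Real.pi := by
      have := ((hI Real.pi (2 * Real.pi) hπ.le (by linarith)).comp_sub_left (2 * Real.pi)).symm
      rw [sub_self, show 2 * Real.pi - Real.pi = Real.pi by ring] at this
      simpa only [hΔr, neg_mul] using this
    rw [e1, ← intervalIntegral.integral_add_adjacent_intervals (hI 0 Real.pi le_rfl hπ.le)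
      (hI Real.pi (2 * Real.pi) hπ.le (by linarith)), e2,
      ← intervalIntegral.integral_add (hI 0 Real.pi le_rfl hπ.le) hI2]
    congr 1; ext y; ring
  -- As the kernel decreases, every later period contributes nonnegatively; the first period alone
  -- is a lower bound.
  have hmono : ∀ n : ℕ, ∫ y in (0 : ℝ)..(2 * Real.pi), Δ y * kernelK a y ≤
      ∫ y in (0 : ℝ)..(2 * Real.pi * (n + 1 : ℕ)), Δ y * kernelK a y := fun n => by
    induction n with
    | zero => simp
    | succ n ih =>
      have h1 := hperiod (n + 1)
      have hn : (0 : ℝ) ≤ 2 * Real.pi * (n + 1 : ℕ) := by positivity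
      have h2 := intervalIntegral.integral_add_adjacent_intervals
        (hint 0 (2 * Real.pi * (n + 1 : ℕ)) le_rfl hn)
        (hint (2 * Real.pi * (n + 1 : ℕ)) (2 * Real.pi * (n + 1 : ℕ) + 2 * Real.pi) hn (by linarith))
      have h3 : 2 * Real.pi * ((n + 1 + 1 : ℕ) : ℝ) = 2 * Real.pi * (n + 1 : ℕ) + 2 * Real.pi := by
        push_cast; ring
      rw [h3, ← h2, h1]
      refine ih.trans (le_add_of_nonneg_right (intervalIntegral.integral_nonneg hπ.le fun y hy => ?_))
      refine mul_nonneg (hΔ0 y hy) (sub_nonneg.2 (kernelK_anti a ?_ ?_))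
      · have : (0 : ℝ) < 2 * Real.pi * (n + 1 : ℕ) := by positivity
        linarith [hy.1]
      · linarith [hy.2]
  have hlim : Tendsto (fun n : ℕ => ∫ y in (0 : ℝ)..(2 * Real.pi * (n + 1 : ℕ)), Δ y * kernelK a y)
      atTop (𝓝 (-H a f x)) := by
    rw [hneg]
    refine intervalIntegral_tendsto_integral_Ioi 0 hint0 ?_
    exact ((tendsto_natCast_atTop_atTop (R := ℝ)).comp (tendsto_add_atTop_nat 1)).const_mul_atTop
      (by positivity)
  refine le_trans ?_ (ge_of_tendsto' hlim hmono)
  have h0 := hperiod 0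
  simp only [Nat.cast_zero, mul_zero, zero_add] at h0
  rw [h0, ← intervalIntegral.integral_const_mul]
  have hq : IntervalIntegrable (fun y => Δ y * cotHalf y) volume 0 Real.pi := by
    have h1 := f.intervalIntegrable_quot x 0 Real.pi
    have h2 := (f.intervalIntegrable_quot x 0 (-Real.pi)).comp_mul_left (c := -1)
    rw [zero_div, neg_div_neg_eq, div_one] at h2
    refine (h1.add h2).congr (fun y _ => ?_)
    simp only [quot, hΔ, neg_one_mul, cotHalf_neg, ← sub_eq_add_neg]; ring
  have hd : IntervalIntegrable (fun y => Δ y * (kernelK a y - kernelK a (2 * Real.pi - y)))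
      volume 0 Real.pi := by
    have := ((hint Real.pi (2 * Real.pi) hπ.le (by linarith)).comp_sub_left (2 * Real.pi)).symm
    rw [sub_self, show 2 * Real.pi - Real.pi = Real.pi by ring] at this
    refine ((hint 0 Real.pi le_rfl hπ.le).add this).congr (fun y _ => ?_)
    simp only [hΔr]; ring
  refine intervalIntegral.integral_mono_on_of_le_Ioo hπ.le (hq.const_mul _) hd fun y hy => ?_
  have := mul_le_mul_of_nonneg_left (cotHalf_le_kernelK_sub a hy.1 hy.2.le)
    (hΔ0 y (Ioo_subset_Icc_self hy))
  linarith

end SP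

/-! ### The Riccati inequality -/

theorem continuousOn_cotHalf : ContinuousOn cotHalf (Ioc 0 Real.pi) := fun _ hx =>
  (hasDerivAt_cotHalf (sin_half_pos hx.1 hx.2).ne').continuousAt.continuousWithinAt

namespace SP

/-- Integration by parts with `(cot(z/2))' = -(1 + cot²(z/2))/2`. The boundary terms vanish: `f z -
f x` at `z = x`, the cotangent at `z = π`. -/
theorem integral_sub_mul_one_add_cotHalf_sq (f : SP) {x : ℝ} (hx : x ∈ Ioo 0 Real.pi) :
    ∫ z in x..Real.pi, (f z - f x) * (1 + cotHalf z ^ 2) =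
      2 * ∫ z in x..Real.pi, D f z * cotHalf z := by
  have hsub : uIcc x Real.pi ⊆ Ioc 0 Real.pi := by
    rw [uIcc_of_le hx.2.le]; exact fun z hz => ⟨hx.1.trans_le hz.1, hz.2⟩
  have hc := continuousOn_cotHalf.mono hsub
  have i1 : IntervalIntegrable (fun z => (f z - f x) * (1 + cotHalf z ^ 2)) volume x Real.pi :=
    ContinuousOn.intervalIntegrable (by fun_prop)
  have i2 : IntervalIntegrable (fun z => D f z * cotHalf z) volume x Real.pi :=
    ContinuousOn.intervalIntegrable (by fun_prop)
  have h := intervalIntegral.integral_eq_sub_of_hasDerivAt (a := x) (b := Real.pi)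
    (f := fun z => -2 * ((f z - f x) * cotHalf z))
    (f' := fun z => (f z - f x) * (1 + cotHalf z ^ 2) - 2 * (D f z * cotHalf z))
    (fun z hz => by
      have := hsub hz
      refine ((((f.hasDerivAt z).sub_const (f x)).mul
        (hasDerivAt_cotHalf (sin_half_pos this.1 this.2).ne')).const_mul (-2)).congr_deriv ?_
      ring) (i1.sub (i2.const_mul 2))
  rw [intervalIntegral.integral_sub i1 (i2.const_mul 2), intervalIntegral.integral_const_mul,
    cotHalf_pi] at h
  linarith

theorem IsEven.integral_le_cotHalf_mul {f : SP} (hf : IsEven f)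
    (hD : ∀ x ∈ Icc 0 Real.pi, 0 ≤ D f x) {x : ℝ} (hx : x ∈ Ioo 0 Real.pi) :
    2 * ∫ z in x..Real.pi, (f z - f x) * (1 + cotHalf z ^ 2) ≤
      cotHalf x * ∫ z in (0 : ℝ)..Real.pi, (f z - f x) * (cotHalf (z - x) + cotHalf (-z - x)) := by
  have hm := monotoneOn hD
  set q : ℝ → ℝ := fun z => cotHalf x * ((f z - f x) * (cotHalf (z - x) + cotHalf (-z - x))) with hq
  have hI : ∀ b c, IntervalIntegrable q volume b c := fun b c => by
    refine IntervalIntegrable.const_mul ?_ _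
    have h1 := (f.intervalIntegrable_quot x (b - x) (c - x)).comp_sub_right x
    have h2 := (f.intervalIntegrable_quot x (-b - x) (-c - x)).comp_sub_right x
    have h3 := h2.comp_mul_left (c := -1)
    simp only [sub_add_cancel, div_neg, div_one, neg_neg] at h1 h3
    refine (h1.add h3).congr fun z _ => ?_
    simp only [quot, add_sub_cancel, hf z, neg_one_mul]
    ring
  rw [← intervalIntegral.integral_const_mul, ← intervalIntegral.integral_const_mul,
    ← intervalIntegral.integral_add_adjacent_intervals (hI 0 x) (hI x Real.pi)]
  refine le_add_of_nonneg_of_le ?_ ?_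
  · refine intervalIntegral.integral_nonneg hx.1.le fun z hz => ?_
    rcases hz.2.eq_or_lt with rfl | hzx
    · simp [hq]
    · have h1 := cotHalf_mul_nonpos hz.1 hzx hx.2
      have h2 : f z - f x ≤ 0 :=
        sub_nonpos.2 (hm ⟨hz.1, hz.2.trans hx.2.le⟩ (Ioo_subset_Icc_self hx) hz.2)
      have := mul_nonneg_of_nonpos_of_nonpos h2 h1
      simp only [hq]
      linarith
  · have hsub : uIcc x Real.pi ⊆ Ioc 0 Real.pi := by
      rw [uIcc_of_le hx.2.le]; exact fun z hz => ⟨hx.1.trans_le hz.1, hz.2⟩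
    have hc := continuousOn_cotHalf.mono hsub
    refine intervalIntegral.integral_mono_on_of_le_Ioo hx.2.le
      (ContinuousOn.intervalIntegrable (by fun_prop)) (hI _ _) fun z hz => ?_
    have h1 := two_mul_one_add_cotHalf_sq_le hx.1 hz.1 hz.2.le
    have h2 : 0 ≤ f z - f x :=
      sub_nonneg.2 (hm (Ioo_subset_Icc_self hx) ⟨(hx.1.trans hz.1).le, hz.2.le⟩ hz.1.le)
    have := mul_le_mul_of_nonneg_left h1 h2
    simp only [hq]
    linarith

theorem quot_zero_of_apply_zero {f : SP} (h : f 0 = 0) (x : ℝ) : quot f 0 x = f x * cotHalf x := by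
  simp [quot, h]

/-- The primitive `2 ∫ₓ^π f'(z) cot (z / 2) dz`. -/
noncomputable def prim (f : SP) (x : ℝ) : ℝ := 2 * ∫ z in x..Real.pi, quot (D f) 0 z

theorem continuous_prim (f : SP) : Continuous (prim f) := by
  have h := intervalIntegral.continuous_primitive (μ := volume) (f := quot (D f) 0)
    (fun a b => (D f).intervalIntegrable_quot 0 a b) Real.pi
  have : prim f = fun x => 2 * -∫ z in Real.pi..x, quot (D f) 0 z := by
    ext x; rw [prim, intervalIntegral.integral_symm]
  rw [this]
  fun_prop

theorem continuousAt_quot (f : SP) {x : ℝ} (hx : x ∈ Ioc 0 Real.pi) : ContinuousAt (quot f 0) x := by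
  have := (hasDerivAt_cotHalf (sin_half_pos hx.1 hx.2).ne').continuousAt
  unfold quot
  fun_prop

theorem hasDerivAt_prim (f : SP) {x : ℝ} (hx : x ∈ Ioc 0 Real.pi) :
    HasDerivAt (prim f) (-2 * quot (D f) 0 x) x := by
  refine ((intervalIntegral.integral_hasDerivAt_left ((D f).intervalIntegrable_quot 0 x Real.pi)
    ((D f).measurable_quot 0).stronglyMeasurable.stronglyMeasurableAtFilter
    ((D f).continuousAt_quot hx)).const_mul 2).congr_deriv ?_
  ring

/-- The difference of the integrands is the derivative of `f * prim f + f² cot(x/2)`. This vanishes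
at `0` because `f 0 = 0`, and at `π` because `prim f` and the cotangent do. -/
theorem IsEven.integral_D_mul_prim {f : SP} (hf : IsEven f) (h0 : f 0 = 0) :
    ∫ x in (0 : ℝ)..Real.pi, D f x * prim f x =
      ∫ x in (0 : ℝ)..Real.pi, (f x ^ 2 + quot f 0 x ^ 2) / 2 := by
  have hD0 : D f 0 = 0 := hf.D_zero
  have i1 : IntervalIntegrable (fun x => D f x * prim f x) volume 0 Real.pi :=
    Continuous.intervalIntegrable ((D f).continuous.mul f.continuous_prim) _ _
  have i2 : IntervalIntegrable (fun x => (f x ^ 2 + quot f 0 x ^ 2) / 2) volume 0 Real.pi := by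
    refine IntervalIntegrable.div_const (IntervalIntegrable.add
      (Continuous.intervalIntegrable (by fun_prop) _ _) ?_) _
    exact intervalIntegrable_of_abs_le (by fun_prop) (C := (Real.pi * supNorm (D f)) ^ 2) (fun x => by
      rw [abs_pow]; exact pow_le_pow_left₀ (abs_nonneg _) (f.abs_quot_le 0 x) 2) _ _
  have hcq : ContinuousOn (fun x => f x * quot f 0 x) (Icc 0 Real.pi) := fun x hx => by
    rcases hx.1.eq_or_lt with rfl | hx0
    · refine ContinuousAt.continuousWithinAt ?_
      rw [ContinuousAt, h0, zero_mul]
      refine squeeze_zero_norm (a := fun x => |f x| * (Real.pi * supNorm (D f))) (fun x => ?_) ?_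
      · rw [Real.norm_eq_abs, abs_mul]
        exact mul_le_mul_of_nonneg_left (f.abs_quot_le 0 x) (abs_nonneg _)
      · have : Continuous fun x => |f x| * (Real.pi * supNorm (D f)) := by fun_prop
        simpa [h0] using this.tendsto 0
    · exact (f.continuous.continuousAt.mul (f.continuousAt_quot ⟨hx0, hx.2⟩)).continuousWithinAt
  have h := intervalIntegral.integral_eq_sub_of_hasDerivAt_of_le Real.pi_pos.le
    (f := fun x => f x * prim f x + f x * quot f 0 x)
    (f' := fun x => D f x * prim f x - (f x ^ 2 + quot f 0 x ^ 2) / 2)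
    ((f.continuous.mul f.continuous_prim).continuousOn.add hcq)
    (fun x hx => by
      have hx' := Ioo_subset_Ioc_self hx
      have hq : HasDerivAt (quot f 0) (D f x * cotHalf x + f x * -((1 + cotHalf x ^ 2) / 2)) x := by
        rw [funext (quot_zero_of_apply_zero h0)]
        exact (f.hasDerivAt x).mul (hasDerivAt_cotHalf (sin_half_pos hx'.1 hx'.2).ne')
      refine (((f.hasDerivAt x).mul (f.hasDerivAt_prim hx')).add
        ((f.hasDerivAt x).mul hq)).congr_deriv ?_
      rw [quot_zero_of_apply_zero h0, quot_zero_of_apply_zero hD0]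
      ring) (i1.sub i2)
  rw [intervalIntegral.integral_sub i1 i2] at h
  simp only [h0, prim, intervalIntegral.integral_same, quot_zero_of_apply_zero h0, cotHalf_pi] at h
  simp only [prim, quot_zero_of_apply_zero h0]
  linarith

/-- The Riccati constant of the blow-up functional. -/
noncomputable def riccati (g a : ℝ) : ℝ := g * (2 * kernelW a Real.pi / Real.pi ^ 2) / Real.pi

theorem riccati_pos {g a : ℝ} (hg : 0 < g) (ha : 0 < a) : 0 < riccati g a := by
  unfold riccati kernelW; positivity

/-- Pointwise, `-g H_a f · f' cot(x/2) ≥ 2 g c f' · prim f`. Integrating, half of `∫ (f cot(x/2))²`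
is below `∫ f' prim f`, and Cauchy–Schwarz on `[0, π]` costs the factor `1/π`. -/
theorem IsEven.riccati_mul_le {g a : ℝ} (hg : 0 ≤ g) {f : SP} (hf : IsEven f)
    (hD : ∀ x ∈ Icc 0 Real.pi, 0 ≤ D f x) (h0 : f 0 = 0) :
    riccati g a * J f ^ 2 ≤ J (nonlin g a f) := by
  set c := 2 * kernelW a Real.pi / Real.pi ^ 2 with hc
  have hc0 : 0 ≤ c := div_nonneg (mul_nonneg zero_le_two (kernelW_nonneg a _)) (sq_nonneg _)
  have hN0 : nonlin g a f 0 = 0 := by simp [nonlin_apply, hf.H_zero]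
  have i1 : IntervalIntegrable (fun x => D f x * prim f x) volume 0 Real.pi :=
    Continuous.intervalIntegrable ((D f).continuous.mul f.continuous_prim) _ _
  have hpt : ∀ x ∈ Ioo 0 Real.pi, g * (2 * c) * (D f x * prim f x) ≤ quot (nonlin g a f) 0 x := by
    intro x hx
    have hx' := Ioo_subset_Icc_self hx
    have hcot := cotHalf_nonneg hx'.1 hx'.2
    have h1 := hf.mul_integral_cotHalf_le hD a hx'
    rw [f.integral_quot_add_quot_neg hf] at h1
    have h2 := hf.integral_le_cotHalf_mul hD hx
    rw [f.integral_sub_mul_one_add_cotHalf_sq hx] at h2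
    have h3 : 2 * prim f x ≤ cotHalf x * ∫ z in (0 : ℝ)..Real.pi,
        (f z - f x) * (cotHalf (z - x) + cotHalf (-z - x)) := by
      rw [prim]
      simpa only [quot_zero_of_apply_zero hf.D_zero] using h2
    have h4 : c * (2 * prim f x) ≤ cotHalf x * -H a f x :=
      (mul_le_mul_of_nonneg_left h3 hc0).trans
        (le_of_eq_of_le (by ring) (mul_le_mul_of_nonneg_left h1 hcot))
    have h5 := mul_le_mul_of_nonneg_left h4 (mul_nonneg hg (hD x hx'))
    rw [quot_zero_of_apply_zero hN0, nonlin_apply]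
    linarith
  have h1 : g * (2 * c) * ∫ x in (0 : ℝ)..Real.pi, D f x * prim f x ≤ J (nonlin g a f) := by
    rw [← intervalIntegral.integral_const_mul, J_apply]
    exact intervalIntegral.integral_mono_on_of_le_Ioo Real.pi_pos.le (i1.const_mul _)
      ((nonlin g a f).intervalIntegrable_quot 0 _ _) hpt
  have hq2 : IntervalIntegrable (fun x => quot f 0 x ^ 2) volume 0 Real.pi :=
    intervalIntegrable_of_abs_le (by fun_prop) (C := (Real.pi * supNorm (D f)) ^ 2) (fun x => by
      rw [abs_pow]; exact pow_le_pow_left₀ (abs_nonneg _) (f.abs_quot_le 0 x) 2) _ _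
  have h2 : (∫ x in (0 : ℝ)..Real.pi, quot f 0 x ^ 2) / 2 ≤
      ∫ x in (0 : ℝ)..Real.pi, D f x * prim f x := by
    rw [hf.integral_D_mul_prim h0, ← intervalIntegral.integral_div]
    refine intervalIntegral.integral_mono_on Real.pi_pos.le (hq2.div_const 2)
      (((Continuous.intervalIntegrable (by fun_prop) _ _).add hq2).div_const 2) fun x _ => ?_
    linarith [sq_nonneg (f x)]
  refine le_trans ?_ h1
  refine le_trans ?_ (mul_le_mul_of_nonneg_left h2 (by positivity))
  have h3 := mul_le_mul_of_nonneg_left f.J_sq_le (mul_nonneg hg hc0)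
  rw [riccati, ← hc, div_mul_eq_mul_div, div_le_iff₀ Real.pi_pos]
  linarith

theorem J_pos {f : SP} (hf : ∀ x ∈ Icc 0 Real.pi, 0 ≤ D f x) (h0 : f 0 = 0) {y : ℝ}
    (hy : y ∈ Icc 0 Real.pi) (hne : f y ≠ 0) : 0 < J f := by
  have hm := IsEven.monotoneOn hf
  have hπ := Real.pi_pos
  have hnn : ∀ x ∈ Icc 0 Real.pi, 0 ≤ f x := fun x hx => by
    rw [← h0]; exact hm (left_mem_Icc.2 hπ.le) hx hx.1
  have hfπ : 0 < f Real.pi :=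
    ((hnn y hy).lt_of_ne' hne).trans_le (hm hy (right_mem_Icc.2 hπ.le) hy.2)
  obtain ⟨x, hfx, hx⟩ := ((f.continuous.continuousAt.eventually (lt_mem_nhds hfπ)).filter_mono
    nhdsWithin_le_nhds |>.and (Ioo_mem_nhdsLT hπ)).exists
  have hI := f.intervalIntegrable_quot 0
  rw [J_apply, ← intervalIntegral.integral_add_adjacent_intervals (hI 0 x) (hI x Real.pi)]
  refine add_pos_of_nonneg_of_pos (intervalIntegral.integral_nonneg hx.1.le fun z hz => ?_)
    (intervalIntegral.intervalIntegral_pos_of_pos_on (hI _ _) (fun z hz => ?_) hx.2)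
  · rw [quot_zero_of_apply_zero h0]
    exact mul_nonneg (hnn z ⟨hz.1, hz.2.trans hx.2.le⟩) (cotHalf_nonneg hz.1 (hz.2.trans hx.2.le))
  · rw [quot_zero_of_apply_zero h0]
    exact mul_pos (hfx.trans_le (hm (Ioo_subset_Icc_self hx) ⟨(hx.1.trans hz.1).le, hz.2.le⟩ hz.1.le))
      (cotHalf_pos (hx.1.trans hz.1) hz.2)

/-- The lifespan of a solution is bounded by the Riccati inequality for `J`. -/
theorem IsSol.le_of_J_pos {g a T : ℝ} {ρ : ℝ → SP} (h : IsSol g a T ρ) (hg : 0 < g) (ha : 0 < a)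
    (hD : ∀ x ∈ Icc 0 Real.pi, 0 ≤ D (ρ 0) x) (h0 : ρ 0 0 = 0) (hJ : 0 < J (ρ 0)) :
    T ≤ 1 / (riccati g a * J (ρ 0)) := by
  set κ := riccati g a with hκ
  have hκ0 : 0 < κ := riccati_pos hg ha
  have hder : ∀ t ∈ Ico 0 T, HasDerivWithinAt (fun t => J (ρ t)) (J (nonlin g a (ρ t))) (Ico 0 T) t :=
    fun t ht => (h.hasTD t ht).map_of_bound J (3 * Real.pi ^ 2) fun f => by
      have := f.abs_J_le
      have h1 : ‖D (D f)‖ ≤ ‖f‖ + ‖D f‖ + ‖D (D f)‖ := by linarith [norm_nonneg f, norm_nonneg (D f)]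
      exact this.trans (mul_le_mul_of_nonneg_left h1 (by positivity))
  have hric : ∀ t ∈ Ico 0 T, κ * J (ρ t) ^ 2 ≤ J (nonlin g a (ρ t)) := fun t ht =>
    (h.even t ht).riccati_mul_le hg.le (fun x hx => h.D_nonneg hD ht hx) ((h.apply_zero ht).trans h0)
  have hmono : MonotoneOn (fun t => J (ρ t)) (Ico 0 T) :=
    monotoneOn_of_hasDerivWithinAt_nonneg (convex_Ico 0 T)
      (fun t ht => (hder t ht).continuousWithinAt)
      (fun t ht => (hder t (interior_subset ht)).mono interior_subset)
      fun t ht => (by positivity : 0 ≤ κ * J (ρ t) ^ 2).trans (hric t (interior_subset ht))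
  have hpos : ∀ t ∈ Ico 0 T, 0 < J (ρ t) := fun t ht =>
    hJ.trans_le (hmono ⟨le_rfl, h.pos⟩ ht ht.1)
  -- The Riccati inequality makes `-1/J - κ t` nondecreasing; as `1/J` stays positive, `κ t ≤ 1/J(ρ
  -- 0)`.
  have hinv : ∀ t ∈ Ico 0 T, HasDerivWithinAt (fun t => -(J (ρ t))⁻¹ - κ * t)
      (-(-J (nonlin g a (ρ t)) / J (ρ t) ^ 2) - κ * 1) (Ico 0 T) t := fun t ht =>
    ((hder t ht).fun_inv (hpos t ht).ne').fun_neg.fun_sub ((hasDerivWithinAt_id t _).const_mul κ)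
  have hmono' : MonotoneOn (fun t => -(J (ρ t))⁻¹ - κ * t) (Ico 0 T) :=
    monotoneOn_of_hasDerivWithinAt_nonneg (convex_Ico 0 T)
      (fun t ht => (hinv t ht).continuousWithinAt)
      (fun t ht => (hinv t (interior_subset ht)).mono interior_subset)
      fun t ht => by
        have h1 := hpos t (interior_subset ht)
        have h2 := hric t (interior_subset ht)
        rw [neg_div, neg_neg, mul_one, sub_nonneg, le_div_iff₀ (by positivity)]
        exact h2
  have hlt : ∀ t ∈ Ico 0 T, t ≤ 1 / (κ * J (ρ 0)) := fun t ht => by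
    have h1 := hmono' ⟨le_rfl, h.pos⟩ ht ht.1
    have h2 := inv_pos.2 (hpos t ht)
    simp only [mul_zero, sub_zero] at h1
    rw [mul_comm, ← div_div, one_div, le_div_iff₀ hκ0]
    linarith
  exact le_of_forall_lt_imp_le_of_dense fun t ht => by
    rcases lt_or_ge t 0 with h' | h'
    · exact h'.le.trans (by positivity)
    · exact hlt t ⟨h', ht⟩

end SP

/-! ### Continuation criterion -/

namespace SP

/-- A logarithmic estimate of the growth rate of the energy. -/
theorem energy_rate_le (g a : ℝ) : ∃ A, 0 ≤ A ∧ ∀ f : SP,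
    2 * inner ℝ f (nonlin g a f) + 2 * inner ℝ (D (D f)) (D (D (nonlin g a f))) ≤
      A * (1 + supNorm (D f)) * ((1 + Real.log (1 + energy f)) * (1 + energy f)) := by
  set c := ∫ y in Ioi 1, kernelK a y with hc
  have hc0 : 0 ≤ c := setIntegral_nonneg measurableSet_Ioi fun y hy =>
    kernelK_nonneg a (one_pos.trans hy)
  refine ⟨2 * |g| * (20 + 6 * c), by positivity, fun f => ?_⟩
  set E := energy f with hE
  have hE0 : 0 ≤ E := energy_nonneg f
  set F := Real.log (1 + E) with hF
  have hF0 : 0 ≤ F := Real.log_nonneg (by linarith)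
  set m := supNorm (D f) with hm
  have hm0 : 0 ≤ m := supNorm_nonneg _
  -- The cut-off radius `δ = 1/(1 + E)` makes the near part at most `4`, since `‖D (D f)‖ ≤ √E`, and
  -- turns `log δ⁻¹` into `log (1 + E)`.
  have hH : supNorm (H a (D f)) ≤ 4 + 2 * m * (F + c) := supNorm_le fun x => by
    have h1 := abs_H_le a (D f) x (δ := (1 + E)⁻¹) (by positivity)
      (inv_le_one_of_one_le₀ (by linarith))
    rw [inv_inv] at h1
    have h2 : √(1 + E)⁻¹ * ‖D (D f)‖ ≤ 1 := by
      rw [Real.sqrt_inv, inv_mul_le_iff₀ (by positivity), mul_one]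
      exact (norm_D_D_le_sqrt_energy f).trans (Real.sqrt_le_sqrt (by linarith))
    linarith
  have h1 := abs_energy_rate_le g a f
  have h2 := le_abs_self (inner ℝ f (nonlin g a f))
  have h3 := le_abs_self (inner ℝ (D (D f)) (D (D (nonlin g a f))))
  have h4 : 3 * supNorm (H a (D f)) + 2 * m ≤ (20 + 6 * c) * (1 + m) * (1 + F) := by
    have : 0 ≤ 14 * m * F + 8 + 18 * m + 6 * c + 20 * F + 6 * c * F + 6 * c * m * F := by positivity
    nlinarith
  have h5 : |g| * (3 * supNorm (H a (D f)) + 2 * m) * E ≤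
      |g| * ((20 + 6 * c) * (1 + m) * (1 + F)) * (1 + E) := by
    have h0 := supNorm_nonneg (H a (D f))
    gcongr
    linarith
  linarith

namespace IsSol
variable {g a T : ℝ} {ρ : ℝ → SP}

theorem continuousOn_supNorm_D (h : IsSol g a T ρ) :
    ContinuousOn (fun t => supNorm (D (ρ t))) (Ico 0 T) :=
  (h.tSmooth 0).map_D.continuousOn_supNorm

theorem intervalIntegrable_supNorm_D (h : IsSol g a T ρ) {s t : ℝ} (hs : s ∈ Ico 0 T)
    (ht : t ∈ Ico 0 T) : IntervalIntegrable (fun t => supNorm (D (ρ t))) volume s t :=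
  (h.continuousOn_supNorm_D.mono (ordConnected_Ico.uIcc_subset hs ht)).intervalIntegrable

theorem integral_supNorm_D_mono (h : IsSol g a T ρ) {s t : ℝ} (hs : s ∈ Ico 0 T) (ht : t ∈ Ico 0 T)
    (hst : s ≤ t) : ∫ σ in (0 : ℝ)..s, supNorm (D (ρ σ)) ≤ ∫ σ in (0 : ℝ)..t, supNorm (D (ρ σ)) := by
  have h0 : (0 : ℝ) ∈ Ico 0 T := ⟨le_rfl, h.pos⟩
  rw [← intervalIntegral.integral_add_adjacent_intervals (h.intervalIntegrable_supNorm_D h0 hs)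
    (h.intervalIntegrable_supNorm_D hs ht)]
  exact le_add_of_nonneg_right (intervalIntegral.integral_nonneg hst fun σ _ => supNorm_nonneg _)

/-- The rate is `A (1 + m)` times `(1 + E)(1 + log(1 + E))`, so `log(1 + log(1 + E))` grows at most
at rate `A (1 + m)`, whose integral is bounded. The energy is then bounded by a double exponential.
-/
theorem energy_le_of_integral_le (h : IsSol g a T ρ) {B : ℝ}
    (hB : ∀ t ∈ Ico 0 T, ∫ s in (0 : ℝ)..t, supNorm (D (ρ s)) ≤ B) :
    ∃ R, 0 < R ∧ ∀ t ∈ Ico 0 T, energy (ρ t) ≤ R := by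
  obtain ⟨A, hA0, hA⟩ := energy_rate_le g a
  set m : ℝ → ℝ := fun t => supNorm (D (ρ t)) with hm
  have hmc : ContinuousOn m (Ico 0 T) := h.continuousOn_supNorm_D
  set L : ℝ → ℝ := fun t => Real.log (1 + Real.log (1 + energy (ρ t))) with hL
  have hF0 : ∀ t, 0 ≤ Real.log (1 + energy (ρ t)) := fun t =>
    Real.log_nonneg (by linarith [energy_nonneg (ρ t)])
  have hLder : ∀ t ∈ Ico 0 T, ∃ L', HasDerivWithinAt L L' (Ico 0 T) t ∧ L' ≤ A * (1 + m t) := by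
    intro t ht
    have hE0 := energy_nonneg (ρ t)
    have hE := (h.hasTD t ht).energy
    have hF := (hE.const_add 1).log (by positivity)
    have h1F : 1 + Real.log (1 + energy (ρ t)) ≠ 0 := by linarith [hF0 t]
    refine ⟨_, (hF.const_add 1).log h1F, ?_⟩
    rw [div_div, div_le_iff₀ (mul_pos (by positivity) (by linarith [hF0 t]))]
    refine (hA (ρ t)).trans (le_of_eq ?_)
    ring
  have hLle : ∀ t ∈ Ico 0 T, L t ≤ L 0 + A * (T + B) := by
    intro t ht
    have hsub : Icc 0 t ⊆ Ico 0 T := fun s hs => ⟨hs.1, hs.2.trans_lt ht.2⟩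
    have hprim : ContinuousOn (fun s => ∫ σ in (0 : ℝ)..s, m σ) (Icc 0 t) := by
      have := intervalIntegral.continuousOn_primitive_interval (μ := volume) (f := m) (a := 0) (b := t)
      rw [uIcc_of_le ht.1] at this
      exact this (hmc.mono hsub).integrableOn_Icc
    choose! L' hL' hL'le using hLder
    have hanti : AntitoneOn (fun s => L s - A * (s + ∫ σ in (0 : ℝ)..s, m σ)) (Icc 0 t) := by
      refine antitoneOn_of_hasDerivWithinAt_nonpos (convex_Icc 0 t)
        (f' := fun s => L' s - A * (1 + m s)) ?_ (fun s hs => ?_) fun s hs => ?_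
      · exact ContinuousOn.sub (fun s hs => ((hL' s (hsub hs)).continuousWithinAt).mono hsub)
          (continuousOn_const.mul (continuousOn_id.add hprim))
      · have hs' := hsub (interior_subset hs)
        rw [interior_Icc] at hs ⊢
        have hsT : s ∈ Ioo 0 T := ⟨hs.1, hs'.2⟩
        have h1 : HasDerivAt (fun s => ∫ σ in (0 : ℝ)..s, m σ) (m s) s :=
          intervalIntegral.integral_hasDerivAt_right
            (h.intervalIntegrable_supNorm_D ⟨le_rfl, h.pos⟩ hs')
            ((hmc.mono Ioo_subset_Ico_self).stronglyMeasurableAtFilter isOpen_Ioo s hsT)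
            ((hmc.mono Ioo_subset_Ico_self).continuousAt (isOpen_Ioo.mem_nhds hsT))
        exact ((hL' s hs').mono fun σ hσ => hsub (Ioo_subset_Icc_self hσ)).fun_sub
          ((((hasDerivAt_id s).fun_add h1).const_mul A).hasDerivWithinAt)
      · have := hL'le s (hsub (interior_subset hs))
        linarith
    have := hanti (left_mem_Icc.2 ht.1) (right_mem_Icc.2 ht.1) ht.1
    simp only [intervalIntegral.integral_same, add_zero, mul_zero, sub_zero] at this
    have h2 : A * (t + ∫ σ in (0 : ℝ)..t, m σ) ≤ A * (T + B) :=
      mul_le_mul_of_nonneg_left (add_le_add ht.2.le (hB t ht)) hA0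
    linarith
  refine ⟨Real.exp (Real.exp (L 0 + A * (T + B))), Real.exp_pos _, fun t ht => ?_⟩
  have hE0 := energy_nonneg (ρ t)
  have h1 : 1 + Real.log (1 + energy (ρ t)) ≤ Real.exp (L 0 + A * (T + B)) := by
    rw [← Real.log_le_iff_le_exp (by linarith [hF0 t])]
    exact hLle t ht
  have h2 : 1 + energy (ρ t) ≤ Real.exp (Real.exp (L 0 + A * (T + B))) := by
    rw [← Real.log_le_iff_le_exp (by positivity)]
    linarith
  linarith

end IsSol

theorem HasTD.mono_of_mem {F : ℝ → SP} {G : SP} {I J : Set ℝ} {t : ℝ} (h : HasTD F G I t)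
    (hJ : I ∈ 𝓝[J] t) : HasTD F G J t := fun k => (h k).mono_of_mem_nhdsWithin hJ

theorem HasTD.union {F : ℝ → SP} {G : SP} {I J : Set ℝ} {t : ℝ} (hI : HasTD F G I t)
    (hJ : HasTD F G J t) : HasTD F G (I ∪ J) t := fun k => (hI k).union (hJ k)

theorem HasTD.comp_sub_const {F : ℝ → SP} {G : SP} {b c t : ℝ} (s : ℝ)
    (h : HasTD F G (Icc b c) (t - s)) : HasTD (fun σ => F (σ - s)) G (Icc (s + b) (s + c)) t :=
  fun k => by
    have hm : MapsTo (fun σ => σ - s) (Icc (s + b) (s + c)) (Icc b c) := fun σ hσ =>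
      ⟨by linarith [hσ.1], by linarith [hσ.2]⟩
    have := (h k).scomp t ((hasDerivAt_id t).sub_const s).hasDerivWithinAt hm
    rwa [one_smul] at this

/-- A solution followed by a solution with matching initial value is a solution. -/
theorem IsSol.concat {g a T s τ : ℝ} {ρ r : ℝ → SP} (h : IsSol g a T ρ) (hs : s ∈ Ico 0 T)
    (hτ : 0 < τ) (hr0 : r 0 = ρ s) (hr : ∀ t ∈ Icc 0 τ, IsEven (r t) ∧
      HasTD r (nonlin g a (r t)) (Icc 0 τ) t) :
    IsSol g a (s + τ) fun t => if t ≤ s then ρ t else r (t - s) := by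
  set q : ℝ → SP := fun t => if t ≤ s then ρ t else r (t - s) with hq
  have hq1 : ∀ t ≤ s, q t = ρ t := fun t ht => if_pos ht
  have hq2 : ∀ t, s ≤ t → q t = r (t - s) := fun t ht => by
    rcases ht.eq_or_lt with rfl | ht
    · rw [hq1 s le_rfl, sub_self, hr0]
    · exact if_neg ht.not_ge
  have hleft : ∀ t ∈ Icc 0 s, HasTD q (nonlin g a (q t)) (Icc 0 s) t := fun t ht => by
    rw [hq1 t ht.2]
    refine ((h.hasTD t ⟨ht.1, ht.2.trans_lt hs.2⟩).mono fun σ hσ =>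
      ⟨hσ.1, hσ.2.trans_lt hs.2⟩).congr_of_eventuallyEq ?_ (hq1 t ht.2)
    filter_upwards [self_mem_nhdsWithin] with σ hσ using hq1 σ hσ.2
  have hright : ∀ t ∈ Icc s (s + τ), HasTD q (nonlin g a (q t)) (Icc s (s + τ)) t := fun t ht => by
    rw [hq2 t ht.1]
    have := HasTD.comp_sub_const s (hr (t - s) ⟨by linarith [ht.1], by linarith [ht.2]⟩).2
    rw [add_zero] at this
    refine this.congr_of_eventuallyEq ?_ (hq2 t ht.1)
    filter_upwards [self_mem_nhdsWithin] with σ hσ using hq2 σ hσ.1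
  refine ⟨by linarith [hs.1], fun t ht => ?_, fun t ht => ?_⟩
  · rcases le_total t s with hts | hts
    · rw [hq1 t hts]
      exact h.even t ⟨ht.1, hts.trans_lt hs.2⟩
    · rw [hq2 t hts]
      exact (hr (t - s) ⟨by linarith, by linarith [ht.2]⟩).1
  · rcases lt_trichotomy t s with hts | rfl | hts
    · refine (hleft t ⟨ht.1, hts.le⟩).mono_of_mem ?_
      filter_upwards [self_mem_nhdsWithin, mem_nhdsWithin_of_mem_nhds (Iio_mem_nhds hts)] with σ h1 h2
      exact ⟨h1.1, le_of_lt h2⟩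
    · refine ((hleft t ⟨ht.1, le_rfl⟩).union (hright t ⟨le_rfl, ht.2.le⟩)).mono fun σ hσ => ?_
      rcases le_total σ t with h1 | h1
      · exact Or.inl ⟨hσ.1, h1⟩
      · exact Or.inr ⟨h1, hσ.2.le⟩
    · refine (hright t ⟨hts.le, ht.2.le⟩).mono_of_mem ?_
      filter_upwards [self_mem_nhdsWithin, mem_nhdsWithin_of_mem_nhds (Ioi_mem_nhds hts)] with σ h1 h2
      exact ⟨le_of_lt h2, h1.2.le⟩

theorem exists_isSol (g a : ℝ) {ρ₀ : SP} (heven : IsEven ρ₀) :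
    ∃ T ρ, IsSol g a T ρ ∧ ρ 0 = ρ₀ := by
  have hR : 0 < energy ρ₀ + 1 := by linarith [energy_nonneg ρ₀]
  obtain ⟨r, hr0, hr⟩ := exists_local_solution g a hR heven (by linarith)
  exact ⟨lifespan g (energy ρ₀ + 1), r, ⟨lifespan_pos g hR, fun t ht => (hr t ⟨ht.1, ht.2.le⟩).1,
    fun t ht => (hr t ⟨ht.1, ht.2.le⟩).2.mono Ico_subset_Icc_self⟩, hr0⟩

/-- Continuation: a solution with bounded `∫ ‖∂ₓ ρ‖_∞` extends beyond its time of existence. -/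
theorem IsSol.exists_extension {g a T : ℝ} {ρ : ℝ → SP} (h : IsSol g a T ρ) {B : ℝ}
    (hB : ∀ t ∈ Ico 0 T, ∫ s in (0 : ℝ)..t, supNorm (D (ρ s)) ≤ B) :
    ∃ T' > T, ∃ r, IsSol g a T' r ∧ r 0 = ρ 0 := by
  obtain ⟨R, hR, hE⟩ := h.energy_le_of_integral_le hB
  have hτ := lifespan_pos g hR
  -- Restarting less than one lifespan before `T` carries the solution beyond `T`; the energy bound
  -- `R` makes that lifespan independent of the restart time.
  obtain ⟨s, hs1, hs2⟩ := exists_between (max_lt h.pos (sub_lt_self T hτ))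
  have hs : s ∈ Ico 0 T := ⟨(le_max_left _ _).trans hs1.le, hs2⟩
  obtain ⟨r, hr0, hr⟩ := exists_local_solution g a hR (h.even s hs) (hE s hs)
  refine ⟨s + lifespan g R, ?_, _, h.concat hs hτ hr0 hr, if_pos hs.1⟩
  linarith [(le_max_right _ _).trans_lt hs1]

/-! ### The maximal solution -/

theorem IsSol.eq_of_eq_zero {g a T T' : ℝ} {ρ r : ℝ → SP} (h : IsSol g a T ρ) (h' : IsSol g a T' r)
    (h0 : r 0 = ρ 0) {t : ℝ} (ht : t ∈ Ico 0 T) (ht' : t < T') : ρ t = r t :=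
  DFunLike.coe_injective (h.isSmoothSolution.eq_of_isSol h' (by rw [h0]) ht ht')

theorem exists_maximal_isSol {g a B : ℝ} {ρ₀ : SP} (heven : IsEven ρ₀)
    (hB : ∀ T ρ, IsSol g a T ρ → ρ 0 = ρ₀ → T ≤ B) :
    ∃ T ρ, IsSol g a T ρ ∧ ρ 0 = ρ₀ ∧ ∀ T' r, IsSol g a T' r → r 0 = ρ₀ → T' ≤ T := by
  set S : Set ℝ := {T | ∃ ρ, IsSol g a T ρ ∧ ρ 0 = ρ₀} with hS
  have hbdd : BddAbove S := ⟨B, fun T ⟨ρ, h, h0⟩ => hB T ρ h h0⟩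
  obtain ⟨T₁, ρ₁, h₁, h₁0⟩ := exists_isSol g a heven
  have hne : S.Nonempty := ⟨T₁, ρ₁, h₁, h₁0⟩
  have hex : ∀ t, t < sSup S → ∃ T ρ, t < T ∧ IsSol g a T ρ ∧ ρ 0 = ρ₀ := fun t ht => by
    obtain ⟨T, ⟨ρ, h, h0⟩, htT⟩ := exists_lt_of_lt_csSup hne ht
    exact ⟨T, ρ, htT, h, h0⟩
  choose! τ r hτ hr hr0 using hex
  have hpos : 0 < sSup S := h₁.pos.trans_le (le_csSup hbdd ⟨ρ₁, h₁, h₁0⟩)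
  have hle : ∀ t, t < sSup S → τ t ≤ sSup S := fun t ht => le_csSup hbdd ⟨r t, hr t ht, hr0 t ht⟩
  have heq : ∀ t < sSup S, ∀ s ∈ Ico 0 (τ t), r s s = r t s := fun t ht s hs => by
    have hs' := hs.2.trans_le (hle t ht)
    exact (hr s hs').eq_of_eq_zero (hr t ht) ((hr0 t ht).trans (hr0 s hs').symm)
      ⟨hs.1, hτ s hs'⟩ hs.2
  -- At each time use any solution alive past it. By uniqueness this diagonal curve coincides near
  -- `t` with the single solution `r t`, so the supremum is attained.
  refine ⟨sSup S, fun t => r t t, ⟨hpos, fun t ht => ?_, fun t ht => ?_⟩, hr0 0 hpos,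
    fun T' ρ' h h0 => le_csSup hbdd ⟨ρ', h, h0⟩⟩
  · exact (hr t ht.2).even t ⟨ht.1, hτ t ht.2⟩
  · have hev : ∀ᶠ s in 𝓝[Ico 0 (sSup S)] t, s ∈ Ico 0 (τ t) := by
      filter_upwards [self_mem_nhdsWithin,
        mem_nhdsWithin_of_mem_nhds (Iio_mem_nhds (hτ t ht.2))] with s h1 h2 using ⟨h1.1, h2⟩
    exact (((hr t ht.2).hasTD t ⟨ht.1, hτ t ht.2⟩).mono_of_mem hev).congr_of_eventuallyEq
      (hev.mono fun s hs => heq t ht.2 s hs) rfl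

end SP

/-! ### Blow-up at the maximal time -/

namespace SP

/-- For a solution that cannot be extended, `∫ ‖∂ₓ ρ‖_∞` is unbounded. -/
theorem IsSol.exists_lt_integral {g a T : ℝ} {ρ : ℝ → SP} (h : IsSol g a T ρ)
    (hmax : ∀ T' r, IsSol g a T' r → r 0 = ρ 0 → T' ≤ T) (B : ℝ) :
    ∃ t ∈ Ico 0 T, B < ∫ s in (0 : ℝ)..t, supNorm (D (ρ s)) := by
  by_contra! hcon
  obtain ⟨T', hT', r, hr, hr0⟩ := h.exists_extension hcon
  exact (hmax T' r hr hr0).not_gt hT'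

theorem IsSol.tendsto_integral {g a T : ℝ} {ρ : ℝ → SP} (h : IsSol g a T ρ)
    (hmax : ∀ T' r, IsSol g a T' r → r 0 = ρ 0 → T' ≤ T) :
    Tendsto (fun t => ∫ s in (0 : ℝ)..t, supNorm (D (ρ s))) (𝓝[<] T) atTop := by
  refine tendsto_atTop.2 fun B => ?_
  obtain ⟨t, ht, htB⟩ := h.exists_lt_integral hmax B
  filter_upwards [Ioo_mem_nhdsLT ht.2] with s hs
  exact htB.le.trans (h.integral_supNorm_D_mono ht ⟨ht.1.trans hs.1.le, hs.2⟩ hs.1.le)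

/-- No smooth solution lives longer than a solution that cannot be extended. -/
theorem IsSol.le_of_isSmoothSolution {g a T T' : ℝ} {ρ : ℝ → SP} {ρ₀ : ℝ → ℝ} {r : ℝ → ℝ → ℝ}
    (h : IsSol g a T ρ) (h0 : ⇑(ρ 0) = ρ₀) (hmax : ∀ T' r, IsSol g a T' r → r 0 = ρ 0 → T' ≤ T)
    (hr : IsSmoothSolution a g ρ₀ T' r) : T' ≤ T := by
  by_contra! hlt
  obtain ⟨M, hM⟩ := hr.exists_supNorm_le hlt
  -- A smooth solution past `T` would have bounded `∂ₓ` on `[0, T]` and agree with `ρ` before `T`,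
  -- which keeps the integral below `|M| |T|`.
  obtain ⟨t, ht, htB⟩ := h.exists_lt_integral hmax (|M| * |T|)
  refine htB.not_ge ?_
  have hle : ∀ s ∈ uIoc 0 t, ‖supNorm (D (ρ s))‖ ≤ |M| := fun s hs => by
    rw [uIoc_of_le ht.1] at hs
    have hsT : s < T := hs.2.trans_lt ht.2
    have hs' : s ∈ Ico 0 T' := ⟨hs.1.le, hsT.trans hlt⟩
    have heq : toCurve r s = ρ s := DFunLike.coe_injective <| by
      rw [coe_toCurve (hr.isSmoothPeriodic hs'), hr.eq_of_isSol h h0 hs' hsT]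
    rw [Real.norm_of_nonneg (supNorm_nonneg _), ← heq]
    exact (hM s ⟨hs.1.le, hsT.le⟩).trans (le_abs_self M)
  have := intervalIntegral.norm_integral_le_of_norm_le_const hle
  rw [sub_zero] at this
  refine (le_abs_self _).trans (this.trans (mul_le_mul_of_nonneg_left ?_ (abs_nonneg M)))
  exact abs_le_abs_of_nonneg ht.1 ht.2.le

end SP

theorem theorem1p1 (a g : ℝ) (ha : 0 < a) (hg : 0 < g) (ρ₀ : ℝ → ℝ)
    (hρ₀ : IsSmoothPeriodic ρ₀)
    (hnonzero : ∃ x, ρ₀ x ≠ 0)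
    (hnonneg : ∀ x, 0 ≤ ρ₀ x)
    (heven : ∀ x, ρ₀ (-x) = ρ₀ x)
    (hzero : ρ₀ 0 = 0)
    (hmono : ∀ x ∈ Ico 0 Real.pi, 0 ≤ deriv ρ₀ x) :
    ∃ (T : ℝ) (ρ : ℝ → ℝ → ℝ),
      -- `ρ` is a smooth solution on `[0, T)`, where `0 < T < ∞`
      IsSmoothSolution a g ρ₀ T ρ ∧
      -- uniqueness, and `[0, T)` is the maximal interval of existence
      (∀ (T' : ℝ) (ρ' : ℝ → ℝ → ℝ), IsSmoothSolution a g ρ₀ T' ρ' →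
        T' ≤ T ∧ ∀ t ∈ Ico 0 T', ∀ x, ρ' t x = ρ t x) ∧
      -- nonnegativity and boundedness before `T`
      (∀ t ∈ Ico 0 T, ∀ x, 0 ≤ ρ t x) ∧
      (∃ M : ℝ, ∀ t ∈ Ico 0 T, ∀ x, |ρ t x| ≤ M) ∧
      -- blow-up
      Tendsto (fun t : ℝ => ∫ s in (0 : ℝ)..t, supNorm (fun x => deriv (ρ s) x))
        (𝓝[<] T) atTop ∧
      -- there is no smooth solution for all time
      ¬ ∃ ρ' : ℝ → ℝ → ℝ, ∀ T' : ℝ, 0 < T' → IsSmoothSolution a g ρ₀ T' ρ' := by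
  set r₀ : SP := SP.mk ρ₀ hρ₀ with hr₀
  have hE : SP.IsEven r₀ := heven
  have h00 : r₀ 0 = 0 := hzero
  have hD : ∀ x ∈ Icc 0 Real.pi, 0 ≤ SP.D r₀ x := fun x hx => by
    rcases hx.2.lt_or_eq with h | rfl
    · exact hmono x ⟨hx.1, h⟩
    -- The hypothesis omits the endpoint `π`, where evenness and periodicity make the derivative
    -- vanish.
    · exact hE.D_pi.ge
  obtain ⟨x, hx⟩ := hnonzero
  obtain ⟨y, hy, hxy⟩ := hE.exists_mem_Icc x
  have hJ : 0 < SP.J r₀ := SP.J_pos hD h00 hy (by rw [← hxy]; exact hx)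
  obtain ⟨T, ρ, hρ, hρ0, hmax⟩ := SP.exists_maximal_isSol (g := g) (a := a) hE
    (B := 1 / (SP.riccati g a * SP.J r₀)) fun T ρ h h0 => by
      rw [← h0] at hD h00 hJ ⊢
      exact h.le_of_J_pos hg ha hD h00 hJ
  rw [← hρ0] at hmax
  have hcoe : ⇑(ρ 0) = ρ₀ := by rw [hρ0]; rfl
  have huniq : ∀ (T' : ℝ) (ρ' : ℝ → ℝ → ℝ), IsSmoothSolution a g ρ₀ T' ρ' →
      T' ≤ T ∧ ∀ t ∈ Ico 0 T', ∀ x, ρ' t x = ρ t x := fun T' ρ' h' => by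
    have hle := hρ.le_of_isSmoothSolution hcoe hmax h'
    exact ⟨hle, fun t ht x => congrFun (h'.eq_of_isSol hρ hcoe ht (ht.2.trans_le hle)) x⟩
  have hbd : ∀ t ∈ Ico 0 T, ∀ x, ρ t x ∈ Icc 0 (ρ₀ Real.pi) := fun t ht x => by
    have := hρ.mem_Icc (by rw [hρ0]; exact hD) ht x
    rwa [hcoe, hzero] at this
  refine ⟨T, fun t => ρ t, ?_, huniq, fun t ht x => (hbd t ht x).1,
    ⟨ρ₀ Real.pi, fun t ht x => ?_⟩, hρ.tendsto_integral hmax, ?_⟩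
  · have := hρ.isSmoothSolution
    rwa [hcoe] at this
  · rw [abs_of_nonneg (hbd t ht x).1]
    exact (hbd t ht x).2
  · rintro ⟨ρ', h'⟩
    -- A global solution would be one on `[0, T + 1)`, against maximality.
    have h1 := (huniq (T + 1) ρ' (h' (T + 1) (by linarith [hρ.pos]))).1
    linarith
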